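/- For integers $0\le m\le n$ let $P_n(x)=\frac{1}{2^n n!}\frac{d^n}{dx^n}(x^2-1)^n$ be the Legendre polynomial, let $F_n^m=P_n^{(m)}/P_n^{(m)}(1)$, and let $Y_n^m$ be the spherical harmonic on the unit sphere $S^2\subset\mathbb R^3$ given in spherical coordinates by $$Y_n^m(\theta,\phi)=\sin^m\theta\;F_n^m(\cos\theta)\,\sin(m\phi).$$ For $f:S^2\to\mathbb R$ let the nodal set be $f^{-1}(0)$, and let $\mathrm{ov}(f)$ be its number of connected components. The nodal set is called non-singular if it is a union of finitely many pairwise disjoint closed (i.e. compact, connected, embedded) real-analytic curves. Theorem. There are $N$ and, for each $n\ge N$, a number $\epsilon_n>0$ and a rotation $R_n\in\mathrm{SO}(3)$ such that the following hold. (a) For every $n\ge N$ and every $\epsilon$ with $0<\epsilon<\epsilon_n$, the nodal set of $Y_n^{[n/2]}+\epsilon\, Y_n^{n-1}\circ R_n$ (if $n$ is odd), respectively of $Y_n^{n/2}+\epsilon\, Y_n^{n}\circ R_n$ (if $n$ is even), is non-singular. (b) For every choice of numbers $\epsilon(n)$ with $0<\epsilon(n)<\epsilon_n$ for all $n\ge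 N$, $$\lim_{\substack{n\to\infty\\ n\text{ odd}}}\frac{\mathrm{ov}\bigl(Y_n^{[n/2]}+\epsilon(n)\, Y_n^{n-1}\circ R_n\bigr)}{n^2/4}=1, \qquad \lim_{\substack{n\to\infty\\ n\text{ even}}}\frac{\mathrm{ov}\bigl(Y_n^{n/2}+\epsilon(n)\, Y_n^{n}\circ R_n\bigr)}{n^2/4}=1.$$ -/

import Mathlib

open Filter Topology

namespace NodalOvals

noncomputable section

/-- Euclidean three-space. -/
abbrev E3 : Type := EuclideanSpace ℝ (Fin 3)

/-- The unit sphere in `ℝ³`. -/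
abbrev S2 : Type := Metric.sphere (0 : E3) 1

/-- The Legendre polynomial `P_n`, by Rodrigues' formula
`P_n = (2 ^ n n!)⁻¹ (d/dx)^n (x² - 1)^n`. -/
def legendreP (n : ℕ) : Polynomial ℝ :=
  Polynomial.C ((2 ^ n * (n.factorial : ℝ))⁻¹) *
    Polynomial.derivative^[n] ((Polynomial.X ^ 2 - 1) ^ n)

/-- `F_n^m`: the `m`-th derivative of `P_n`, normalized to take the value `1` at `1`
(for `m ≤ n` that derivative is positive at `1`). -/
def legendreF (n m : ℕ) (x : ℝ) : ℝ :=
  (Polynomial.derivative^[m] (legendreP n)).eval x /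
    (Polynomial.derivative^[m] (legendreP n)).eval 1

/-- The standard spherical harmonic `Y_n^m (θ, φ) = sin^m θ · F_n^m (cos θ) · sin (m φ)`, written
in Cartesian coordinates through `Im ((x + i y) ^ m) = sin^m θ · sin (m φ)`;
see `sphHarm_sphPoint`. -/
def sphHarm (n m : ℕ) (p : S2) : ℝ :=
  (((⟨(p : E3) 0, (p : E3) 1⟩ : ℂ) ^ m).im) * legendreF n m ((p : E3) 2)

/-- The point of the sphere with polar angle `θ` and azimuth `φ`. -/
def sphPoint (θ φ : ℝ) : S2 :=
  ⟨!₂[Real.sin θ * Real.cos φ, Real.sin θ * Real.sin φ, Real.cos θ], by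
    rw [mem_sphere_zero_iff_norm, EuclideanSpace.norm_eq, Real.sqrt_eq_one]
    simp only [Real.norm_eq_abs, sq_abs, Fin.sum_univ_three]
    simp
    nlinarith [Real.sin_sq_add_cos_sq θ, Real.sin_sq_add_cos_sq φ]⟩

theorem sphHarm_sphPoint (n m : ℕ) (θ φ : ℝ) :
    sphHarm n m (sphPoint θ φ) =
      Real.sin θ ^ m * legendreF n m (Real.cos θ) * Real.sin (m * φ) := by
  have h : (⟨Real.sin θ * Real.cos φ, Real.sin θ * Real.sin φ⟩ : ℂ) =
      (Real.sin θ : ℂ) * (Complex.cos φ + Complex.sin φ * Complex.I) := by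
    rw [← Complex.ofReal_cos, ← Complex.ofReal_sin]
    apply Complex.ext
    · rw [Complex.re_ofReal_mul]
      simp only [Complex.add_re, Complex.ofReal_re, Complex.re_ofReal_mul, Complex.I_re, mul_zero,
        add_zero]
    · rw [Complex.im_ofReal_mul]
      simp only [Complex.add_im, Complex.ofReal_im, Complex.im_ofReal_mul, Complex.I_im, mul_one,
        zero_add]
  have h2 : (((⟨Real.sin θ * Real.cos φ, Real.sin θ * Real.sin φ⟩ : ℂ) ^ m).im) =
      Real.sin θ ^ m * Real.sin (m * φ) := by
    rw [h, mul_pow, Complex.cos_add_sin_mul_I_pow, ← Complex.ofReal_pow,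
      Complex.im_ofReal_mul]
    congr 1
    rw [← Complex.ofReal_natCast, ← Complex.ofReal_mul, ← Complex.ofReal_cos,
      ← Complex.ofReal_sin]
    simp only [Complex.add_im, Complex.ofReal_im, Complex.im_ofReal_mul, Complex.I_im, mul_one,
      zero_add]
  change ((⟨Real.sin θ * Real.cos φ, Real.sin θ * Real.sin φ⟩ : ℂ) ^ m).im *
    legendreF n m (Real.cos θ) = _
  rw [h2]
  ring

/-- The rotation group `SO(3)`. -/
abbrev SO3 : Type := Matrix.specialOrthogonalGroup (Fin 3) ℝ

/-- The action of a rotation on the sphere, `p ↦ R p`. -/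
def rotate (R : SO3) (p : S2) : S2 :=
  ⟨WithLp.toLp 2 ((R : Matrix (Fin 3) (Fin 3) ℝ).mulVec (WithLp.ofLp (p : E3))), by
    have hR : (R : Matrix (Fin 3) (Fin 3) ℝ).transpose * (R : Matrix (Fin 3) (Fin 3) ℝ) = 1 :=
      (Matrix.mem_orthogonalGroup_iff' (Fin 3) ℝ).1
        (Matrix.mem_specialOrthogonalGroup_iff.1 R.2).1
    have hp : ‖(p : E3)‖ ^ 2 = 1 := by
      rw [mem_sphere_zero_iff_norm.1 p.2, one_pow]
    rw [mem_sphere_zero_iff_norm, ← sq_eq_sq₀ (norm_nonneg _) zero_le_one, one_pow]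
    have key : ∀ v : Fin 3 → ℝ, ‖(WithLp.toLp 2 v : E3)‖ ^ 2 = v ⬝ᵥ v := by
      intro v
      rw [EuclideanSpace.norm_sq_eq]
      simp [dotProduct, sq]
    rw [key, Matrix.dotProduct_mulVec, Matrix.vecMul_mulVec, hR, ← Matrix.dotProduct_mulVec,
      Matrix.one_mulVec, ← key]
    exact hp⟩

/-- The nodal set (zero set) of a function on the sphere. -/
def nodalSet (f : S2 → ℝ) : Set S2 := {p | f p = 0}

/-- `ov f`: the number of connected components of the nodal set (`0` if there are infinitely
many, which is impossible for a non-singular nodal set). -/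
def ov (f : S2 → ℝ) : ℕ := Nat.card (ConnectedComponents (nodalSet f))

/-- A closed analytic curve in space: a compact connected one-dimensional real-analytic embedded
submanifold, that is, a compact connected set which near each of its points is an
analytically and regularly embedded open arc. -/
structure IsClosedAnalyticCurve (C : Set E3) : Prop where
  isCompact : IsCompact C
  isConnected : IsConnected C
  exists_arc : ∀ p ∈ C, ∃ U : Set E3, IsOpen U ∧ p ∈ U ∧ ∃ γ : ℝ → E3,
    AnalyticOnNhd ℝ γ (Set.Ioo (-1) 1) ∧
    (∀ t ∈ Set.Ioo (-1 : ℝ) 1, deriv γ t ≠ 0) ∧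
    IsEmbedding ((Set.Ioo (-1 : ℝ) 1).domRestrict γ) ∧
    γ '' Set.Ioo (-1) 1 = C ∩ U

/-- The nodal set of `f` is non-singular: it is the union of finitely many pairwise disjoint
closed analytic curves. -/
def NonSingularNodalSet (f : S2 → ℝ) : Prop :=
  ∃ 𝒞 : Set (Set E3), 𝒞.Finite ∧ 𝒞.PairwiseDisjoint id ∧
    (∀ C ∈ 𝒞, IsClosedAnalyticCurve C) ∧ ⋃₀ 𝒞 = Subtype.val '' nodalSet f

/-- `Y_n^m + ε · Y_n^l ∘ R`. -/
def perturbed (n m l : ℕ) (ε : ℝ) (R : SO3) : S2 → ℝ :=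
  fun p => sphHarm n m p + ε * sphHarm n l (rotate R p)

end

end NodalOvals

/-! Put m = ⌊n/2⌋. The nodal set of Y_n^m is a grid of n - m circles of latitude and 2m meridians;
it cuts the sphere into n - m + 1 rows of 2m cells, with signs alternating as on a chessboard. In
both parities of n the perturbing harmonic has order l = 2m, so its factor sin(lφ) has the same
phase on all 2m meridians. A shift in longitude makes the common value positive, and F_n^l is the
constant 1 or the identity, so at the vertices of the grid the sign of the perturbation depends on
the latitude only. A further small tilt makes the perturbation nonzero at the poles and at vertices
on the equator without spoiling the other signs (`exists_rotation`).

For small ε > 0 every crossing is resolved according to the sign of the perturbation at the vertex: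
the nodal curve rounds off the corner of those cells whose sign is the opposite one. In a row all of
whose corners carry the same sign, every second cell is cut off at its four corners and yields one
oval, hence m ovals in the row. Only the two polar rows and at most two rows where F_n^l changes
sign can fail to be of this kind. This gives m(n - m) + O(m) components, which is asymptotic to
n²/4.

The perturbation may vanish on an edge, so the nodal curve may wander across it, and at the poles
the unperturbed function vanishes to order m. The local analysis therefore uses triangles ("kites")
spanned by the centre of a cell, a vertex, and the centre of the cell beyond the edge; at a pole the
third point is replaced by the foot on the edge. Seen from the centre of a cell that is rounded off
at the vertex, the perturbed function is radially monotone at its zeros, so each ray meets the nodal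
set exactly once and the arc in the kite is connected and regular (`eventually_kiteZeros`,
`KiteZeros.of_radial`). These kites catch all zeros (`Grid.exists_active`). The kites of a cell form
a diamond whose boundary is free of zeros when all four corners are active. Such diamonds bound the
number of components from below, and covering the nodal set by connected arcs bounds it from above
(`Grid.ov_bounds`). Regularity of the arcs gives non-singularity through the inverse function
theorem (`nonSingularNodalSet_of_regular`). -/

namespace NodalOvals

/-! ### The nodal arc in a single kite -/

/-- A differentiable function whose derivative is positive at its zeros has at most one zero on an
interval. -/
theorem eq_of_zeros_of_deriv_pos {ψ ψ' : ℝ → ℝ} {s t : ℝ} (hst : s ≤ t)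
    (hd : ∀ x ∈ Set.Icc s t, HasDerivAt ψ (ψ' x) x)
    (hpos : ∀ x ∈ Set.Icc s t, ψ x = 0 → 0 < ψ' x) (hs : ψ s = 0) (ht : ψ t = 0) : s = t := by
  by_contra hne
  have hlt : s < t := lt_of_le_of_ne hst hne
  -- Starting from 0 at `s`, `ψ` can never become negative, whereas the positive derivative at `t`
  -- forces negative values just to the left of `t`.
  have key : ∀ ⦃x : ℝ⦄, x ∈ Set.Icc s t → -ψ x ≤ 0 := by
    apply image_le_of_deriv_right_lt_deriv_boundary (f := fun x => -ψ x) (f' := fun x => -ψ' x)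
      (B := fun _ => 0) (B' := fun _ => 0)
    · exact fun x hx => (hd x hx).neg.continuousAt.continuousWithinAt
    · exact fun x hx => (hd x ⟨hx.1, hx.2.le⟩).neg.hasDerivWithinAt
    · simp [hs]
    · exact fun x => hasDerivAt_const x 0
    · intro x hx h0
      have := hpos x ⟨hx.1, hx.2.le⟩ (by simpa using h0)
      simpa using this
  have hdt := hd t ⟨hst, le_rfl⟩
  have hpt := hpos t ⟨hst, le_rfl⟩ ht
  have h1 : ∀ᶠ x in 𝓝[<] t, 0 < slope ψ t x := by
    have := hasDerivAt_iff_tendsto_slope.1 hdt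
    exact (this.mono_left (nhdsWithin_mono _ (fun x hx => ne_of_lt hx))).eventually
      (lt_mem_nhds hpt)
  have h2 : ∀ᶠ x in 𝓝[<] t, x ∈ Set.Ioo s t := Ioo_mem_nhdsLT hlt
  obtain ⟨x, hx1, hx2⟩ := (h1.and h2).exists
  have h3 := key (Set.Ioo_subset_Icc_self hx2)
  rw [slope_def_field, ht, sub_zero] at hx1
  have : ψ x / (x - t) ≤ 0 :=
    div_nonpos_of_nonneg_of_nonpos (by linarith) (by linarith [hx2.2])
  linarith

/-- If `f ≥ 0` on a compact set and `g > 0` where `f = 0`, then `f + ε g > 0` there for all small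
`ε > 0`. -/
theorem eventually_pos_on_compact {X : Type*} [TopologicalSpace X] {K : Set X} (hK : IsCompact K)
    {f g : X → ℝ} (hf : Continuous f) (hg : Continuous g) (h0 : ∀ x ∈ K, 0 ≤ f x)
    (h1 : ∀ x ∈ K, f x = 0 → 0 < g x) :
    ∀ᶠ ε in 𝓝[>] (0 : ℝ), ∀ x ∈ K, 0 < f x + ε * g x := by
  -- Compactness reduces the uniform claim to neighbourhoods of the points (0, y). These also
  -- contain ε ≤ 0 and points off `K`, hence the two premises inside.
  have key : ∀ᶠ ε in 𝓝 (0 : ℝ), ∀ x ∈ K, 0 < ε → x ∈ K → 0 < f x + ε * g x := by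
    apply hK.eventually_forall_of_forall_eventually
    intro y hy
    rcases (h0 y hy).eq_or_lt with h | h
    · have hgy : ∀ᶠ z : ℝ × X in 𝓝 ((0 : ℝ), y), 0 < g z.2 :=
        (hg.comp continuous_snd).continuousAt.eventually (lt_mem_nhds (h1 y hy h.symm))
      filter_upwards [hgy] with z hz hε hzK
      have := h0 _ hzK
      positivity
    · have : ∀ᶠ z : ℝ × X in 𝓝 ((0 : ℝ), y), 0 < f z.2 + z.1 * g z.2 := by
        have hc : Continuous fun z : ℝ × X => f z.2 + z.1 * g z.2 := by fun_prop
        refine hc.continuousAt.eventually (lt_mem_nhds ?_)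
        simpa using h
      filter_upwards [this] with z hz _ _ using hz
  filter_upwards [nhdsWithin_le_nhds key, self_mem_nhdsWithin] with ε hε hpos x hx
    using hε x hx hpos hx

/-- The triangle with vertices `(0, 0)`, `(1 + κ, 0)`, `(1, 1)`. -/
def kite (κ : ℝ) : Set (ℝ × ℝ) := {q | 0 ≤ q.2 ∧ q.2 ≤ q.1 ∧ q.1 + κ * q.2 ≤ 1 + κ}

theorem isCompact_kite {κ : ℝ} (hκ : 0 ≤ κ) : IsCompact (kite κ) := by
  refine (isCompact_Icc (a := ((0 : ℝ), (0 : ℝ))) (b := (1 + κ, 1 + κ))).of_isClosed_subset ?_ ?_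
  · have h1 : IsClosed {q : ℝ × ℝ | 0 ≤ q.2} := isClosed_le (by fun_prop) (by fun_prop)
    have h2 : IsClosed {q : ℝ × ℝ | q.2 ≤ q.1} := isClosed_le (by fun_prop) (by fun_prop)
    have h3 : IsClosed {q : ℝ × ℝ | q.1 + κ * q.2 ≤ 1 + κ} :=
      isClosed_le (by fun_prop) (by fun_prop)
    exact h1.inter (h2.inter h3)
  · rintro ⟨u, v⟩ ⟨h1, h2, h3⟩
    simp only at h1 h2 h3
    have : 0 ≤ κ * v := by positivity
    refine ⟨⟨?_, ?_⟩, ⟨?_, ?_⟩⟩ <;> simp <;> linarith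

/-- The zero set of `h` in the triangle is a regular connected curve that crosses it from the side
`v = 0` to the side `u = v`, avoiding the third side. -/
structure KiteZeros (κ : ℝ) (h : ℝ × ℝ → ℝ) : Prop where
  conn : IsPreconnected {q | q ∈ kite κ ∧ h q = 0}
  regular : ∀ q ∈ kite κ, h q = 0 → fderiv ℝ h q q ≠ 0
  far : ∀ q ∈ kite κ, q.1 + κ * q.2 = 1 + κ → h q ≠ 0
  axis : ∃ t, (t, 0) ∈ kite κ ∧ h (t, 0) = 0
  diag : ∃ t ∈ Set.Icc (0 : ℝ) 1, h (t, t) = 0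

theorem KiteZeros.of_neg {κ : ℝ} {h : ℝ × ℝ → ℝ} (H : KiteZeros κ (fun q => -h q)) :
    KiteZeros κ h where
  conn := by simpa only [neg_eq_zero] using H.conn
  regular q hq h0 := by
    have := H.regular q hq (by simp [h0])
    rw [fderiv_fun_neg] at this
    simpa using this
  far q hq hf := by simpa only [ne_eq, neg_eq_zero] using H.far q hq hf
  axis := by simpa only [neg_eq_zero] using H.axis
  diag := by simpa only [neg_eq_zero] using H.diag

/-- A function which is negative at the origin, positive on the far side and radially increasing at
its zeros vanishes once on each ray of the triangle. -/
theorem KiteZeros.of_radial {κ : ℝ} (hκ : 0 ≤ κ) {h : ℝ × ℝ → ℝ} (hd : Differentiable ℝ h)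
    (h0 : h (0, 0) < 0) (hfar : ∀ q ∈ kite κ, q.1 + κ * q.2 = 1 + κ → 0 < h q)
    (hreg : ∀ q ∈ kite κ, h q = 0 → 0 < fderiv ℝ h q q) : KiteZeros κ h := by
  have hmem : ∀ s ∈ Set.Icc (0 : ℝ) 1, ∀ t ∈ Set.Icc (0 : ℝ) ((1 + κ) / (1 + κ * s)),
      (t, t * s) ∈ kite κ := by
    intro s hs t ht
    have hp : 0 < 1 + κ * s := by nlinarith [hs.1]
    have h1 := (le_div_iff₀ hp).1 ht.2
    refine ⟨mul_nonneg ht.1 hs.1, ?_, ?_⟩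
    · exact mul_le_of_le_one_right ht.1 hs.2
    · simp only; linarith
  have hder : ∀ s t : ℝ, HasDerivAt (fun t : ℝ => h (t, t * s)) (fderiv ℝ h (t, t * s) (1, s)) t := by
    intro s t
    have hg : HasDerivAt (fun t : ℝ => (t, t * s)) ((1 : ℝ), s) t := by
      simpa using (hasDerivAt_id t).prodMk ((hasDerivAt_id t).mul_const s)
    exact (hd (t, t * s)).hasFDerivAt.comp_hasDerivAt t hg
  have hex : ∀ s ∈ Set.Icc (0 : ℝ) 1, ∃ t ∈ Set.Icc (0 : ℝ) ((1 + κ) / (1 + κ * s)),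
      h (t, t * s) = 0 := by
    intro s hs
    have hp : 0 < 1 + κ * s := by nlinarith [hs.1]
    have hT : 0 ≤ (1 + κ) / (1 + κ * s) := by positivity
    have hc : ContinuousOn (fun t : ℝ => h (t, t * s)) (Set.Icc 0 ((1 + κ) / (1 + κ * s))) :=
      fun t _ => (hder s t).continuousAt.continuousWithinAt
    apply intermediate_value_Icc hT hc
    refine ⟨by simpa using h0.le, (hfar _ (hmem s hs _ ⟨hT, le_rfl⟩) ?_).le⟩
    simp only
    field_simp
  have hne : ∀ q ∈ kite κ, h q = 0 → 0 < q.1 := by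
    rintro ⟨u, v⟩ ⟨h1, h2, h3⟩ hz
    simp only at h1 h2 h3 ⊢
    rcases (h1.trans h2).eq_or_lt with h | h
    · subst h
      obtain rfl : v = 0 := le_antisymm h2 h1
      linarith
    · exact h
  refine ⟨?_, fun q hq hz => (hreg q hq hz).ne', fun q hq hf => (hfar q hq hf).ne', ?_, ?_⟩
  · set Z : Set (ℝ × ℝ) := {q | q ∈ kite κ ∧ h q = 0} with hZ
    have hZc : IsCompact Z := (isCompact_kite hκ).inter_right
      (isClosed_eq hd.continuous continuous_const)
    have : CompactSpace Z := isCompact_iff_compactSpace.1 hZc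
    let r : Z → ℝ := fun q => q.1.2 / q.1.1
    have hrc : Continuous r := by
      refine Continuous.div (by fun_prop) (by fun_prop) ?_
      exact fun q => (hne _ q.2.1 q.2.2).ne'
    have hrI : ∀ q, r q ∈ Set.Icc (0 : ℝ) 1 := fun q =>
      ⟨div_nonneg q.2.1.1 (hne _ q.2.1 q.2.2).le, div_le_one_of_le₀ q.2.1.2.1 (hne _ q.2.1 q.2.2).le⟩
    -- Zeros of equal slope lie on one ray, and `fderiv ℝ h q q` is a positive multiple of the
    -- derivative along it, so `eq_of_zeros_of_deriv_pos` identifies them.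
    have hrinj : Function.Injective r := by
      have aux : ∀ q q' : Z, q.1.1 ≤ q'.1.1 → r q = r q' → q = q' := by
        intro q q' hle hqq
        have hq1 := hne _ q.2.1 q.2.2
        have hq1' := hne _ q'.2.1 q'.2.2
        have e1 : ((q.1.1, q.1.1 * r q) : ℝ × ℝ) = q.1 := by
          refine Prod.ext rfl ?_
          simp only [r]
          field_simp
        have e2 : ((q'.1.1, q'.1.1 * r q) : ℝ × ℝ) = q'.1 := by
          rw [hqq]
          refine Prod.ext rfl ?_
          simp only [r]
          field_simp
        have hp : 0 < 1 + κ * r q := by nlinarith [(hrI q).1]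
        have hq2' : q'.1.1 ≤ (1 + κ) / (1 + κ * r q) := by
          rw [le_div_iff₀ hp]
          have := q'.2.1.2.2
          rw [← e2] at this
          simp only at this
          linarith
        have := eq_of_zeros_of_deriv_pos (ψ := fun t => h (t, t * r q))
          (ψ' := fun t => fderiv ℝ h (t, t * r q) (1, r q)) hle (fun t _ => hder _ t) ?_
          (by rw [e1]; exact q.2.2) (by rw [e2]; exact q'.2.2)
        · apply Subtype.ext
          rw [← e1, ← e2, this]
        · intro t ht hz
          have ht0 : 0 < t := hq1.trans_le ht.1
          have := hreg _ (hmem (r q) (hrI q) t ⟨ht0.le, ht.2.trans hq2'⟩) hz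
          have e3 : ((t, t * r q) : ℝ × ℝ) = t • ((1 : ℝ), r q) := by ext <;> simp
          nth_rewrite 2 [e3] at this
          rw [map_smul, smul_eq_mul] at this
          exact (mul_pos_iff_of_pos_left ht0).1 this
      intro q q' hqq
      rcases le_total q.1.1 q'.1.1 with hle | hle
      · exact aux q q' hle hqq
      · exact (aux q' q hle hqq.symm).symm
    -- The slope is a continuous injection of the compact zero set onto [0, 1], hence a closed map,
    -- and connectedness of the interval pulls back.
    have hpre := (isPreconnected_Icc (a := (0 : ℝ)) (b := 1)).preimage_of_isClosedMap hrinj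
      hrc.isClosedMap (by
        intro s hs
        obtain ⟨t, ht, hz⟩ := hex s hs
        refine ⟨⟨(t, t * s), hmem s hs t ht, hz⟩, ?_⟩
        have := hne _ (hmem s hs t ht) hz
        simp only [r] at this ⊢
        field_simp)
    have huniv : r ⁻¹' Set.Icc (0 : ℝ) 1 = Set.univ := Set.eq_univ_of_forall hrI
    rw [huniv] at hpre
    have := hpre.image (Subtype.val) continuous_subtype_val.continuousOn
    rwa [Set.image_univ, Subtype.range_coe] at this
  · obtain ⟨t, ht, hz⟩ := hex 0 (by simp)
    exact ⟨t, by simpa using hmem 0 (by simp) t ht, by simpa using hz⟩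
  · obtain ⟨t, ht, hz⟩ := hex 1 (by simp)
    refine ⟨t, ⟨ht.1, ?_⟩, by simpa using hz⟩
    have := ht.2
    rwa [mul_one, div_self (by positivity)] at this

/-- A `C¹` function, positive on `[0, 1)`, which vanishes at `1` more steeply than any exponential
rate. -/
structure SteepZero (a : ℝ → ℝ) : Prop where
  contDiff : ContDiff ℝ 1 a
  pos : ∀ t, 0 ≤ t → t < 1 → 0 < a t
  zero : a 1 = 0
  steep : ∀ K : ℝ, ∀ᶠ t in 𝓝[<] (1 : ℝ), K * a t ≤ -deriv a t

/-- Below 1 the value of `b` is positive and a large `C` absorbs the derivative; at 1 steepness with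
constant 0 suffices. It keeps the derivative along the edge from spoiling the radial derivative. -/
theorem SteepZero.exists_lower_bound {b : ℝ → ℝ} (hb : SteepZero b) {v : ℝ} (h0 : 0 ≤ v)
    (h1 : v ≤ 1) : ∃ C, ∀ᶠ t in 𝓝 v, t < 1 → -(C * b t) ≤ -deriv b t := by
  rcases h1.eq_or_lt with rfl | h1
  · refine ⟨0, ?_⟩
    have := hb.steep 0
    rw [eventually_nhdsWithin_iff] at this
    filter_upwards [this] with t ht h
    simpa using ht h
  · have hpos := hb.pos v h0 h1
    have hc : Continuous (deriv b) := hb.contDiff.continuous_deriv le_rfl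
    refine ⟨(deriv b v + 1) / b v, ?_⟩
    have hcont : ContinuousAt (fun t => (deriv b v + 1) / b v * b t - deriv b t) v :=
      ((hb.contDiff.continuous.const_mul _ |>.sub hc)).continuousAt
    have := hcont.eventually (lt_mem_nhds (a := (0 : ℝ)) ?_)
    · filter_upwards [this] with t ht _
      linarith
    · beta_reduce
      rw [div_mul_cancel₀ _ hpos.ne']
      linarith

/-- The edge is the line u = 1, the vertex is (1, 1), and signs are normalised so that the cell is
negative and the perturbation `G` is positive at the vertex. In the kite a(u) b(v) vanishes only on
u = 1, so for small ε all zeros are close to that line. Near points of it with G > 0 the zeros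
satisfy a b = ε G > 0, hence u < 1, and there the steep decay of `a` dominates every other term of
the radial derivative. A point of it with G ≤ 0 is neither the vertex nor on a pole, and the
transversal derivative -a'(1) b(v) > 0 survives the perturbation. The alternatives in `hside` are an
edge with a cell beyond it and an edge collapsed to a pole. -/
theorem eventually_kiteZeros {a b : ℝ → ℝ} {G : ℝ × ℝ → ℝ} {κ : ℝ} (ha : SteepZero a)
    (hb : SteepZero b) (hG : ContDiff ℝ 1 G) (hκ : 0 ≤ κ) (hG1 : 0 < G (1, 1))
    (hside : (0 < κ ∧ deriv a 1 < 0 ∧ ∀ t, 1 < t → t ≤ 1 + κ → a t < 0) ∨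
      (κ = 0 ∧ ∀ v ∈ Set.Icc (0 : ℝ) 1, 0 < G (1, v))) :
    ∀ᶠ ε in 𝓝[>] (0 : ℝ), KiteZeros κ (fun q => -(a q.1 * b q.2) + ε * G q) := by
  have hca := ha.contDiff.continuous
  have hcb := hb.contDiff.continuous
  have hcG := hG.continuous
  have hneg : ∀ q ∈ kite κ, q.1 < 1 → 0 < a q.1 ∧ 0 < b q.2 := fun q hq h =>
    ⟨ha.pos _ (hq.1.trans hq.2.1) h, hb.pos _ hq.1 (hq.2.1.trans_lt h)⟩
  have hbig : ∀ q ∈ kite κ, 1 < q.1 → a q.1 < 0 ∧ 0 < b q.2 := by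
    rintro ⟨u, v⟩ ⟨h1, h2, h3⟩ hu
    simp only at h1 h2 h3 hu ⊢
    rcases hside with ⟨hk, -, hneg⟩ | ⟨rfl, -⟩
    · refine ⟨hneg u hu ?_, hb.pos v h1 ?_⟩
      · nlinarith
      · nlinarith
    · linarith
  have hle1 : ∀ q ∈ kite κ, q.1 = 1 → q.2 ≤ 1 := fun q hq h => h ▸ hq.2.1
  have hcrit : ∀ q ∈ kite κ, q.1 = 1 → G q ≤ 0 → 0 < κ ∧ deriv a 1 < 0 ∧ 0 < b q.2 := by
    rintro ⟨u, v⟩ hq hu hGq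
    simp only at hu
    subst hu
    have hv := hle1 _ hq rfl
    simp only at hv
    rcases hside with ⟨hk, hd, -⟩ | ⟨-, h⟩
    · refine ⟨hk, hd, hb.pos v hq.1 (lt_of_le_of_ne hv ?_)⟩
      rintro rfl
      linarith
    · linarith [h v ⟨hq.1, hv⟩]
  -- the value at the origin
  have e1 : ∀ᶠ ε in 𝓝[>] (0 : ℝ), -(a 0 * b 0) + ε * G (0, 0) < 0 := by
    have hc : Continuous fun ε : ℝ => -(a 0 * b 0) + ε * G (0, 0) := by fun_prop
    have := hc.continuousAt (x := 0) |>.eventually (gt_mem_nhds (a := (0 : ℝ)) ?_)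
    · exact nhdsWithin_le_nhds this
    · have := mul_pos (ha.pos 0 le_rfl one_pos) (hb.pos 0 le_rfl one_pos)
      linarith
  -- the far side
  have e2 : ∀ᶠ ε in 𝓝[>] (0 : ℝ), ∀ q ∈ kite κ ∩ {q | q.1 + κ * q.2 = 1 + κ},
      0 < -(a q.1 * b q.2) + ε * G q := by
    apply eventually_pos_on_compact
    · exact (isCompact_kite hκ).inter_right (isClosed_eq (by fun_prop) (by fun_prop))
    · fun_prop
    · exact hcG
    · rintro q ⟨hq, hf⟩
      rcases lt_trichotomy q.1 1 with h | h | h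
      · exfalso
        have h2 := hq.2.1
        simp only [Set.mem_ofPred_eq] at hf
        nlinarith
      · rw [h, ha.zero]; simp
      · have := hbig q hq h
        nlinarith [mul_pos (neg_pos.2 this.1) this.2]
    · rintro q ⟨hq, hf⟩ hz
      rcases lt_trichotomy q.1 1 with h | h | h
      · have := hneg q hq h
        nlinarith [mul_pos this.1 this.2]
      · simp only [Set.mem_ofPred_eq] at hf
        by_contra hG0
        obtain ⟨hk, -, hb0⟩ := hcrit q hq h (not_lt.1 hG0)
        have : q.2 = 1 := by
          have : κ * q.2 = κ * 1 := by linarith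
          exact mul_left_cancel₀ hk.ne' this
        rw [this, hb.zero] at hb0
        exact lt_irrefl _ hb0
      · have := hbig q hq h
        nlinarith [mul_pos (neg_pos.2 this.1) this.2]
  -- radial derivative
  have hda : ∀ u, HasDerivAt a (deriv a u) u := fun u =>
    (ha.contDiff.differentiable one_ne_zero u).hasDerivAt
  have hdb : ∀ u, HasDerivAt b (deriv b u) u := fun u =>
    (hb.contDiff.differentiable one_ne_zero u).hasDerivAt
  have hfd : ∀ (ε : ℝ) (q : ℝ × ℝ), fderiv ℝ (fun q : ℝ × ℝ => -(a q.1 * b q.2) + ε * G q) q q =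
      -(q.1 * deriv a q.1 * b q.2 + a q.1 * (q.2 * deriv b q.2)) + ε * fderiv ℝ G q q := by
    intro ε q
    have h1 : HasFDerivAt (fun q : ℝ × ℝ => a q.1) _ q :=
      (hda q.1).hasFDerivAt.comp q hasFDerivAt_fst
    have h2 : HasFDerivAt (fun q : ℝ × ℝ => b q.2) _ q :=
      (hdb q.2).hasFDerivAt.comp q hasFDerivAt_snd
    have h3 := (hG.differentiable one_ne_zero q).hasFDerivAt
    have h4 : HasFDerivAt (fun q : ℝ × ℝ => -(a q.1 * b q.2) + ε * G q) _ q :=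
      (h1.mul h2).neg.add (h3.const_mul ε)
    rw [h4.fderiv]
    simp
    ring
  have hdiff : ∀ ε : ℝ, Differentiable ℝ (fun q : ℝ × ℝ => -(a q.1 * b q.2) + ε * G q) := by
    intro ε q
    have h1 : HasFDerivAt (fun q : ℝ × ℝ => a q.1) _ q :=
      (hda q.1).hasFDerivAt.comp q hasFDerivAt_fst
    have h2 : HasFDerivAt (fun q : ℝ × ℝ => b q.2) _ q :=
      (hdb q.2).hasFDerivAt.comp q hasFDerivAt_snd
    have h3 := (hG.differentiable one_ne_zero q).hasFDerivAt
    exact ((h1.mul h2).neg.add (h3.const_mul ε)).differentiableAt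
  have hcda : Continuous (deriv a) := ha.contDiff.continuous_deriv le_rfl
  have hcdb : Continuous (deriv b) := hb.contDiff.continuous_deriv le_rfl
  have hcXG : Continuous fun q : ℝ × ℝ => fderiv ℝ G q q :=
    (hG.continuous_fderiv one_ne_zero).clm_apply continuous_id
  have e3 : ∀ᶠ ε in 𝓝 (0 : ℝ), ∀ q ∈ kite κ, 0 < ε → q ∈ kite κ →
      -(a q.1 * b q.2) + ε * G q = 0 →
      0 < -(q.1 * deriv a q.1 * b q.2 + a q.1 * (q.2 * deriv b q.2)) + ε * fderiv ℝ G q q := by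
    apply (isCompact_kite hκ).eventually_forall_of_forall_eventually
    rintro ⟨u, v⟩ hq
    by_cases hu : u = 1
    · subst hu
      by_cases hGq : 0 < G (1, v)
      · have hv : v ≤ 1 := hle1 _ hq rfl
        obtain ⟨C, hC⟩ := hb.exists_lower_bound hq.1 hv
        obtain ⟨M, hM⟩ : ∃ M, ∀ᶠ q in 𝓝 ((1 : ℝ), v), -(M * G q) < fderiv ℝ G q q := by
          refine ⟨(|fderiv ℝ G (1, v) (1, v)| + 1) / G (1, v), ?_⟩
          have hc : Continuous fun q : ℝ × ℝ =>
              fderiv ℝ G q q + (|fderiv ℝ G (1, v) (1, v)| + 1) / G (1, v) * G q := by fun_prop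
          have := hc.continuousAt (x := (1, v)) |>.eventually (lt_mem_nhds (a := (0 : ℝ)) ?_)
          · filter_upwards [this] with q hq
            linarith
          · beta_reduce
            rw [div_mul_cancel₀ _ hGq.ne']
            linarith [neg_abs_le (fderiv ℝ G (1, v) (1, v))]
        -- The factor 2 compensates for the radial weight u > 1/2. What is left, (|C| + |M|) a b,
        -- balances the losses |C| a b from the derivative of `b` and |M| ε G = |M| a b from that of
        -- `G`; the last estimate is strict.
        have hsteep := ha.steep (2 * (|C| + |M|))
        rw [eventually_nhdsWithin_iff] at hsteep
        have t2 : Tendsto (fun z : ℝ × (ℝ × ℝ) => z.2) (𝓝 ((0 : ℝ), ((1 : ℝ), v))) (𝓝 (1, v)) :=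
          continuous_snd.tendsto _
        have tu : Tendsto (fun z : ℝ × (ℝ × ℝ) => z.2.1) (𝓝 ((0 : ℝ), ((1 : ℝ), v))) (𝓝 1) :=
          (continuous_fst.comp continuous_snd).tendsto (0, (1, v))
        have tv : Tendsto (fun z : ℝ × (ℝ × ℝ) => z.2.2) (𝓝 ((0 : ℝ), ((1 : ℝ), v))) (𝓝 v) :=
          (continuous_snd.comp continuous_snd).tendsto (0, (1, v))
        filter_upwards [tv.eventually hC, t2.eventually hM, tu.eventually hsteep,
          t2.eventually (hcG.continuousAt.eventually (lt_mem_nhds hGq)),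
          tu.eventually (lt_mem_nhds (show (1 / 2 : ℝ) < 1 by norm_num))]
        rintro ⟨ε, q⟩ hC hM hst hGpos hhalf hε hq hz
        simp only at hC hM hst hGpos hhalf hε hq hz ⊢
        have hab : 0 < a q.1 * b q.2 := by nlinarith [mul_pos hε hGpos]
        have hu1 : q.1 < 1 := by
          by_contra hcon
          rcases (not_lt.1 hcon).eq_or_lt with h | h
          · rw [← h, ha.zero] at hab; simp at hab
          · have := hbig q hq h
            nlinarith [mul_pos (neg_pos.2 this.1) this.2]
        obtain ⟨hap, hbp⟩ := hneg q hq hu1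
        have hv1 : q.2 < 1 := hq.2.1.trans_lt hu1
        have hC' := hC hv1
        have hst' := hst hu1
        -- compare the four terms
        have i1 : (|C| + |M|) * (a q.1 * b q.2) ≤ -(q.1 * deriv a q.1 * b q.2) := by
          have h1 : (1 / 2) * (2 * (|C| + |M|) * a q.1) ≤ q.1 * (-deriv a q.1) := by
            apply mul_le_mul hhalf.le hst' (by positivity) (by linarith)
          have := mul_le_mul_of_nonneg_right h1 hbp.le
          linarith
        have i2 : -(|C| * (a q.1 * b q.2)) ≤ -(a q.1 * (q.2 * deriv b q.2)) := by
          have h1 : -(|C| * b q.2) ≤ -(q.2 * deriv b q.2) := by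
            have : q.2 * (-(C * b q.2)) ≤ q.2 * (-deriv b q.2) :=
              mul_le_mul_of_nonneg_left hC' hq.1
            have h2 : q.2 * (C * b q.2) ≤ 1 * (|C| * b q.2) := by
              apply mul_le_mul hv1.le _ _ zero_le_one |>.trans' _
              · exact |C| * b q.2
              · exact le_rfl
              · positivity
              · exact mul_le_mul_of_nonneg_left
                  (mul_le_mul_of_nonneg_right (le_abs_self C) hbp.le) hq.1
            linarith
          have := mul_le_mul_of_nonneg_left h1 hap.le
          linarith
        have i3 : -(|M| * (a q.1 * b q.2)) < ε * fderiv ℝ G q q := by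
          have h1 : -(|M| * G q) < fderiv ℝ G q q := by
            have := mul_le_mul_of_nonneg_right (le_abs_self M) hGpos.le
            linarith
          have h2 := mul_lt_mul_of_pos_left h1 hε
          have h3 : a q.1 * b q.2 = ε * G q := by linarith
          rw [h3]
          linarith
        linarith
      · obtain ⟨-, hd, hb0⟩ := hcrit _ hq rfl (not_lt.1 hGq)
        have hc : Continuous fun z : ℝ × (ℝ × ℝ) =>
            -(z.2.1 * deriv a z.2.1 * b z.2.2 + a z.2.1 * (z.2.2 * deriv b z.2.2)) +
              z.1 * fderiv ℝ G z.2 z.2 := by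
          have := hcXG.comp (continuous_snd (X := ℝ))
          simp only [Function.comp_def] at this
          fun_prop
        have := hc.continuousAt (x := (0, (1, v))) |>.eventually (lt_mem_nhds (a := (0 : ℝ)) ?_)
        · filter_upwards [this] with z hz _ _ _ using hz
        · simp only [ha.zero] at hb0 ⊢
          nlinarith
    -- Off the edge the unperturbed function is nonzero, so no zeros occur nearby for small ε.
    · have hne : a u * b v ≠ 0 := by
        rcases lt_or_gt_of_ne hu with h | h
        · have := hneg _ hq h
          exact mul_ne_zero this.1.ne' this.2.ne'
        · have := hbig _ hq h
          exact mul_ne_zero this.1.ne this.2.ne'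
      have hc : Continuous fun z : ℝ × (ℝ × ℝ) => -(a z.2.1 * b z.2.2) + z.1 * G z.2 := by fun_prop
      have := hc.continuousAt (x := (0, (u, v))) |>.eventually_ne (y := 0) ?_
      · filter_upwards [this] with z hz _ _ h0 using absurd h0 hz
      · simpa using hne
  filter_upwards [e1, e2, nhdsWithin_le_nhds e3, self_mem_nhdsWithin] with ε h1 h2 h3 hε
  refine KiteZeros.of_radial hκ (hdiff ε) h1 (fun q hq hf => h2 q ⟨hq, hf⟩) ?_
  intro q hq hz
  rw [hfd]
  exact h3 q hq hε hq hz

/-! ### Regular zeros and analytic curves -/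

/-- Two functionals on space, one of which is nonzero on the kernel of the other, complete to a
coordinate system by a third. -/
theorem exists_equiv_of_two_functionals (α β : E3 →L[ℝ] ℝ) {p w : E3} (hp : α p ≠ 0)
    (hw0 : α w = 0) (hw : β w ≠ 0) :
    ∃ (ℓ : E3 →L[ℝ] ℝ) (e : E3 ≃L[ℝ] ℝ × ℝ × ℝ), ∀ v, e v = (α v, β v, ℓ v) := by
  let L : E3 →ₗ[ℝ] ℝ × ℝ := (α.prod β : E3 →L[ℝ] ℝ × ℝ)
  have hL : ∀ v, L v = (α v, β v) := fun v => rfl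
  have hsurj : Function.Surjective L := by
    rintro ⟨x, y⟩
    refine ⟨(x / α p) • p + ((y - x / α p * β p) / β w) • w, ?_⟩
    rw [hL]
    ext
    · simp [hw0, hp]
    · simp [hw]
  have hker : Module.finrank ℝ (LinearMap.ker L) = 1 := by
    have h1 := L.finrank_range_add_finrank_ker
    rw [LinearMap.range_eq_top.2 hsurj] at h1
    simp at h1
    omega
  obtain ⟨⟨d, hd⟩, hd0, hspan⟩ := finrank_eq_one_iff'.1 hker
  have hdne : d ≠ 0 := fun h => hd0 (Subtype.ext h)
  let ℓ : E3 →L[ℝ] ℝ := innerSL ℝ d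
  let M : E3 →ₗ[ℝ] ℝ × ℝ × ℝ := (α.prod (β.prod ℓ) : E3 →L[ℝ] ℝ × ℝ × ℝ)
  have hinj : Function.Injective M := by
    rw [← LinearMap.ker_eq_bot, LinearMap.ker_eq_bot']
    intro v hv
    have hv1 : α v = 0 := congrArg Prod.fst hv
    have hv2 : β v = 0 := congrArg (fun z => z.2.1) hv
    have hv3 : ℓ v = 0 := congrArg (fun z => z.2.2) hv
    have hvk : v ∈ LinearMap.ker L := by rw [LinearMap.mem_ker, hL, hv1, hv2]; rfl
    obtain ⟨c, hc⟩ := hspan ⟨v, hvk⟩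
    have hc' : c • d = v := congrArg Subtype.val hc
    rw [← hc'] at hv3
    have : c * inner ℝ d d = 0 := by simpa [ℓ, inner_smul_right] using hv3
    rcases mul_eq_zero.1 this with h | h
    · rw [← hc', h, zero_smul]
    · exact absurd (inner_self_eq_zero.1 h) hdne
  have hdim : Module.finrank ℝ E3 = Module.finrank ℝ (ℝ × ℝ × ℝ) := by simp
  let e := (LinearEquiv.ofInjectiveOfFinrankEq M hinj hdim).toContinuousLinearEquiv
  exact ⟨ℓ, e, fun v => rfl⟩

/-- Near a point where it is regular, the zero set of an analytic function on the sphere is an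
analytic arc. -/
theorem exists_arc_of_regular {h : E3 → ℝ} (hh : ContDiff ℝ ⊤ h) {p w : E3} (hp : ‖p‖ = 1)
    (hz : h p = 0) (hpw : inner ℝ p w = 0) (hw : fderiv ℝ h p w ≠ 0) :
    ∃ U : Set E3, IsOpen U ∧ p ∈ U ∧ ∃ γ : ℝ → E3,
      AnalyticOnNhd ℝ γ (Set.Ioo (-1) 1) ∧
      (∀ t ∈ Set.Ioo (-1 : ℝ) 1, deriv γ t ≠ 0) ∧
      IsEmbedding ((Set.Ioo (-1 : ℝ) 1).domRestrict γ) ∧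
      γ '' Set.Ioo (-1) 1 = {x | ‖x‖ = 1 ∧ h x = 0} ∩ U := by
  obtain ⟨ℓ, e, he⟩ := exists_equiv_of_two_functionals (2 • innerSL ℝ p) (fderiv ℝ h p)
    (p := p) (w := w) (by
      have : p ≠ 0 := by rintro rfl; simp at hp
      simpa using this) (by simp [hpw]) hw
  -- In these local coordinates the zero set on the sphere is a piece of the third axis. The third
  -- coordinate `ℓ` parametrises it, which also yields the nonvanishing velocity and the embedding.
  let F : E3 → ℝ × ℝ × ℝ := fun x => (‖x‖ ^ 2 - 1, h x, ℓ x)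
  have hF : ContDiff ℝ ⊤ F :=
    ((contDiff_norm_sq ℝ).sub contDiff_const).prodMk (hh.prodMk ℓ.contDiff)
  have hFd : HasFDerivAt F (e : E3 →L[ℝ] ℝ × ℝ × ℝ) p := by
    have h1 : HasFDerivAt (fun x : E3 => ‖x‖ ^ 2 - 1) (2 • innerSL ℝ p) p :=
      (hasStrictFDerivAt_norm_sq p).hasFDerivAt.sub_const 1
    have h2 : HasFDerivAt h (fderiv ℝ h p) p :=
      (hh.differentiable (by simp) p).hasFDerivAt
    have h3 := h1.prodMk (h2.prodMk ℓ.hasFDerivAt)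
    have h4 : (e : E3 →L[ℝ] ℝ × ℝ × ℝ) =
        (2 • innerSL ℝ p : E3 →L[ℝ] ℝ).prod ((fderiv ℝ h p).prod ℓ) :=
      ContinuousLinearMap.ext he
    rw [h4]
    exact h3
  have hn : (⊤ : WithTop ℕ∞) ≠ 0 := by simp
  let Φ := hF.contDiffAt.toOpenPartialHomeomorph F hFd hn
  have hΦ : ∀ x, Φ x = F x := fun x => rfl
  have hps : p ∈ Φ.source := hF.contDiffAt.mem_toOpenPartialHomeomorph_source hFd hn
  have hFp : F p = (0, 0, ℓ p) := by simp [F, hp, hz]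
  have hpt : ((0 : ℝ), (0 : ℝ), ℓ p) ∈ Φ.target := by
    rw [← hFp, ← hΦ]; exact Φ.map_source hps
  have hsym : Φ.symm (0, 0, ℓ p) = p := by rw [← hFp, ← hΦ, Φ.left_inv hps]
  have han : AnalyticAt ℝ Φ.symm (0, 0, ℓ p) := by
    apply ContDiffAt.analyticAt
    apply Φ.contDiffAt_symm hpt (f₀' := e)
    · rw [hsym]; exact hFd
    · exact hF.contDiffAt
  have hev : ∀ᶠ s in 𝓝 (ℓ p), AnalyticAt ℝ Φ.symm ((0 : ℝ), (0 : ℝ), s) ∧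
      ((0 : ℝ), (0 : ℝ), s) ∈ Φ.target := by
    have hc : Continuous fun s : ℝ => ((0 : ℝ), (0 : ℝ), s) := by fun_prop
    exact hc.continuousAt.eventually
      (han.eventually_analyticAt.and (Φ.open_target.mem_nhds hpt))
  obtain ⟨δ, hδ, hball⟩ := Metric.eventually_nhds_iff.1 hev
  have hin : ∀ t ∈ Set.Ioo (-1 : ℝ) 1, dist (ℓ p + δ * t) (ℓ p) < δ := by
    intro t ht
    rw [Real.dist_eq, add_sub_cancel_left, abs_mul, abs_of_pos hδ]
    have : |t| < 1 := abs_lt.2 ht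
    nlinarith
  let γ : ℝ → E3 := fun t => Φ.symm (0, 0, ℓ p + δ * t)
  have hγF : ∀ t ∈ Set.Ioo (-1 : ℝ) 1, F (γ t) = (0, 0, ℓ p + δ * t) := fun t ht =>
    Φ.right_inv (hball (hin t ht)).2
  have hγan : AnalyticOnNhd ℝ γ (Set.Ioo (-1) 1) := by
    intro t ht
    have h1 : AnalyticAt ℝ (fun t : ℝ => ((0 : ℝ), (0 : ℝ), ℓ p + δ * t)) t := by fun_prop
    exact AnalyticAt.fun_comp (g := Φ.symm) (f := fun t : ℝ => ((0 : ℝ), (0 : ℝ), ℓ p + δ * t))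
      (hball (hin t ht)).1 h1
  have hℓγ : ∀ t ∈ Set.Ioo (-1 : ℝ) 1, ℓ (γ t) = ℓ p + δ * t := fun t ht =>
    congrArg (fun z => z.2.2) (hγF t ht)
  refine ⟨Φ.source ∩ ℓ ⁻¹' Metric.ball (ℓ p) δ, Φ.open_source.inter
    (Metric.isOpen_ball.preimage ℓ.continuous), ⟨hps, by simpa using hδ⟩, γ, hγan, ?_, ?_, ?_⟩
  · intro t ht h0
    have h1 : HasDerivAt γ 0 t := by
      rw [← h0]; exact (hγan t ht).differentiableAt.hasDerivAt
    have h2 : HasDerivAt (fun t => ℓ (γ t)) (ℓ 0) t := ℓ.hasFDerivAt.comp_hasDerivAt t h1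
    have h3 : HasDerivAt (fun t => ℓ p + δ * t) (δ * 1) t :=
      ((hasDerivAt_id t).const_mul δ).const_add _
    have h4 : (fun t => ℓ (γ t)) =ᶠ[𝓝 t] fun t => ℓ p + δ * t := by
      filter_upwards [isOpen_Ioo.mem_nhds ht] with s hs using hℓγ s hs
    have := (h3.congr_of_eventuallyEq h4).unique h2
    simp at this
    exact hδ.ne' this
  · have hcont : Continuous ((Set.Ioo (-1 : ℝ) 1).domRestrict γ) :=
      continuousOn_iff_continuous_domRestrict.1 hγan.continuousOn
    refine IsEmbedding.of_comp hcont (g := fun x => (ℓ x - ℓ p) / δ) (by fun_prop) ?_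
    convert IsEmbedding.subtypeVal (X := ℝ) (p := (· ∈ Set.Ioo (-1 : ℝ) 1)) using 1
    funext t
    simp only [Function.comp, Set.domRestrict_apply]
    rw [hℓγ t t.2, add_sub_cancel_left, mul_div_cancel_left₀ _ hδ.ne']
  · ext x
    constructor
    · rintro ⟨t, ht, rfl⟩
      have h1 := hγF t ht
      have h2 : ‖γ t‖ ^ 2 - 1 = 0 := congrArg Prod.fst h1
      have h3 : h (γ t) = 0 := congrArg (fun z => z.2.1) h1
      refine ⟨⟨?_, h3⟩, Φ.map_target (hball (hin t ht)).2, ?_⟩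
      · have : ‖γ t‖ ^ 2 = 1 := by linarith
        exact (pow_eq_one_iff_of_nonneg (norm_nonneg _) two_ne_zero).1 this
      · rw [Set.mem_preimage, hℓγ t ht]
        exact hin t ht
    · rintro ⟨⟨hx1, hx2⟩, hxs, hxb⟩
      refine ⟨(ℓ x - ℓ p) / δ, ?_, ?_⟩
      · rw [Set.mem_preimage, Metric.mem_ball, Real.dist_eq, abs_lt] at hxb
        constructor
        · rw [lt_div_iff₀ hδ]; linarith
        · rw [div_lt_iff₀ hδ]; linarith
      · have hFx : F x = (0, 0, ℓ x) := by simp [F, hx1, hx2]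
        have e1 : ℓ p + δ * ((ℓ x - ℓ p) / δ) = ℓ x := by field_simp; ring
        simp only [γ]
        rw [e1, ← hFx, ← hΦ, Φ.left_inv hxs]

/-- A derivative that is nonzero in a tangential direction gives local arcs by
`exists_arc_of_regular`. Each arc is connected and so stays in one component; near its points that
component is therefore the whole zero set, and the components themselves serve as the required
curves. -/
theorem nonSingularNodalSet_of_regular {f : S2 → ℝ} {h : E3 → ℝ} (hfh : ∀ p : S2, f p = h p)
    (hh : ContDiff ℝ ⊤ h)
    (hreg : ∀ p : S2, f p = 0 → ∃ w : E3, inner ℝ (p : E3) w = 0 ∧ fderiv ℝ h p w ≠ 0)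
    (hfin : Finite (ConnectedComponents (nodalSet f))) : NonSingularNodalSet f := by
  have hfc : Continuous f := by
    rw [show f = fun p : S2 => h p from funext hfh]
    exact hh.continuous.comp continuous_subtype_val
  have hZcl : IsClosed (nodalSet f) := isClosed_eq hfc continuous_const
  have : CompactSpace (nodalSet f) := isCompact_iff_compactSpace.1 hZcl.isCompact
  let ι : nodalSet f → E3 := fun z => ((z : S2) : E3)
  have hι : IsEmbedding ι := IsEmbedding.subtypeVal.comp IsEmbedding.subtypeVal
  let D : ConnectedComponents (nodalSet f) → Set E3 := fun c => ι '' (ConnectedComponents.mk ⁻¹' {c})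
  have hD : ∀ z : nodalSet f, D (ConnectedComponents.mk z) = ι '' connectedComponent z := by
    intro z
    simp only [D, connectedComponents_preimage_singleton]
  have hrange : ∀ x : E3, x ∈ Set.range ι ↔ ‖x‖ = 1 ∧ h x = 0 := by
    intro x
    constructor
    · rintro ⟨z, rfl⟩
      refine ⟨mem_sphere_zero_iff_norm.1 z.1.2, ?_⟩
      have := z.2
      rw [← hfh]; exact this
    · rintro ⟨h1, h2⟩
      have hx : x ∈ Metric.sphere (0 : E3) 1 := by simpa using h1
      exact ⟨⟨⟨x, hx⟩, (hfh _).trans h2⟩, rfl⟩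
  refine ⟨Set.range D, Set.finite_range D, ?_, ?_, ?_⟩
  · rintro _ ⟨c, rfl⟩ _ ⟨d, rfl⟩ hcd
    have hne : c ≠ d := fun h => hcd (by rw [h])
    refine (Set.disjoint_image_iff hι.injective).2 (Disjoint.preimage _ ?_)
    simpa using hne
  · rintro _ ⟨c, rfl⟩
    obtain ⟨z, rfl⟩ := ConnectedComponents.surjective_coe c
    rw [hD]
    refine ⟨isClosed_connectedComponent.isCompact.image hι.continuous,
      isConnected_connectedComponent.image _ hι.continuous.continuousOn, ?_⟩
    rintro _ ⟨z', hz', rfl⟩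
    obtain ⟨hn, hz0⟩ := (hrange (ι z')).1 ⟨z', rfl⟩
    obtain ⟨w, hw1, hw2⟩ := hreg z'.1 z'.2
    obtain ⟨U, hU, hpU, γ, hγ1, hγ2, hγ3, hγ4⟩ := exists_arc_of_regular hh hn hz0 hw1 hw2
    refine ⟨U, hU, hpU, γ, hγ1, hγ2, hγ3, ?_⟩
    rw [hγ4]
    have hset : {x | ‖x‖ = 1 ∧ h x = 0} = Set.range ι := by
      ext x; exact (hrange x).symm
    rw [hset] at hγ4 ⊢
    apply Set.Subset.antisymm
    · have hpre : IsPreconnected (ι ⁻¹' (γ '' Set.Ioo (-1) 1)) := by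
        rw [← hι.isInducing.isPreconnected_image, Set.image_preimage_eq_of_subset]
        · exact isPreconnected_Ioo.image _ hγ1.continuousOn
        · rw [hγ4]; exact Set.inter_subset_left
      have hsub := hpre.subset_connectedComponent (x := z') (by
        rw [Set.mem_preimage, hγ4]; exact ⟨⟨z', rfl⟩, hpU⟩)
      rw [← connectedComponent_eq hz'] at hsub
      rintro _ ⟨⟨y, rfl⟩, hyU⟩
      refine ⟨⟨y, hsub ?_, rfl⟩, hyU⟩
      rw [Set.mem_preimage, hγ4]
      exact ⟨⟨y, rfl⟩, hyU⟩
    · rintro _ ⟨⟨y, hy, rfl⟩, hyU⟩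
      exact ⟨⟨y, rfl⟩, hyU⟩
  · ext x
    simp only [Set.sUnion_range, Set.mem_iUnion]
    constructor
    · rintro ⟨c, z, -, rfl⟩
      exact ⟨z.1, z.2, rfl⟩
    · rintro ⟨p, hp, rfl⟩
      exact ⟨ConnectedComponents.mk ⟨p, hp⟩, ⟨p, hp⟩, rfl, rfl⟩

/-! ### Zeros of the derivatives of Legendre polynomials -/

open Polynomial in
theorem iterate_derivative_comp_neg (n j : ℕ) :
    (derivative^[j] ((X ^ 2 - 1 : ℝ[X]) ^ n)).comp (-X) =
      C ((-1) ^ j) * derivative^[j] ((X ^ 2 - 1 : ℝ[X]) ^ n) := by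
  induction j with
  | zero => simp
  | succ j ih =>
    have h := congrArg derivative ih
    rw [derivative_comp, derivative_C_mul] at h
    rw [Function.iterate_succ_apply']
    have h2 : derivative (-X : ℝ[X]) = -1 := by simp
    rw [h2] at h
    rw [pow_succ (-1 : ℝ) j, C_mul, mul_assoc, mul_comm (C (-1 : ℝ)), ← mul_assoc, ← h]
    simp

theorem eval_neg_iterate_derivative (n j : ℕ) (x : ℝ) :
    (Polynomial.derivative^[j] ((Polynomial.X ^ 2 - 1 : Polynomial ℝ) ^ n)).eval (-x) =
      (-1) ^ j * (Polynomial.derivative^[j] ((Polynomial.X ^ 2 - 1 : Polynomial ℝ) ^ n)).eval x := by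
  have h := congrArg (Polynomial.eval x) (iterate_derivative_comp_neg n j)
  simpa [Polynomial.eval_comp] using h

-- After the shift x = 1 + y the polynomial is y^n (y + 2)^n, whose derivatives have nonnegative
-- coefficients; for n ≤ j ≤ 2n the constant term of the j-th one is positive.
open Polynomial in
theorem iterate_derivative_eval_pos {n j : ℕ} (h1 : n ≤ j) (h2 : j ≤ 2 * n) {x : ℝ} (hx : 1 ≤ x) :
    0 < (derivative^[j] ((X ^ 2 - 1 : ℝ[X]) ^ n)).eval x := by
  have hcomp : (derivative^[j] ((X ^ 2 - 1 : ℝ[X]) ^ n)).comp (X + C 1) =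
      derivative^[j] (X ^ n * (X + C 2) ^ n) := by
    have hit : ∀ (i : ℕ) (P : ℝ[X]),
        (derivative^[i] P).comp (X + C 1) = derivative^[i] (P.comp (X + C 1)) := by
      intro i
      induction i with
      | zero => intro P; rfl
      | succ i ih =>
        intro P
        rw [Function.iterate_succ_apply, Function.iterate_succ_apply, ih, derivative_comp]
        simp
    rw [hit]
    congr 1
    simp only [pow_comp, sub_comp, X_comp, one_comp]
    rw [← mul_pow]
    congr 1
    simp only [C_1, map_ofNat]
    ring
  have heval : (derivative^[j] ((X ^ 2 - 1 : ℝ[X]) ^ n)).eval x =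
      (derivative^[j] (X ^ n * (X + C 2 : ℝ[X]) ^ n)).eval (x - 1) := by
    rw [← hcomp, eval_comp]; simp
  have hnn : ∀ i, 0 ≤ (derivative^[j] (X ^ n * (X + C 2 : ℝ[X]) ^ n)).coeff i := by
    intro i
    rw [coeff_iterate_derivative, coeff_X_pow_mul']
    split_ifs
    · rw [coeff_X_add_C_pow]; positivity
    · simp
  have h0 : 0 < (derivative^[j] (X ^ n * (X + C 2 : ℝ[X]) ^ n)).coeff 0 := by
    rw [coeff_iterate_derivative, coeff_X_pow_mul', if_pos (by omega), coeff_X_add_C_pow,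
      nsmul_eq_mul, zero_add]
    have ha : 0 < j.descFactorial j := by rw [Nat.descFactorial_self]; positivity
    have hb : 0 < n.choose (j - n) := Nat.choose_pos (by omega)
    positivity
  rw [heval, eval_eq_sum_range]
  have hx' : 0 ≤ x - 1 := by linarith
  refine lt_of_lt_of_le h0 ?_
  have := Finset.single_le_sum (s := Finset.range
    ((derivative^[j] (X ^ n * (X + C 2 : ℝ[X]) ^ n)).natDegree + 1))
    (f := fun i => (derivative^[j] (X ^ n * (X + C 2 : ℝ[X]) ^ n)).coeff i * (x - 1) ^ i)
    (fun i _ => mul_nonneg (hnn i) (pow_nonneg hx' i)) (Finset.mem_range.2 (Nat.succ_pos _))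
  simpa using this

-- Rolle's theorem for distinct roots. As long as i < n the points ±1 remain roots and are distinct
-- from the new roots in between, so the count grows by one with each derivative and reaches n + 1
-- at i = n - 1. Each later derivative loses at most one.
open Polynomial in
theorem card_roots_iterate_derivative {n j : ℕ} (h1 : n ≤ j) (h2 : j ≤ 2 * n) :
    2 * n - j ≤ (derivative^[j] ((X ^ 2 - 1 : ℝ[X]) ^ n)).roots.toFinset.card := by
  have hne : ∀ i ≤ 2 * n, derivative^[i] ((X ^ 2 - 1 : ℝ[X]) ^ n) ≠ 0 := by
    intro i hi h0
    have h3 : derivative^[2 * n] ((X ^ 2 - 1 : ℝ[X]) ^ n) = 0 := by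
      have : 2 * n = (2 * n - i) + i := by omega
      rw [this, Function.iterate_add_apply, h0, iterate_derivative_zero]
    have := iterate_derivative_eval_pos (n := n) (j := 2 * n) (by omega) le_rfl (le_refl (1 : ℝ))
    rw [h3] at this
    simp at this
  have hpm : ∀ i < n, ∀ x ∈ ({1, -1} : Finset ℝ),
      x ∈ (derivative^[i] ((X ^ 2 - 1 : ℝ[X]) ^ n)).roots.toFinset := by
    intro i hi x hx
    rw [Multiset.mem_toFinset, mem_roots (hne i (by omega))]
    have hd := pow_sub_dvd_iterate_derivative_of_pow_dvd i
      (dvd_refl ((X ^ 2 - 1 : ℝ[X]) ^ n))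
    have hd2 : (X ^ 2 - 1 : ℝ[X]) ∣ derivative^[i] ((X ^ 2 - 1 : ℝ[X]) ^ n) :=
      (dvd_pow_self _ (by omega)).trans hd
    apply IsRoot.dvd _ hd2
    simp only [Finset.mem_insert, Finset.mem_singleton] at hx
    rcases hx with rfl | rfl <;> simp
  have hlow : ∀ i < n, i + 2 ≤ (derivative^[i] ((X ^ 2 - 1 : ℝ[X]) ^ n)).roots.toFinset.card := by
    intro i
    induction i with
    | zero =>
      intro h
      have := Finset.card_le_card (show ({1, -1} : Finset ℝ) ⊆ _ from fun x hx => hpm 0 h x hx)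
      rwa [Finset.card_pair (by norm_num)] at this
    | succ i ih =>
      intro h
      have hr := card_roots_toFinset_le_card_roots_derivative_sdiff_roots_succ
        (derivative^[i] ((X ^ 2 - 1 : ℝ[X]) ^ n))
      rw [← Function.iterate_succ_apply' derivative] at hr
      set S := (derivative^[i] ((X ^ 2 - 1 : ℝ[X]) ^ n)).roots.toFinset with hS
      set T := (derivative^[i + 1] ((X ^ 2 - 1 : ℝ[X]) ^ n)).roots.toFinset with hT
      have hsub : (T \ S) ∪ {1, -1} ⊆ T :=
        Finset.union_subset Finset.sdiff_subset (fun x hx => hpm (i + 1) h x hx)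
      have hdis : Disjoint (T \ S) {1, -1} := by
        rw [Finset.disjoint_right]
        intro x hx hx'
        exact (Finset.mem_sdiff.1 hx').2 (hpm i (by omega) x hx)
      have hc := Finset.card_le_card hsub
      rw [Finset.card_union_of_disjoint hdis, Finset.card_pair (by norm_num)] at hc
      have := ih (by omega)
      omega
  have hstep : ∀ i, (derivative^[i] ((X ^ 2 - 1 : ℝ[X]) ^ n)).roots.toFinset.card ≤
      (derivative^[i + 1] ((X ^ 2 - 1 : ℝ[X]) ^ n)).roots.toFinset.card + 1 := by
    intro i
    have hr := card_roots_toFinset_le_card_roots_derivative_sdiff_roots_succ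
        (derivative^[i] ((X ^ 2 - 1 : ℝ[X]) ^ n))
    rw [← Function.iterate_succ_apply' derivative] at hr
    exact hr.trans (by gcongr; exact Finset.sdiff_subset)
  induction j, h1 using Nat.le_induction with
  | base =>
    rcases Nat.eq_zero_or_pos n with rfl | hn
    · simp
    · obtain ⟨i, rfl⟩ : ∃ i, n = i + 1 := ⟨n - 1, by omega⟩
      have := hlow i (by omega)
      have := hstep i
      omega
  | succ j hj ih =>
    have := ih (by omega)
    have := hstep j
    omega

theorem derivative_legendreP (n m : ℕ) : Polynomial.derivative^[m] (legendreP n) =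
    Polynomial.C ((2 ^ n * (n.factorial : ℝ))⁻¹) *
      Polynomial.derivative^[m + n] ((Polynomial.X ^ 2 - 1) ^ n) := by
  rw [legendreP, Polynomial.iterate_derivative_C_mul, Function.iterate_add_apply]

theorem derivative_legendreP_eval_one_pos {n m : ℕ} (h : m ≤ n) :
    0 < (Polynomial.derivative^[m] (legendreP n)).eval 1 := by
  rw [derivative_legendreP, Polynomial.eval_C_mul]
  have := iterate_derivative_eval_pos (n := n) (j := m + n) (by omega) (by omega) (le_refl (1 : ℝ))
  positivity

theorem natDegree_derivative_legendreP_le {n m : ℕ} :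
    (Polynomial.derivative^[m] (legendreP n)).natDegree ≤ n - m := by
  rw [derivative_legendreP]
  refine (Polynomial.natDegree_C_mul_le _ _).trans ?_
  refine (Polynomial.natDegree_iterate_derivative _ _).trans ?_
  have : ((Polynomial.X ^ 2 - 1 : Polynomial ℝ) ^ n).natDegree ≤ n * 2 := by
    refine Polynomial.natDegree_pow_le.trans ?_
    gcongr
    compute_degree
  omega

theorem derivative_legendreP_eval_neg (n m : ℕ) (x : ℝ) :
    (Polynomial.derivative^[m] (legendreP n)).eval (-x) =
      (-1) ^ (m + n) * (Polynomial.derivative^[m] (legendreP n)).eval x := by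
  rw [derivative_legendreP, Polynomial.eval_C_mul, Polynomial.eval_C_mul,
    eval_neg_iterate_derivative]
  ring

theorem derivative_legendreP_ne_zero_of_one_le_abs {n m : ℕ} (h : m ≤ n) {x : ℝ} (hx : 1 ≤ |x|) :
    (Polynomial.derivative^[m] (legendreP n)).eval x ≠ 0 := by
  have key : ∀ y : ℝ, 1 ≤ y → (Polynomial.derivative^[m] (legendreP n)).eval y ≠ 0 := by
    intro y hy
    rw [derivative_legendreP, Polynomial.eval_C_mul]
    have := iterate_derivative_eval_pos (n := n) (j := m + n) (by omega) (by omega) hy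
    positivity
  rcases le_abs.1 hx with h1 | h1
  · exact key x h1
  · have := key (-x) h1
    rw [derivative_legendreP_eval_neg] at this
    exact right_ne_zero_of_mul this

/-- Rolle's lower bound equals the upper bound for the degree, so there is no room for multiple
roots. -/
theorem card_roots_derivative_legendreP {n m : ℕ} (h : m ≤ n) :
    (Polynomial.derivative^[m] (legendreP n)).roots.toFinset.card = n - m ∧
      (Polynomial.derivative^[m] (legendreP n)).roots.Nodup := by
  set Q := Polynomial.derivative^[m] (legendreP n) with hQ
  have hroots : Q.roots =
      (Polynomial.derivative^[m + n] ((Polynomial.X ^ 2 - 1 : Polynomial ℝ) ^ n)).roots := by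
    rw [hQ, derivative_legendreP, Polynomial.roots_C_mul]
    positivity
  have h1 : n - m ≤ Q.roots.toFinset.card := by
    rw [hroots]
    have := card_roots_iterate_derivative (n := n) (j := m + n) (by omega) (by omega)
    omega
  have h2 : Q.roots.toFinset.card ≤ Q.roots.card := Multiset.toFinset_card_le _
  have h3 : Q.roots.card ≤ n - m := (Polynomial.card_roots' Q).trans
    natDegree_derivative_legendreP_le
  refine ⟨by omega, ?_⟩
  rw [← Multiset.toFinset_card_eq_card_iff_nodup]
  omega

theorem derivative_eval_ne_zero_of_root {n m : ℕ} (h : m ≤ n) {x : ℝ}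
    (hx : (Polynomial.derivative^[m] (legendreP n)).eval x = 0) :
    (Polynomial.derivative (Polynomial.derivative^[m] (legendreP n))).eval x ≠ 0 := by
  set Q := Polynomial.derivative^[m] (legendreP n) with hQ
  have hQ0 : Q ≠ 0 := by
    intro h0
    have := derivative_legendreP_eval_one_pos h
    rw [← hQ, h0] at this
    simp at this
  intro hd
  have h1 : 1 < Q.rootMultiplicity x :=
    (Polynomial.one_lt_rootMultiplicity_iff_isRoot hQ0).2 ⟨hx, hd⟩
  have h2 := Multiset.nodup_iff_count_le_one.1 (card_roots_derivative_legendreP h).2 x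
  rw [Polynomial.count_roots] at h2
  exact absurd h1 (not_lt.2 h2)

theorem legendreF_self (n : ℕ) (x : ℝ) : legendreF n n x = 1 := by
  have hpos := derivative_legendreP_eval_one_pos (le_refl n)
  have hdeg := natDegree_derivative_legendreP_le (n := n) (m := n)
  rw [Nat.sub_self, Nat.le_zero] at hdeg
  rw [Polynomial.eq_C_of_natDegree_eq_zero hdeg] at hpos
  rw [legendreF, Polynomial.eq_C_of_natDegree_eq_zero hdeg]
  simp only [Polynomial.eval_C] at hpos ⊢
  exact div_self hpos.ne'

/-- The derivative of order n - 1 is linear and odd, and the normalisation at 1 fixes the factor.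
This is the perturbation for odd n; it changes sign only at the equator. -/
theorem legendreF_pred (m : ℕ) (x : ℝ) : legendreF (m + 1) m x = x := by
  have hpos := derivative_legendreP_eval_one_pos (n := m + 1) (m := m) (by omega)
  have hdeg := natDegree_derivative_legendreP_le (n := m + 1) (m := m)
  rw [Nat.add_sub_cancel_left] at hdeg
  have hneg := derivative_legendreP_eval_neg (m + 1) m 1
  rw [show m + (m + 1) = 2 * m + 1 by ring, pow_succ, pow_mul] at hneg
  obtain ⟨a, b, hab⟩ := Polynomial.exists_eq_X_add_C_of_natDegree_le_one hdeg
  rw [legendreF]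
  rw [hab] at hpos hneg ⊢
  simp at hpos hneg ⊢
  have hb : b = 0 := by linarith
  subst hb
  simp at hpos ⊢
  field_simp

theorem legendreF_one {n m : ℕ} (h : m ≤ n) : legendreF n m 1 = 1 :=
  div_self (derivative_legendreP_eval_one_pos h).ne'

theorem contDiff_legendreF (n m : ℕ) : ContDiff ℝ ⊤ (legendreF n m) :=
  ((Polynomial.contDiff_aeval (R := ℝ) (𝕜 := ℝ) _ _)).div_const _

theorem pos_of_ne_zero_of_pos {W : ℝ → ℝ} (hW : Continuous W) {a b c x : ℝ}
    (hne : ∀ y ∈ Set.Ioo a b, W y ≠ 0) (hc : c ∈ Set.Ioo a b) (hpos : 0 < W c)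
    (hx : x ∈ Set.Ioo a b) : 0 < W x := by
  by_contra hcon
  obtain ⟨y, hy, hy0⟩ := isPreconnected_Ioo.intermediate_value hx hc hW.continuousOn
    (show (0 : ℝ) ∈ Set.Icc (W x) (W c) from ⟨not_lt.1 hcon, hpos.le⟩)
  exact hne y hy hy0

/-- A function with simple zeros changes sign at each of them. -/
theorem sign_alternates {W : ℝ → ℝ} (hW : Differentiable ℝ W) {θ : ℕ → ℝ} {k : ℕ}
    (hlt : ∀ i ≤ k, θ i < θ (i + 1)) (hne : ∀ i ≤ k, ∀ x ∈ Set.Ioo (θ i) (θ (i + 1)), W x ≠ 0)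
    (h0 : 0 < W (θ 0))
    (hz : ∀ i, 1 ≤ i → i ≤ k → W (θ i) = 0 ∧ deriv W (θ i) ≠ 0) :
    ∀ i ≤ k, ∀ x ∈ Set.Ioo (θ i) (θ (i + 1)), 0 < (-1) ^ i * W x := by
  intro i
  induction i with
  | zero =>
    intro hi x hx
    have h1 : ∀ᶠ y in 𝓝[>] (θ 0), 0 < W y :=
      nhdsWithin_le_nhds (hW.continuous.continuousAt.eventually (lt_mem_nhds h0))
    obtain ⟨c, hc1, hc2⟩ := (h1.and (Ioo_mem_nhdsGT (hlt 0 hi))).exists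
    simpa using pos_of_ne_zero_of_pos hW.continuous (hne 0 hi) hc2 hc1 hx
  | succ i ih =>
    intro hi x hx
    have ih := ih (by omega)
    obtain ⟨hz0, hz1⟩ := hz (i + 1) (by omega) hi
    set V : ℝ → ℝ := fun y => (-1) ^ i * W y with hV
    have hVd : HasDerivAt V ((-1) ^ i * deriv W (θ (i + 1))) (θ (i + 1)) :=
      (hW _).hasDerivAt.const_mul _
    have hV0 : V (θ (i + 1)) = 0 := by simp [hV, hz0]
    set d := (-1) ^ i * deriv W (θ (i + 1)) with hd
    have hd0 : d ≠ 0 := mul_ne_zero (by positivity) hz1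
    have hslope := hasDerivAt_iff_tendsto_slope.1 hVd
    have hdneg : d < 0 := by
      by_contra hcon
      have hdp : 0 < d := lt_of_le_of_ne (not_lt.1 hcon) (Ne.symm hd0)
      have h1 : ∀ᶠ y in 𝓝[<] (θ (i + 1)), 0 < slope V (θ (i + 1)) y :=
        (hslope.mono_left (nhdsWithin_mono _ fun y hy => ne_of_lt hy)).eventually (lt_mem_nhds hdp)
      obtain ⟨y, hy1, hy2⟩ := (h1.and (Ioo_mem_nhdsLT (hlt i (by omega)))).exists
      rw [slope_def_field, hV0, sub_zero] at hy1
      have := div_neg_of_pos_of_neg (ih y hy2) (sub_neg.2 hy2.2)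
      exact lt_asymm hy1 this
    have h1 : ∀ᶠ y in 𝓝[>] (θ (i + 1)), slope V (θ (i + 1)) y < 0 :=
      (hslope.mono_left (nhdsWithin_mono _ fun y hy => ne_of_gt hy)).eventually (gt_mem_nhds hdneg)
    obtain ⟨c, hc1, hc2⟩ := (h1.and (Ioo_mem_nhdsGT (hlt (i + 1) hi))).exists
    rw [slope_def_field, hV0, sub_zero] at hc1
    have hVc : V c < 0 := by
      by_contra hcon
      exact absurd hc1 (not_lt.2 (div_nonneg (not_lt.1 hcon) (sub_nonneg.2 hc2.1.le)))
    refine pos_of_ne_zero_of_pos (W := fun y => (-1) ^ (i + 1) * W y)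
      (hW.continuous.const_mul _) ?_ hc2 ?_ hx
    · exact fun y hy => mul_ne_zero (by positivity) (hne (i + 1) hi y hy)
    · simp only [hV] at hVc
      rw [pow_succ]
      linarith

/-- The angles are 0, π and the arccosines of the roots, in increasing order. Zeros stay simple in
the angle because sin does not vanish inside (0, π), and the signs alternate starting from the value
1 at the north pole. -/
theorem exists_zeros_legendreF {n m : ℕ} (h : m ≤ n) :
    ∃ θ : ℕ → ℝ, θ 0 = 0 ∧ θ (n - m + 1) = Real.pi ∧ (∀ i ≤ n - m, θ i < θ (i + 1)) ∧
      (∀ i ≤ n - m, ∀ x ∈ Set.Ioo (θ i) (θ (i + 1)), 0 < (-1) ^ i * legendreF n m (Real.cos x)) ∧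
      (∀ i, 1 ≤ i → i ≤ n - m → legendreF n m (Real.cos (θ i)) = 0 ∧
        deriv (fun x => legendreF n m (Real.cos x)) (θ i) ≠ 0) := by
  set Q := Polynomial.derivative^[m] (legendreP n) with hQ
  have hQ0 : Q ≠ 0 := by
    intro h0
    have := derivative_legendreP_eval_one_pos h
    rw [← hQ, h0] at this
    simp at this
  have hQ1 := derivative_legendreP_eval_one_pos h
  rw [← hQ] at hQ1
  set S := Q.roots.toFinset with hS
  have hSmem : ∀ x, x ∈ S ↔ Q.eval x = 0 := by
    intro x; rw [hS, Multiset.mem_toFinset, Polynomial.mem_roots hQ0]; rfl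
  have hSI : ∀ x ∈ S, -1 < x ∧ x < 1 := by
    intro x hx
    rw [← abs_lt]
    by_contra hcon
    exact derivative_legendreP_ne_zero_of_one_le_abs h (not_lt.1 hcon) ((hSmem x).1 hx)
  have hScard : S.card = n - m := (card_roots_derivative_legendreP h).1
  have hF0 : ∀ x, legendreF n m x = 0 ↔ x ∈ S := by
    intro x
    rw [hSmem, legendreF, div_eq_zero_iff, ← hQ]
    simp [hQ1.ne']
  set T := insert 0 (insert Real.pi (S.image Real.arccos)) with hT
  have himg : (S.image Real.arccos).card = n - m := by
    rw [Finset.card_image_of_injOn, hScard]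
    intro x hx y hy hxy
    exact Real.arccos_injOn ⟨(hSI x hx).1.le, (hSI x hx).2.le⟩ ⟨(hSI y hy).1.le, (hSI y hy).2.le⟩ hxy
  have hIoo : ∀ x ∈ S.image Real.arccos, 0 < x ∧ x < Real.pi := by
    intro x hx
    obtain ⟨y, hy, rfl⟩ := Finset.mem_image.1 hx
    refine ⟨Real.arccos_pos.2 (hSI y hy).2, lt_of_le_of_ne (Real.arccos_le_pi y) ?_⟩
    intro he
    exact absurd (Real.arccos_eq_pi.1 he) (not_le.2 (hSI y hy).1)
  have hTcard : T.card = n - m + 1 + 1 := by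
    rw [hT, Finset.card_insert_of_notMem, Finset.card_insert_of_notMem, himg]
    · intro hx; exact lt_irrefl _ (hIoo _ hx).2
    · rw [Finset.mem_insert]
      rintro (h | h)
      · exact Real.pi_pos.ne h
      · exact lt_irrefl _ (hIoo _ h).1
  have hTI : ∀ x ∈ T, 0 ≤ x ∧ x ≤ Real.pi := by
    intro x hx
    rw [hT, Finset.mem_insert, Finset.mem_insert] at hx
    rcases hx with rfl | rfl | hx
    · exact ⟨le_rfl, Real.pi_pos.le⟩
    · exact ⟨Real.pi_pos.le, le_rfl⟩
    · exact ⟨(hIoo x hx).1.le, (hIoo x hx).2.le⟩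
  have h0T : (0 : ℝ) ∈ T := by simp [hT]
  have hπT : Real.pi ∈ T := by simp [hT]
  set e := T.orderEmbOfFin hTcard with he
  have hrange : ∀ x, x ∈ T ↔ ∃ i, e i = x := by
    intro x
    have := Finset.range_orderEmbOfFin T hTcard
    rw [← Finset.mem_coe, ← this]; rfl
  set θ : ℕ → ℝ := fun i => if hi : i < n - m + 1 + 1 then e ⟨i, hi⟩ else 0 with hθ
  have hθe : ∀ i (hi : i < n - m + 1 + 1), θ i = e ⟨i, hi⟩ := fun i hi => dif_pos hi
  have hθ0 : θ 0 = 0 := by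
    rw [hθe 0 (by omega)]
    obtain ⟨i, hi⟩ := (hrange 0).1 h0T
    refine le_antisymm ?_ (hTI _ ((hrange _).2 ⟨_, rfl⟩)).1
    rw [← hi]
    exact e.monotone (Fin.mk_le_of_le_val (Nat.zero_le _))
  have hθl : θ (n - m + 1) = Real.pi := by
    rw [hθe _ (by omega)]
    obtain ⟨i, hi⟩ := (hrange Real.pi).1 hπT
    refine le_antisymm (hTI _ ((hrange _).2 ⟨_, rfl⟩)).2 ?_
    rw [← hi]
    apply e.monotone
    have := i.2
    exact Fin.mk_le_mk.2 (by omega)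
  have hlt : ∀ i ≤ n - m, θ i < θ (i + 1) := by
    intro i hi
    rw [hθe i (by omega), hθe (i + 1) (by omega)]
    exact e.strictMono (Fin.mk_lt_mk.2 (Nat.lt_succ_self i))
  have hgap : ∀ i ≤ n - m, ∀ x ∈ Set.Ioo (θ i) (θ (i + 1)), x ∉ T := by
    intro i hi x hx hxT
    obtain ⟨j, rfl⟩ := (hrange x).1 hxT
    rw [hθe i (by omega), hθe (i + 1) (by omega)] at hx
    have h1 := e.lt_iff_lt.1 hx.1
    have h2 := e.lt_iff_lt.1 hx.2
    rw [Fin.lt_def] at h1 h2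
    simp only at h1 h2
    omega
  have hθI : ∀ i ≤ n - m + 1, 0 ≤ θ i ∧ θ i ≤ Real.pi := by
    intro i hi
    rw [hθe i (by omega)]
    exact hTI _ ((hrange _).2 ⟨_, rfl⟩)
  have hFd : Differentiable ℝ (legendreF n m) := (contDiff_legendreF n m).differentiable (by simp)
  have hz : ∀ i, 1 ≤ i → i ≤ n - m → legendreF n m (Real.cos (θ i)) = 0 ∧
      deriv (fun x => legendreF n m (Real.cos x)) (θ i) ≠ 0 := by
    intro i h1 h2
    have hT' : θ i ∈ T := by rw [hθe i (by omega)]; exact (hrange _).2 ⟨_, rfl⟩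
    have hpos : 0 < θ i := by
      rw [← hθ0, hθe 0 (by omega), hθe i (by omega)]
      exact e.strictMono (Fin.mk_lt_mk.2 (by omega))
    have hlt' : θ i < Real.pi := by
      rw [← hθl, hθe (n - m + 1) (by omega), hθe i (by omega)]
      exact e.strictMono (Fin.mk_lt_mk.2 (by omega))
    rw [hT, Finset.mem_insert, Finset.mem_insert] at hT'
    rcases hT' with h' | h' | h'
    · exact absurd h' hpos.ne'
    · exact absurd h' hlt'.ne
    · obtain ⟨y, hy, hyθ⟩ := Finset.mem_image.1 h'
      have hcos : Real.cos (θ i) = y := by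
        rw [← hyθ, Real.cos_arccos (hSI y hy).1.le (hSI y hy).2.le]
      have hyQ := (hSmem y).1 hy
      refine ⟨by rw [hcos, hF0]; exact hy, ?_⟩
      have hd : HasDerivAt (legendreF n m) ((Polynomial.derivative Q).eval y / Q.eval 1) y :=
        (Polynomial.hasDerivAt Q y).div_const _
      rw [← hcos] at hd
      have := hd.comp (θ i) (Real.hasDerivAt_cos (θ i))
      rw [show (fun x => legendreF n m (Real.cos x)) = legendreF n m ∘ Real.cos from rfl,
        this.deriv, hcos]
      refine mul_ne_zero (div_ne_zero (derivative_eval_ne_zero_of_root h hyQ) hQ1.ne') ?_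
      exact neg_ne_zero.2 (Real.sin_pos_of_pos_of_lt_pi hpos hlt').ne'
  refine ⟨θ, hθ0, hθl, hlt, ?_, hz⟩
  apply sign_alternates (W := fun x => legendreF n m (Real.cos x)) _ hlt _ _ hz
  · exact hFd.comp Real.differentiable_cos
  · intro i hi x hx h0
    have hx0 : 0 < x := (hθI i (by omega)).1.trans_lt hx.1
    have hxπ : x < Real.pi := hx.2.trans_le (hθI (i + 1) (by omega)).2
    apply hgap i hi x hx
    rw [hT, Finset.mem_insert, Finset.mem_insert]
    right; right
    exact Finset.mem_image.2 ⟨Real.cos x, (hF0 _).1 h0, Real.arccos_cos hx0.le hxπ.le⟩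
  · simp only [hθ0, Real.cos_zero, legendreF_one h]
    exact one_pos

/-! ### Rotations and the tilted perturbation -/

/-- The rotation by the angle `a` about the third axis. -/
noncomputable def rotZ (a : ℝ) : SO3 :=
  ⟨!![Real.cos a, -Real.sin a, 0; Real.sin a, Real.cos a, 0; 0, 0, 1], by
    rw [Matrix.mem_specialOrthogonalGroup_iff, Matrix.mem_orthogonalGroup_iff]
    constructor
    · ext i j
      have := Real.sin_sq_add_cos_sq a
      fin_cases i <;> fin_cases j <;>
        simp [Matrix.mul_apply, Fin.sum_univ_three] <;> nlinarith
    · rw [Matrix.det_fin_three]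
      simp
      nlinarith [Real.sin_sq_add_cos_sq a]⟩

/-- The rotation by the angle `t` about the first axis. -/
noncomputable def rotX (t : ℝ) : SO3 :=
  ⟨!![1, 0, 0; 0, Real.cos t, -Real.sin t; 0, Real.sin t, Real.cos t], by
    rw [Matrix.mem_specialOrthogonalGroup_iff, Matrix.mem_orthogonalGroup_iff]
    constructor
    · ext i j
      have := Real.sin_sq_add_cos_sq t
      fin_cases i <;> fin_cases j <;>
        simp [Matrix.mul_apply, Fin.sum_univ_three] <;> nlinarith
    · rw [Matrix.det_fin_three]
      simp
      nlinarith [Real.sin_sq_add_cos_sq t]⟩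

theorem rotate_mul (R S : SO3) (p : S2) : rotate (R * S) p = rotate R (rotate S p) := by
  apply Subtype.ext
  simp only [rotate]
  congr 1
  rw [Matrix.mulVec_mulVec]
  rfl

theorem rotate_rotZ_sphPoint (a θ φ : ℝ) :
    rotate (rotZ a) (sphPoint θ φ) = sphPoint θ (φ + a) := by
  apply Subtype.ext
  ext i
  fin_cases i <;> simp [rotate, rotZ, sphPoint, Real.cos_add, Real.sin_add] <;> ring

/-- Without tilt the three rotations amount to the longitude shift b. Splitting it as -b before and
2b after the tilt keeps the tilt effective at the grid meridians and at the poles. -/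
theorem sphHarm_tilted (n l : ℕ) (b t θ φ : ℝ) :
    sphHarm n l (rotate (rotZ (2 * b) * rotX t * rotZ (-b)) (sphPoint θ φ)) =
      ((Complex.exp (2 * b * Complex.I) * ⟨Real.sin θ * Real.cos (φ - b),
        Real.sin θ * Real.sin (φ - b) * Real.cos t - Real.cos θ * Real.sin t⟩) ^ l).im *
      legendreF n l (Real.sin θ * Real.sin (φ - b) * Real.sin t + Real.cos θ * Real.cos t) := by
  rw [rotate_mul, rotate_mul, rotate_rotZ_sphPoint, sphHarm]
  have hexp : Complex.exp (2 * b * Complex.I) = ⟨Real.cos (2 * b), Real.sin (2 * b)⟩ := by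
    apply Complex.ext
    · rw [show (2 * b * Complex.I : ℂ) = ((2 * b : ℝ) : ℂ) * Complex.I by push_cast; ring,
        Complex.exp_ofReal_mul_I_re]
    · rw [show (2 * b * Complex.I : ℂ) = ((2 * b : ℝ) : ℂ) * Complex.I by push_cast; ring,
        Complex.exp_ofReal_mul_I_im]
  rw [hexp]
  congr 1
  · congr 2
    apply Complex.ext <;>
    simp [rotate, rotZ, rotX, sphPoint, dotProduct, Fin.sum_univ_three, ← sub_eq_add_neg]
    ring
  · congr 1
    simp [rotate, rotZ, rotX, sphPoint, dotProduct, Fin.sum_univ_three, ← sub_eq_add_neg]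

/-- The harmonic `Y_n^l` can be tilted so that it vanishes at no vertex of the grid formed by `m = l/2`
great circles through the poles and given circles of latitude, and has there the sign of
`F_n^l (cos θ)`. -/
theorem exists_rotation {n l m : ℕ} (hm : 1 ≤ m) (hl : l = 2 * m) (hn : n = l ∨ n = l + 1)
    (V : Finset ℝ) (hV : ∀ θ ∈ V, 0 < θ ∧ θ < Real.pi) :
    ∃ R : SO3,
      (∀ θ ∈ V, ∀ j : ℤ, sphHarm n l (rotate R (sphPoint θ (Real.pi * j / m))) ≠ 0 ∧
        (legendreF n l (Real.cos θ) ≠ 0 →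
          0 < legendreF n l (Real.cos θ) *
            sphHarm n l (rotate R (sphPoint θ (Real.pi * j / m))))) ∧
      (∀ φ, sphHarm n l (rotate R (sphPoint 0 φ)) ≠ 0) ∧
      (∀ φ, sphHarm n l (rotate R (sphPoint Real.pi φ)) ≠ 0) := by
  have hF : (∀ x, legendreF n l x = 1) ∨ (∀ x, legendreF n l x = x) := by
    rcases hn with rfl | rfl
    · exact Or.inl (legendreF_self n)
    · exact Or.inr (legendreF_pred l)
  have hFc : Continuous (legendreF n l) := (contDiff_legendreF n l).continuous
  have hm0 : (0 : ℝ) < m := by exact_mod_cast hm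
  have hmC : (m : ℂ) ≠ 0 := by exact_mod_cast hm0.ne'
  -- Three facts rest on this value: l b = π/4 gives a positive sine on every meridian of the grid,
  -- 2 l b = π/2 gives the factor i at the poles, and b is no multiple of π/m, so that sin(πj/m - b)
  -- ≠ 0 on the equator.
  set b : ℝ := Real.pi / (8 * m) with hb
  let R : ℝ → SO3 := fun t => rotZ (2 * b) * rotX t * rotZ (-b)
  -- the imaginary part at `t = 0`
  have hcont : ∀ θ φ : ℝ, Continuous fun t : ℝ =>
      ((Complex.exp (2 * b * Complex.I) * ⟨Real.sin θ * Real.cos (φ - b),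
        Real.sin θ * Real.sin (φ - b) * Real.cos t - Real.cos θ * Real.sin t⟩) ^ l).im := by
    intro θ φ
    refine Complex.continuous_im.comp (Continuous.pow (continuous_const.mul ?_) l)
    have : (fun t : ℝ => (⟨Real.sin θ * Real.cos (φ - b),
        Real.sin θ * Real.sin (φ - b) * Real.cos t - Real.cos θ * Real.sin t⟩ : ℂ)) =
        fun t : ℝ => ((Real.sin θ * Real.cos (φ - b) : ℝ) : ℂ) +
          ((Real.sin θ * Real.sin (φ - b) * Real.cos t - Real.cos θ * Real.sin t : ℝ) : ℂ) *
            Complex.I := by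
      funext t
      rw [Complex.mk_eq_add_mul_I]
    rw [this]
    have h2 : Continuous fun t : ℝ =>
      Real.sin θ * Real.sin (φ - b) * Real.cos t - Real.cos θ * Real.sin t := by fun_prop
    exact continuous_const.add ((Complex.continuous_ofReal.comp h2).mul continuous_const)
  have him : ∀ θ, ∀ j : ℤ,
      ((Complex.exp (2 * b * Complex.I) * ⟨Real.sin θ * Real.cos (Real.pi * j / m - b),
        Real.sin θ * Real.sin (Real.pi * j / m - b) * Real.cos 0 - Real.cos θ * Real.sin 0⟩) ^ l).im
        = Real.sin θ ^ l * Real.sin (Real.pi / 4) := by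
    intro θ j
    have e1 : (⟨Real.sin θ * Real.cos (Real.pi * j / m - b),
        Real.sin θ * Real.sin (Real.pi * j / m - b) * Real.cos 0 - Real.cos θ * Real.sin 0⟩ : ℂ) =
        (Real.sin θ : ℂ) * Complex.exp ((Real.pi * j / m - b : ℝ) * Complex.I) := by
      apply Complex.ext
      · rw [Complex.re_ofReal_mul, Complex.exp_ofReal_mul_I_re]
      · rw [Complex.im_ofReal_mul, Complex.exp_ofReal_mul_I_im]; simp
    have e2 : (Complex.exp (2 * b * Complex.I) * ((Real.sin θ : ℂ) *
        Complex.exp ((Real.pi * j / m - b : ℝ) * Complex.I))) ^ l =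
        ((Real.sin θ ^ l : ℝ) : ℂ) * Complex.exp ((Real.pi / 4 : ℝ) * Complex.I) := by
      rw [mul_left_comm, mul_pow, ← Complex.exp_add, ← Complex.exp_nat_mul]
      push_cast
      congr 1
      rw [Complex.exp_eq_exp_iff_exists_int]
      refine ⟨j, ?_⟩
      rw [hl, hb]
      push_cast
      field_simp
      ring
    rw [e1, e2, Complex.im_ofReal_mul, Complex.exp_ofReal_mul_I_im]
  have hs4 : 0 < Real.sin (Real.pi / 4) :=
    Real.sin_pos_of_pos_of_lt_pi (by positivity) (by linarith [Real.pi_pos])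
  have hgrid : ∀ θ ∈ V, ∀ j : ℤ, ∀ᶠ t in 𝓝[>] (0 : ℝ),
      sphHarm n l (rotate (R t) (sphPoint θ (Real.pi * j / m))) ≠ 0 ∧
        (legendreF n l (Real.cos θ) ≠ 0 →
          0 < legendreF n l (Real.cos θ) *
            sphHarm n l (rotate (R t) (sphPoint θ (Real.pi * j / m)))) := by
    intro θ hθ j
    have hsin := Real.sin_pos_of_pos_of_lt_pi (hV θ hθ).1 (hV θ hθ).2
    have him0 := him θ j
    have hcj := hcont θ (Real.pi * j / m)
    -- A zero occurs only on the equator when F(x) = x. There the argument of F after the tilt is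
    -- sin θ sin(φ - b) sin t, nonzero for small t > 0; elsewhere continuity at t = 0 decides the
    -- sign.
    by_cases hF0 : legendreF n l (Real.cos θ) = 0
    · have hFx : ∀ x, legendreF n l x = x := by
        rcases hF with h | h
        · rw [h] at hF0; exact absurd hF0 one_ne_zero
        · exact h
      have hcos : Real.cos θ = 0 := by rwa [hFx] at hF0
      have h1 := hcj.continuousAt (x := 0) |>.eventually (lt_mem_nhds (a := (0 : ℝ)) (by
        beta_reduce
        rw [him0]
        positivity))
      filter_upwards [nhdsWithin_le_nhds h1, Ioo_mem_nhdsGT Real.pi_pos] with t ht1 ht2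
      refine ⟨?_, fun h => absurd hF0 h⟩
      simp only [R]
      rw [sphHarm_tilted, hFx, hcos]
      simp only [hcos] at ht1
      refine mul_ne_zero ht1.ne' ?_
      rw [zero_mul, add_zero]
      refine mul_ne_zero (mul_ne_zero hsin.ne' ?_)
        (Real.sin_pos_of_pos_of_lt_pi ht2.1 ht2.2).ne'
      intro hs
      obtain ⟨k, hk⟩ := Real.sin_eq_zero_iff.1 hs
      rw [hb] at hk
      field_simp at hk
      -- Impossible modulo 8.
      have hk' : k * m * 8 = 8 * j - 1 := by
        have : (k : ℝ) * m * 8 = 8 * j - 1 := by linarith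
        exact_mod_cast this
      omega
    · have hc2 : Continuous fun t : ℝ => legendreF n l (Real.cos θ) *
          sphHarm n l (rotate (R t) (sphPoint θ (Real.pi * j / m))) := by
        simp only [R, sphHarm_tilted]
        exact continuous_const.mul (hcj.mul (hFc.comp (by fun_prop)))
      have h1 := hc2.continuousAt (x := 0) |>.eventually (lt_mem_nhds (a := (0 : ℝ)) (by
        simp only [R]
        rw [sphHarm_tilted, him0]
        simp only [Real.sin_zero, Real.cos_zero, mul_zero, zero_add, mul_one]
        have : legendreF n l (Real.cos θ) * (Real.sin θ ^ l * Real.sin (Real.pi / 4) *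
          legendreF n l (Real.cos θ)) = Real.sin θ ^ l * Real.sin (Real.pi / 4) *
            legendreF n l (Real.cos θ) ^ 2 := by ring
        rw [this]
        positivity))
      filter_upwards [nhdsWithin_le_nhds h1] with t ht
      exact ⟨right_ne_zero_of_mul ht.ne', fun _ => ht⟩
  have hper : ∀ (t θ : ℝ) (j : ℤ), sphPoint θ (Real.pi * (j % (2 * m) : ℤ) / m) =
      sphPoint θ (Real.pi * j / m) := by
    intro t θ j
    have e : (Real.pi * j / m : ℝ) = Real.pi * (j % (2 * m) : ℤ) / m +
        (j / (2 * m) : ℤ) * (2 * Real.pi) := by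
      have h1 : (j : ℝ) = ((j % (2 * m) : ℤ) : ℝ) + 2 * m * ((j / (2 * m) : ℤ) : ℝ) := by
        exact_mod_cast (Int.emod_add_mul_ediv j (2 * m)).symm
      rw [h1]
      field_simp
    apply Subtype.ext
    simp only [sphPoint]
    rw [e, Real.cos_add_int_mul_two_pi, Real.sin_add_int_mul_two_pi]
  -- By periodicity only finitely many vertices matter, so one tilt serves all of them.
  have hall : ∀ᶠ t in 𝓝[>] (0 : ℝ), ∀ θ ∈ V, ∀ j ∈ Finset.Ico (0 : ℤ) (2 * m),
      sphHarm n l (rotate (R t) (sphPoint θ (Real.pi * j / m))) ≠ 0 ∧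
        (legendreF n l (Real.cos θ) ≠ 0 →
          0 < legendreF n l (Real.cos θ) *
            sphHarm n l (rotate (R t) (sphPoint θ (Real.pi * j / m)))) := by
    rw [Filter.eventually_all_finset]
    intro θ hθ
    rw [Filter.eventually_all_finset]
    exact fun j _ => hgrid θ hθ j
  have hpole : ∀ t ∈ Set.Ioo (0 : ℝ) (Real.pi / 2), ∀ c s : ℝ, (c = 1 ∨ c = -1) → s = 0 →
      ((Complex.exp (2 * b * Complex.I) * ⟨s, -(c * Real.sin t)⟩) ^ l).im *
      legendreF n l (c * Real.cos t) ≠ 0 := by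
    rintro t ht c s hc rfl
    have hcos : 0 < Real.cos t := Real.cos_pos_of_mem_Ioo ⟨by linarith [ht.1, Real.pi_pos], ht.2⟩
    have hsin : 0 < Real.sin t := Real.sin_pos_of_pos_of_lt_pi ht.1 (by linarith [ht.2, ht.1])
    have hc0 : c ≠ 0 := by rcases hc with rfl | rfl <;> norm_num
    refine mul_ne_zero ?_ ?_
    · have e : (Complex.exp (2 * b * Complex.I) * ⟨0, -(c * Real.sin t)⟩) ^ l =
          (((-(c * Real.sin t)) ^ l * (-1) ^ m : ℝ) : ℂ) * Complex.I := by
        have e1 : (⟨0, -(c * Real.sin t)⟩ : ℂ) = ((-(c * Real.sin t) : ℝ) : ℂ) * Complex.I := by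
          apply Complex.ext
          · rw [Complex.re_ofReal_mul]; simp
          · rw [Complex.im_ofReal_mul]; simp
        have e2 : (Complex.exp (2 * b * Complex.I)) ^ l = Complex.I := by
          have e4 : (l : ℂ) * (2 * b * Complex.I) = Real.pi / 2 * Complex.I := by
            rw [hl, hb]
            push_cast
            field_simp
            ring
          rw [← Complex.exp_nat_mul, e4, Complex.exp_pi_div_two_mul_I]
        rw [e1, mul_pow, mul_pow, e2]
        have e3 : Complex.I ^ l = (-1) ^ m := by rw [hl, pow_mul, Complex.I_sq]
        rw [e3]
        push_cast
        ring
      rw [e, Complex.im_ofReal_mul, Complex.I_im, mul_one]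
      have : -(c * Real.sin t) ≠ 0 := neg_ne_zero.2 (mul_ne_zero hc0 hsin.ne')
      positivity
    · rcases hF with h | h
      · rw [h]; exact one_ne_zero
      · rw [h]; exact mul_ne_zero hc0 hcos.ne'
  obtain ⟨t, ht1, ht2⟩ := (hall.and (Ioo_mem_nhdsGT (show (0 : ℝ) < Real.pi / 2 by positivity))).exists
  refine ⟨R t, ?_, ?_, ?_⟩
  · intro θ hθ j
    have h2m : (0 : ℤ) < 2 * m := by omega
    have := ht1 θ hθ (j % (2 * m)) (Finset.mem_Ico.2
      ⟨Int.emod_nonneg _ h2m.ne', Int.emod_lt_of_pos _ h2m⟩)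
    rwa [hper t] at this
  · intro φ
    simp only [R]
    rw [sphHarm_tilted]
    have := hpole t ht2 1 0 (Or.inl rfl) rfl
    simpa using this
  · intro φ
    simp only [R]
    rw [sphHarm_tilted]
    have := hpole t ht2 (-1) 0 (Or.inr rfl) rfl
    simpa using this

/-! ### Cells, kites and the resolution of the grid for small ε -/

/-- The sign `1` or `-1` of a Boolean. -/
def sg (b : Bool) : ℝ := if b then 1 else -1

@[simp] theorem sg_true : sg true = 1 := rfl
@[simp] theorem sg_false : sg false = -1 := rfl

/-- The midpoint of the `i`-th interval of a partition. -/
noncomputable def midpt (θ : ℕ → ℝ) (i : ℕ) : ℝ := (θ i + θ (i + 1)) / 2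

/-- Half the length of the `i`-th interval of a partition. -/
noncomputable def halfWidth (θ : ℕ → ℝ) (i : ℕ) : ℝ := (θ (i + 1) - θ i) / 2

/-- A function on `[0, π]` vanishing at the points of a partition and alternating in sign between
them, with simple zeros inside `(0, π)` and a steep behaviour at all zeros. -/
structure Grid (k : ℕ) (A : ℝ → ℝ) (θ : ℕ → ℝ) : Prop where
  left : θ 0 = 0
  right : θ (k + 1) = Real.pi
  lt : ∀ i ≤ k, θ i < θ (i + 1)
  sign : ∀ i ≤ k, ∀ x ∈ Set.Ioo (θ i) (θ (i + 1)), 0 < (-1) ^ i * A x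
  contDiff : ContDiff ℝ 1 A
  simple : ∀ i, 1 ≤ i → i ≤ k → A (θ i) = 0 ∧ deriv A (θ i) ≠ 0
  steep : ∀ i ≤ k, ∀ b : Bool,
    SteepZero fun u => (-1) ^ i * A (midpt θ i + sg b * halfWidth θ i * u)

/-- The row `i` is bounded on the side `b` by a pole. -/
def IsPolar (k i : ℕ) (b : Bool) : Prop := if b then i = k else i = 0

instance (k i : ℕ) (b : Bool) : Decidable (IsPolar k i b) := by
  unfold IsPolar; infer_instance

/-- The row adjacent to the row `i` on the side `b`. -/
def nextRow (i : ℕ) (b : Bool) : ℕ := if b then i + 1 else i - 1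

/-- The ratio of the widths of the cells on both sides of the edge that carries a kite; `lat`
tells whether this edge lies on a circle of latitude. -/
noncomputable def kappa (k : ℕ) (θ : ℕ → ℝ) (i : ℕ) (b lat : Bool) : ℝ :=
  if lat then
    if IsPolar k i b then 0 else halfWidth θ (nextRow i b) / halfWidth θ i
  else 1

/-- The coordinates of a kite with apex in the middle of the cell `(i, j)`. -/
noncomputable def chart (m : ℕ) (θ : ℕ → ℝ) (i : ℕ) (j : ℤ) (b c lat : Bool) (q : ℝ × ℝ) : S2 :=
  sphPoint (midpt θ i + sg b * halfWidth θ i * (if lat then q.1 else q.2))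
    (Real.pi / m * (j + 1 / 2 + sg c * (if lat then q.2 else q.1) / 2))

/-- The sign of the cell `(i, j)`. -/
noncomputable def cellSign (i : ℕ) (j : ℤ) : ℝ := (-1) ^ ((i : ℤ) + j)

theorem cellSign_eq (i : ℕ) (j : ℤ) : cellSign i j = (-1) ^ i * (-1) ^ j := by
  rw [cellSign, zpow_add₀ (by norm_num), zpow_natCast]

theorem cellSign_succ_left (i : ℕ) (j : ℤ) : cellSign (i + 1) j = -cellSign i j := by
  rw [cellSign_eq, cellSign_eq]; ring

theorem cellSign_add_one (i : ℕ) (j : ℤ) : cellSign i (j + 1) = -cellSign i j := by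
  rw [cellSign_eq, cellSign_eq, zpow_add₀ (by norm_num)]; simp

theorem cellSign_add_two_mul (i : ℕ) (j l : ℤ) : cellSign i (j + 2 * l) = cellSign i j := by
  rw [cellSign_eq, cellSign_eq, zpow_add₀ (by norm_num), zpow_mul]; simp

theorem cellSign_eq_or (i : ℕ) (j : ℤ) : cellSign i j = 1 ∨ cellSign i j = -1 := by
  rw [cellSign]
  rcases Int.even_or_odd ((i : ℤ) + j) with h | h
  · exact Or.inl h.neg_one_zpow
  · exact Or.inr h.neg_one_zpow

theorem contDiff_sphPoint : ContDiff ℝ ⊤ fun q : ℝ × ℝ => (sphPoint q.1 q.2 : E3) := by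
  rw [contDiff_euclidean]
  intro i
  have h1 : ContDiff ℝ ⊤ fun q : ℝ × ℝ => Real.sin q.1 := Real.contDiff_sin.comp contDiff_fst
  have h2 : ContDiff ℝ ⊤ fun q : ℝ × ℝ => Real.cos q.1 := Real.contDiff_cos.comp contDiff_fst
  have h3 : ContDiff ℝ ⊤ fun q : ℝ × ℝ => Real.sin q.2 := Real.contDiff_sin.comp contDiff_snd
  have h4 : ContDiff ℝ ⊤ fun q : ℝ × ℝ => Real.cos q.2 := Real.contDiff_cos.comp contDiff_snd
  fin_cases i
  · exact h1.mul h4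
  · exact h1.mul h3
  · exact h2

theorem continuous_sphPoint : Continuous fun q : ℝ × ℝ => sphPoint q.1 q.2 :=
  Continuous.subtype_mk contDiff_sphPoint.continuous _

theorem contDiff_chart (m : ℕ) (θ : ℕ → ℝ) (i : ℕ) (j : ℤ) (b c lat : Bool) :
    ContDiff ℝ ⊤ fun q => (chart m θ i j b c lat q : E3) := by
  have h : ContDiff ℝ ⊤ fun q : ℝ × ℝ =>
      (midpt θ i + sg b * halfWidth θ i * (if lat then q.1 else q.2),
        Real.pi / m * (j + 1 / 2 + sg c * (if lat then q.2 else q.1) / 2)) := by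
    cases lat
    · simp only [Bool.false_eq_true, if_false]; fun_prop
    · simp only [if_true]; fun_prop
  have h' := contDiff_sphPoint.comp h
  simp only [Function.comp_def] at h'
  exact h'

theorem continuous_chart (m : ℕ) (θ : ℕ → ℝ) (i : ℕ) (j : ℤ) (b c lat : Bool) :
    Continuous (chart m θ i j b c lat) :=
  Continuous.subtype_mk (contDiff_chart m θ i j b c lat).continuous _

theorem chart_add_period {m : ℕ} (hm : 1 ≤ m) (θ : ℕ → ℝ) (i : ℕ) (j l : ℤ) (b c lat : Bool) :
    chart m θ i (j + 2 * (m * l)) b c lat = chart m θ i j b c lat := by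
  funext q
  have hm0 : (m : ℝ) ≠ 0 := by exact_mod_cast (by omega : m ≠ 0)
  have e : ∀ y : ℝ, Real.pi / m * (((j + 2 * (m * l) : ℤ) : ℝ) + 1 / 2 + y) =
      Real.pi / m * (j + 1 / 2 + y) + l * (2 * Real.pi) := by
    intro y; push_cast; field_simp; ring
  apply Subtype.ext
  simp only [chart, sphPoint]
  rw [e, Real.cos_add_int_mul_two_pi, Real.sin_add_int_mul_two_pi]

/-- The values at the vertices of the grid of a function on the sphere. -/
noncomputable def vertexValue (m : ℕ) (θ : ℕ → ℝ) (g : S2 → ℝ) (i : ℕ) (j : ℤ) : ℝ :=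
  g (sphPoint (θ i) (Real.pi / m * j))

theorem midpt_add_sg (θ : ℕ → ℝ) (i : ℕ) (b : Bool) :
    midpt θ i + sg b * halfWidth θ i * 1 = θ (i + b.toNat) := by
  cases b <;> simp [midpt, halfWidth] <;> ring

theorem chart_one_one (m : ℕ) (θ : ℕ → ℝ) (i : ℕ) (j : ℤ) (b c lat : Bool) :
    chart m θ i j b c lat (1, 1) =
      sphPoint (θ (i + b.toNat)) (Real.pi / m * ((j + c.toNat : ℤ) : ℝ)) := by
  have : (j + 1 / 2 + sg c * 1 / 2 : ℝ) = ((j + c.toNat : ℤ) : ℝ) := by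
    cases c <;> simp <;> ring
  simp only [chart, ite_self]
  rw [midpt_add_sg, this]

theorem deriv_neg_of_pos_of_zero {a : ℝ → ℝ} {d : ℝ} (hpos : ∀ t, 0 ≤ t → t < 1 → 0 < a t)
    (h1 : a 1 = 0) (hd : HasDerivAt a d 1) (hne : d ≠ 0) : d < 0 := by
  refine lt_of_le_of_ne ?_ hne
  by_contra hcon
  have hslope := (hasDerivAt_iff_tendsto_slope.1 hd).eventually (lt_mem_nhds (not_le.1 hcon))
  have hleft : 𝓝[<] (1 : ℝ) ≤ 𝓝[≠] 1 := nhdsWithin_mono _ fun y hy => ne_of_lt hy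
  obtain ⟨y, hy1, hy2⟩ := ((hslope.filter_mono hleft).and
    (Ioo_mem_nhdsLT (zero_lt_one (α := ℝ)))).exists
  rw [slope_def_field, h1, sub_zero] at hy1
  exact lt_asymm hy1 (div_neg_of_pos_of_neg (hpos y hy2.1.le hy2.2) (sub_neg.2 hy2.2))

/-- At 1 the function vanishes while minus its derivative is positive, so continuity gives the
inequality for any rate K. -/
theorem steepZero_of_simple {a : ℝ → ℝ} (ha : ContDiff ℝ 1 a) (hpos : ∀ t, 0 ≤ t → t < 1 → 0 < a t)
    (h1 : a 1 = 0) (hd : deriv a 1 < 0) : SteepZero a := by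
  refine ⟨ha, hpos, h1, fun K => ?_⟩
  have hc : Continuous fun t => -deriv a t - K * a t :=
    (ha.continuous_deriv le_rfl).neg.sub (ha.continuous.const_mul K)
  have := hc.continuousAt (x := 1) |>.eventually (lt_mem_nhds (a := (0 : ℝ)) (by
    simp only [h1]; linarith))
  filter_upwards [nhdsWithin_le_nhds this] with t ht
  linarith

theorem hasDerivAt_cos_half (v : ℝ) : HasDerivAt (fun v : ℝ => Real.cos (Real.pi / 2 * v))
    (-Real.sin (Real.pi / 2 * v) * (Real.pi / 2)) v := by
  have := ((hasDerivAt_id v).const_mul (Real.pi / 2)).cos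
  simp only [id, mul_one] at this
  exact this

theorem deriv_cos_half : deriv (fun v : ℝ => Real.cos (Real.pi / 2 * v)) 1 < 0 := by
  rw [(hasDerivAt_cos_half 1).deriv]
  simp [Real.pi_pos]

theorem steepZero_cos_half : SteepZero fun v => Real.cos (Real.pi / 2 * v) := by
  refine steepZero_of_simple ?_ ?_ (by simp) deriv_cos_half
  · exact Real.contDiff_cos.comp (by fun_prop)
  · intro t h0 h1
    apply Real.cos_pos_of_mem_Ioo
    constructor <;> nlinarith [Real.pi_pos]

section

variable {k : ℕ} {A : ℝ → ℝ} {θ : ℕ → ℝ}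

theorem Grid.halfWidth_pos (H : Grid k A θ) {i : ℕ} (hi : i ≤ k) : 0 < halfWidth θ i := by
  have := H.lt i hi
  simp only [halfWidth]; linarith

theorem nextRow_le {i : ℕ} {b : Bool} (hi : i ≤ k) (hb : ¬ IsPolar k i b) : nextRow i b ≤ k := by
  cases b <;> simp [IsPolar, nextRow] at hb ⊢ <;> omega

theorem Grid.kappa_nonneg (H : Grid k A θ) {i : ℕ} (hi : i ≤ k) (b lat : Bool) :
    0 ≤ kappa k θ i b lat := by
  unfold kappa
  split_ifs with h1 h2
  · exact le_rfl
  · exact (div_pos (H.halfWidth_pos (nextRow_le hi h2)) (H.halfWidth_pos hi)).le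
  · exact zero_le_one

/-- Beyond a nonpolar edge the function continues with the opposite sign. -/
theorem Grid.beyond (H : Grid k A θ) {i : ℕ} (hi : i ≤ k) {b : Bool} (hb : ¬ IsPolar k i b) :
    0 < kappa k θ i b true ∧
    deriv (fun u => (-1) ^ i * A (midpt θ i + sg b * halfWidth θ i * u)) 1 < 0 ∧
    ∀ t, 1 < t → t ≤ 1 + kappa k θ i b true →
      (-1) ^ i * A (midpt θ i + sg b * halfWidth θ i * t) < 0 := by
  have hw := H.halfWidth_pos hi
  have hw' := H.halfWidth_pos (nextRow_le hi hb)
  have hκ : kappa k θ i b true = halfWidth θ (nextRow i b) / halfWidth θ i := by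
    simp [kappa, hb]
  refine ⟨by rw [hκ]; exact div_pos hw' hw, ?_, ?_⟩
  · have hS := H.steep i hi b
    have hAd : ∀ x, HasDerivAt A (deriv A x) x := fun x =>
      (H.contDiff.differentiable one_ne_zero x).hasDerivAt
    have hlin : HasDerivAt (fun u : ℝ => midpt θ i + sg b * halfWidth θ i * u)
        (sg b * halfWidth θ i * 1) 1 := ((hasDerivAt_id (1 : ℝ)).const_mul _).const_add _
    have hd := ((hAd _).comp (1 : ℝ) hlin).const_mul ((-1) ^ i)
    simp only [Function.comp_def] at hd
    rw [midpt_add_sg] at hd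
    rw [hd.deriv]
    have hne : deriv A (θ (i + b.toNat)) ≠ 0 := by
      refine (H.simple _ ?_ ?_).2 <;> cases b <;> simp [IsPolar] at hb ⊢ <;> omega
    have hsg : sg b ≠ 0 := by cases b <;> simp
    exact deriv_neg_of_pos_of_zero hS.pos hS.zero hd (by positivity)
  · intro t ht1 ht2
    rw [hκ] at ht2
    have ht3 : (t - 1) * halfWidth θ i ≤ halfWidth θ (nextRow i b) := by
      have : t - 1 ≤ halfWidth θ (nextRow i b) / halfWidth θ i := by linarith
      rwa [le_div_iff₀ hw] at this
    have ht4 : 0 < (t - 1) * halfWidth θ i := mul_pos (by linarith) hw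
    cases b
    · obtain ⟨l, rfl⟩ : ∃ l, i = l + 1 := ⟨i - 1, by simp [IsPolar] at hb; omega⟩
      have hs := H.sign l (by omega) (midpt θ (l + 1) + sg false * halfWidth θ (l + 1) * t) (by
        simp [midpt, halfWidth, nextRow] at ht3 ht4 hw hw' ⊢
        constructor <;> linarith)
      rw [pow_succ]; linarith
    · have hi' : i + 1 ≤ k := nextRow_le hi hb
      have hs := H.sign (i + 1) hi' (midpt θ i + sg true * halfWidth θ i * t) (by
        simp [midpt, halfWidth, nextRow] at ht3 ht4 hw hw' ⊢
        constructor <;> linarith)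
      rw [pow_succ] at hs; linarith

theorem sin_column {m : ℕ} (hm : 1 ≤ m) (j : ℤ) (c : Bool) (y : ℝ) :
    Real.sin (m * (Real.pi / m * (j + 1 / 2 + sg c * y / 2))) =
      (-1) ^ j * Real.cos (Real.pi / 2 * y) := by
  have hm0 : (m : ℝ) ≠ 0 := by exact_mod_cast (by omega : m ≠ 0)
  have e : (m * (Real.pi / m * (j + 1 / 2 + sg c * y / 2)) : ℝ) =
      (sg c * (Real.pi / 2 * y) + Real.pi / 2) + j * Real.pi := by field_simp; ring
  rw [e, Real.sin_add_int_mul_pi, Real.sin_add_pi_div_two]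
  cases c <;> simp

/-- The edge u = 1 collapses to the pole, so the sign of the perturbation at the vertex is its sign
along the entire edge. -/
theorem chart_polar (H : Grid k A θ) (m : ℕ) {i : ℕ} {b : Bool} (hb : IsPolar k i b)
    (j : ℤ) (c : Bool) (v : ℝ) :
    chart m θ i j b c true (1, v) = chart m θ i j b c true (1, 1) := by
  have hsin : Real.sin (θ (i + b.toNat)) = 0 := by
    cases b <;> simp [IsPolar] at hb <;> subst hb <;> simp [H.left, H.right]
  apply Subtype.ext
  simp only [chart, if_true]
  rw [midpt_add_sg]
  simp [sphPoint, hsin]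

/-- The kite over a half-edge is seen from the cell that its corner cuts off. -/
def Active (γ : ℕ → ℤ → ℝ) (i : ℕ) (j : ℤ) (b c : Bool) : Prop :=
  cellSign i j * γ (i + b.toNat) (j + c.toNat) < 0

/-- The nodal set of `h` is resolved along the grid: all active kites are crossed by it in regular
arcs, and it avoids the inactive half-cells at the poles. -/
structure Resolved (m k : ℕ) (θ : ℕ → ℝ) (γ : ℕ → ℤ → ℝ) (h : S2 → ℝ) : Prop where
  kite_zeros : ∀ i ≤ k, ∀ j b c lat, Active γ i j b c →
    KiteZeros (kappa k θ i b lat) fun q => h (chart m θ i j b c lat q)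
  polar : ∀ i ≤ k, ∀ j b c, IsPolar k i b → ¬ Active γ i j b c →
    ∀ q ∈ kite 0, h (chart m θ i j b c true q) ≠ 0

variable {m : ℕ} {f g : S2 → ℝ} {gE : E3 → ℝ}

theorem Grid.apply_chart (hm : 1 ≤ m) (hf : ∀ x φ, f (sphPoint x φ) = A x * Real.sin (m * φ))
    (i : ℕ) (j : ℤ) (b c lat : Bool) (q : ℝ × ℝ) :
    f (chart m θ i j b c lat q) = cellSign i j *
      (((-1) ^ i * A (midpt θ i + sg b * halfWidth θ i * (if lat then q.1 else q.2))) *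
        Real.cos (Real.pi / 2 * (if lat then q.2 else q.1))) := by
  have h1 : ((-1 : ℝ) ^ i) * (-1) ^ i = 1 := by rw [← mul_pow]; simp
  rw [chart, hf, sin_column hm, cellSign_eq]
  linear_combination -(A (midpt θ i + sg b * halfWidth θ i * (if lat then q.1 else q.2)) *
    (-1) ^ j * Real.cos (Real.pi / 2 * (if lat then q.2 else q.1))) * h1

/-- Multiplication by minus the sign of the cell produces the normal form of `eventually_kiteZeros`,
in which activity of the corner reads G(1, 1) > 0. The factor transversal to the edge is the
latitude profile for edges on circles of latitude and the cosine for edges on meridians; the two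
factors exchange roles. -/
theorem Grid.eventually_kiteZeros_chart (H : Grid k A θ) (hm : 1 ≤ m)
    (hf : ∀ x φ, f (sphPoint x φ) = A x * Real.sin (m * φ))
    (hg : ∀ p : S2, g p = gE p) (hgE : ContDiff ℝ ⊤ gE) {i : ℕ} (hi : i ≤ k) (j : ℤ)
    (b c lat : Bool) (hact : Active (vertexValue m θ g) i j b c) :
    ∀ᶠ ε in 𝓝[>] (0 : ℝ), KiteZeros (kappa k θ i b lat)
      fun q => f (chart m θ i j b c lat q) + ε * g (chart m θ i j b c lat q) := by
  set a : ℝ → ℝ := fun u => (-1) ^ i * A (midpt θ i + sg b * halfWidth θ i * u) with ha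
  set B : ℝ → ℝ := fun v => Real.cos (Real.pi / 2 * v) with hB
  set G : ℝ × ℝ → ℝ := fun q => -cellSign i j * g (chart m θ i j b c lat q) with hG
  have haS : SteepZero a := H.steep i hi b
  have hBS : SteepZero B := steepZero_cos_half
  have hGc : ContDiff ℝ 1 G := by
    have : G = fun q => -cellSign i j * gE (chart m θ i j b c lat q) := by
      funext q; simp only [hG, hg]
    rw [this]
    exact contDiff_const.mul ((hgE.comp (contDiff_chart m θ i j b c lat)).of_le le_top)
  have hG1 : 0 < G (1, 1) := by
    simp only [hG]
    rw [chart_one_one]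
    have := hact
    simp only [Active, vertexValue] at this
    linarith
  have hmain : ∀ᶠ ε in 𝓝[>] (0 : ℝ), KiteZeros (kappa k θ i b lat) fun q =>
      -cellSign i j * (f (chart m θ i j b c lat q) + ε * g (chart m θ i j b c lat q)) := by
    have hsq : cellSign i j * cellSign i j = 1 := by
      rcases cellSign_eq_or i j with h | h <;> rw [h] <;> norm_num
    cases lat
    · rw [show kappa k θ i b false = 1 by simp [kappa]]
      have := eventually_kiteZeros hBS haS hGc zero_le_one hG1 (Or.inl ⟨one_pos, deriv_cos_half, ?_⟩)
      · filter_upwards [this] with ε hε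
        convert hε using 2 with q
        rw [Grid.apply_chart hm hf]
        simp only [hB, hG, ha, Bool.false_eq_true, if_false]
        linear_combination -(Real.cos (Real.pi / 2 * q.1) *
          ((-1) ^ i * A (midpt θ i + sg b * halfWidth θ i * q.2))) * hsq
      · intro t h1 h2
        simp only [hB]
        apply Real.cos_neg_of_pi_div_two_lt_of_lt <;> nlinarith [Real.pi_pos]
    · have := eventually_kiteZeros haS hBS hGc (H.kappa_nonneg hi b true) hG1 ?_
      · filter_upwards [this] with ε hε
        convert hε using 2 with q
        rw [Grid.apply_chart hm hf]
        simp only [hB, hG, ha, if_true]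
        linear_combination -(((-1) ^ i * A (midpt θ i + sg b * halfWidth θ i * q.1)) *
          Real.cos (Real.pi / 2 * q.2)) * hsq
      · by_cases hp : IsPolar k i b
        · right
          refine ⟨by simp [kappa, hp], fun v _ => ?_⟩
          simp only [hG] at hG1 ⊢
          rwa [chart_polar H m hp]
        · exact Or.inl (H.beyond hi hp)
  filter_upwards [hmain] with ε hε
  rcases cellSign_eq_or i j with h | h
  · rw [h] at hε
    apply KiteZeros.of_neg
    simpa using hε
  · rw [h] at hε
    simpa using hε

/-- At an inactive pole the perturbation has the sign of the cell, so it reinforces the unperturbed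
function where that one vanishes. -/
theorem Grid.eventually_polar (H : Grid k A θ) (hm : 1 ≤ m)
    (hf : ∀ x φ, f (sphPoint x φ) = A x * Real.sin (m * φ))
    (hg : ∀ p : S2, g p = gE p) (hgE : ContDiff ℝ ⊤ gE) {i : ℕ} (hi : i ≤ k) (j : ℤ)
    (b c : Bool) (hp : IsPolar k i b) (hne : ∀ i ≤ k + 1, ∀ j, vertexValue m θ g i j ≠ 0)
    (hact : ¬ Active (vertexValue m θ g) i j b c) :
    ∀ᶠ ε in 𝓝[>] (0 : ℝ), ∀ q ∈ kite 0,
      f (chart m θ i j b c true q) + ε * g (chart m θ i j b c true q) ≠ 0 := by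
  have haS : SteepZero fun u => (-1) ^ i * A (midpt θ i + sg b * halfWidth θ i * u) := H.steep i hi b
  have hBS : SteepZero fun v => Real.cos (Real.pi / 2 * v) := steepZero_cos_half
  have hsq : cellSign i j * cellSign i j = 1 := by
    rcases cellSign_eq_or i j with h | h <;> rw [h] <;> norm_num
  have hgc : Continuous g := by
    rw [show g = fun p : S2 => gE p from funext hg]
    exact hgE.continuous.comp continuous_subtype_val
  have hfq : ∀ q, cellSign i j * f (chart m θ i j b c true q) =
      ((-1) ^ i * A (midpt θ i + sg b * halfWidth θ i * q.1)) * Real.cos (Real.pi / 2 * q.2) := by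
    intro q
    rw [Grid.apply_chart hm hf]
    simp only [if_true]
    linear_combination (((-1) ^ i * A (midpt θ i + sg b * halfWidth θ i * q.1)) *
          Real.cos (Real.pi / 2 * q.2)) * hsq
  have hpos : ∀ q ∈ kite 0, q.1 < 1 → 0 < cellSign i j * f (chart m θ i j b c true q) := by
    intro q hq h1
    rw [hfq]
    exact mul_pos (haS.pos _ (hq.1.trans hq.2.1) h1) (hBS.pos _ hq.1 (hq.2.1.trans_lt h1))
  have hle : ∀ q ∈ kite 0, q.1 ≤ 1 := by
    intro q hq
    have := hq.2.2
    linarith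
  have hone : ∀ q ∈ kite 0, q.1 = 1 → cellSign i j * f (chart m θ i j b c true q) = 0 := by
    intro q _ h1
    rw [hfq, h1]
    have := haS.zero
    rw [this, zero_mul]
  have key := eventually_pos_on_compact (isCompact_kite le_rfl)
    (f := fun q => cellSign i j * f (chart m θ i j b c true q))
    (g := fun q => cellSign i j * g (chart m θ i j b c true q)) ?_
    (continuous_const.mul (hgc.comp (continuous_chart m θ i j b c true))) ?_ ?_
  · filter_upwards [key] with ε hε q hq h0
    have h1 := hε q hq
    have h2 : cellSign i j * f (chart m θ i j b c true q) +
      ε * (cellSign i j * g (chart m θ i j b c true q)) = cellSign i j *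
        (f (chart m θ i j b c true q) + ε * g (chart m θ i j b c true q)) := by ring
    rw [h2, h0, mul_zero] at h1
    exact lt_irrefl _ h1
  · simp only [hfq]
    have h1 := haS.contDiff.continuous.comp (continuous_fst (X := ℝ) (Y := ℝ))
    have h2 := hBS.contDiff.continuous.comp (continuous_snd (X := ℝ) (Y := ℝ))
    exact h1.mul h2
  · intro q hq
    rcases (hle q hq).lt_or_eq with h | h
    · exact (hpos q hq h).le
    · exact (hone q hq h).ge
  · intro q hq h0
    rcases (hle q hq).lt_or_eq with h | h
    · exact absurd h0 (hpos q hq h).ne'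
    · have hq1 : q = (1, q.2) := Prod.ext h rfl
      have hv : 0 ≤ cellSign i j * vertexValue m θ g (i + b.toNat) (j + c.toNat) := not_lt.1 hact
      have hv0 := hne (i + b.toNat) (by cases b <;> simp <;> omega) (j + c.toNat)
      rw [hq1, chart_polar H m hp, chart_one_one]
      refine lt_of_le_of_ne hv (Ne.symm (mul_ne_zero ?_ hv0))
      rcases cellSign_eq_or i j with h | h <;> rw [h] <;> norm_num

theorem vertexValue_add_period (hm : 1 ≤ m) (i : ℕ) (j l : ℤ) :
    vertexValue m θ g i (j + 2 * (m * l)) = vertexValue m θ g i j := by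
  have hm0 : (m : ℝ) ≠ 0 := by exact_mod_cast (by omega : m ≠ 0)
  have e : Real.pi / m * ((j + 2 * (m * l) : ℤ) : ℝ) = Real.pi / m * j + l * (2 * Real.pi) := by
    push_cast; field_simp
  unfold vertexValue
  congr 1
  apply Subtype.ext
  simp only [sphPoint]
  rw [e, Real.cos_add_int_mul_two_pi, Real.sin_add_int_mul_two_pi]

theorem active_add_period {γ : ℕ → ℤ → ℝ} (hγ : ∀ i j l, γ i (j + 2 * (m * l)) = γ i j)
    (i : ℕ) (j l : ℤ) (b c : Bool) :
    Active γ i (j + 2 * (m * l)) b c ↔ Active γ i j b c := by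
  unfold Active
  rw [cellSign_add_two_mul, add_right_comm, hγ]

/-- Everything is 2m-periodic in the column, so only finitely many smallness conditions on ε have to
be met. -/
theorem Grid.eventually_resolved (H : Grid k A θ) (hm : 1 ≤ m)
    (hf : ∀ x φ, f (sphPoint x φ) = A x * Real.sin (m * φ))
    (hg : ∀ p : S2, g p = gE p) (hgE : ContDiff ℝ ⊤ gE)
    (hne : ∀ i ≤ k + 1, ∀ j, vertexValue m θ g i j ≠ 0) :
    ∀ᶠ ε in 𝓝[>] (0 : ℝ), Resolved m k θ (vertexValue m θ g) fun p => f p + ε * g p := by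
  have h1 : ∀ᶠ ε in 𝓝[>] (0 : ℝ), ∀ i ∈ Finset.range (k + 1), ∀ j ∈ Finset.Ico (0 : ℤ) (2 * m),
      ∀ b c : Bool,
      (∀ lat, Active (vertexValue m θ g) i j b c → KiteZeros (kappa k θ i b lat)
        fun q => f (chart m θ i j b c lat q) + ε * g (chart m θ i j b c lat q)) ∧
      (IsPolar k i b → ¬ Active (vertexValue m θ g) i j b c → ∀ q ∈ kite 0,
        f (chart m θ i j b c true q) + ε * g (chart m θ i j b c true q) ≠ 0) := by
    rw [Filter.eventually_all_finset]
    intro i hi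
    have hi' : i ≤ k := Nat.lt_succ_iff.1 (Finset.mem_range.1 hi)
    rw [Filter.eventually_all_finset]
    intro j _
    simp only [Filter.eventually_all, Filter.eventually_and]
    intro b c
    exact ⟨fun lat hact => H.eventually_kiteZeros_chart hm hf hg hgE hi' j b c lat hact,
      fun hp hact => H.eventually_polar hm hf hg hgE hi' j b c hp hne hact⟩
  filter_upwards [h1] with ε hε
  have h2m : (0 : ℤ) < 2 * m := by omega
  have hmod : ∀ j : ℤ, j % (2 * m) ∈ Finset.Ico (0 : ℤ) (2 * m) := fun j =>
    Finset.mem_Ico.2 ⟨Int.emod_nonneg _ h2m.ne', Int.emod_lt_of_pos _ h2m⟩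
  have hj : ∀ j : ℤ, j = j % (2 * m) + 2 * (m * (j / (2 * m))) := by
    intro j
    have := Int.emod_add_mul_ediv j (2 * m)
    linarith
  constructor
  · intro i hi j b c lat hact
    rw [hj j] at hact ⊢
    rw [active_add_period (fun i j l => vertexValue_add_period hm i j l)] at hact
    rw [chart_add_period hm]
    exact (hε i (Finset.mem_range.2 (Nat.lt_succ_of_le hi)) _ (hmod j) b c).1 lat hact
  · intro i hi j b c hp hact
    rw [hj j] at hact ⊢
    rw [active_add_period (fun i j l => vertexValue_add_period hm i j l)] at hact
    rw [chart_add_period hm]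
    exact (hε i (Finset.mem_range.2 (Nat.lt_succ_of_le hi)) _ (hmod j) b c).2 hp hact

end

/-! ### Grid coordinates and the covering of the zeros by active kites -/

/-- The piecewise linear function with the value `θ i` at `i` for `0 ≤ i ≤ k + 1`. -/
noncomputable def interp (k : ℕ) (θ : ℕ → ℝ) (x : ℝ) : ℝ :=
  θ 0 + ∑ l ∈ Finset.range (k + 1), (θ (l + 1) - θ l) * max 0 (min 1 (x - l))

theorem continuous_interp (k : ℕ) (θ : ℕ → ℝ) : Continuous (interp k θ) := by
  unfold interp
  fun_prop

theorem interp_eq {k : ℕ} (θ : ℕ → ℝ) {i : ℕ} (hi : i ≤ k) {x : ℝ} (h1 : (i : ℝ) ≤ x)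
    (h2 : x ≤ i + 1) : interp k θ x = θ i + (θ (i + 1) - θ i) * (x - i) := by
  unfold interp
  rw [← Finset.sum_subset (Finset.range_mono (Nat.succ_le_succ hi)), Finset.sum_range_succ]
  · have e1 : ∑ l ∈ Finset.range i, (θ (l + 1) - θ l) * max 0 (min 1 (x - l)) = θ i - θ 0 := by
      rw [← Finset.sum_range_sub]
      apply Finset.sum_congr rfl
      intro l hl
      have : (l : ℝ) + 1 ≤ i := by exact_mod_cast Finset.mem_range.1 hl
      rw [min_eq_left (by linarith), max_eq_right zero_le_one, mul_one]
    rw [e1, min_eq_right (by linarith), max_eq_right (by linarith)]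
    ring
  · intro l _ hl
    have : (i : ℝ) + 1 ≤ l := by
      have : i + 1 ≤ l := by simpa using hl
      exact_mod_cast this
    rw [max_eq_left ((min_le_right _ _).trans (by linarith)), mul_zero]

section

variable {k m : ℕ} {A : ℝ → ℝ} {θ : ℕ → ℝ}

theorem Grid.interp_strictMonoOn (H : Grid k A θ) :
    StrictMonoOn (interp k θ) (Set.Icc 0 (k + 1)) := by
  intro x hx y hy hxy
  have hl : ⌊x⌋₊ < k + 1 := by
    rw [Nat.floor_lt hx.1]
    push_cast
    exact hxy.trans_le hy.2
  unfold interp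
  gcongr 1
  apply Finset.sum_lt_sum
  · intro l hl
    have := H.lt l (Nat.lt_succ_iff.1 (Finset.mem_range.1 hl))
    apply mul_le_mul_of_nonneg_left _ (by linarith)
    gcongr
  · refine ⟨⌊x⌋₊, Finset.mem_range.2 hl, ?_⟩
    have := H.lt _ (Nat.lt_succ_iff.1 hl)
    apply mul_lt_mul_of_pos_left _ (by linarith)
    have h1 := Nat.floor_le hx.1
    have h2 := Nat.lt_floor_add_one x
    rw [min_eq_right (by linarith), max_eq_right (by linarith)]
    exact lt_max_of_lt_right (lt_min (by linarith) (by linarith))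

theorem Grid.interp_zero (H : Grid k A θ) : interp k θ 0 = 0 := by
  rw [interp_eq θ (Nat.zero_le k) (by simp) (by simp), H.left]; simp

theorem Grid.interp_last (H : Grid k A θ) : interp k θ (k + 1) = Real.pi := by
  rw [interp_eq θ le_rfl (by simp) le_rfl, H.right]; ring

theorem Grid.interp_mem (H : Grid k A θ) {x : ℝ} (hx : x ∈ Set.Icc (0 : ℝ) (k + 1)) :
    interp k θ x ∈ Set.Icc 0 Real.pi := by
  have h0 : (0 : ℝ) ≤ k + 1 := by positivity
  constructor
  · rw [← H.interp_zero]
    exact H.interp_strictMonoOn.monotoneOn ⟨le_rfl, h0⟩ hx hx.1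
  · rw [← H.interp_last]
    exact H.interp_strictMonoOn.monotoneOn hx ⟨h0, le_rfl⟩ hx.2

theorem Grid.interp_mem_Ioo (H : Grid k A θ) {x : ℝ} (h1 : 0 < x) (h2 : x < k + 1) :
    interp k θ x ∈ Set.Ioo 0 Real.pi := by
  have h0 : (0 : ℝ) ≤ k + 1 := by positivity
  constructor
  · rw [← H.interp_zero]
    exact H.interp_strictMonoOn ⟨le_rfl, h0⟩ ⟨h1.le, h2.le⟩ h1
  · rw [← H.interp_last]
    exact H.interp_strictMonoOn ⟨h1.le, h2.le⟩ ⟨h0, le_rfl⟩ h2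

theorem exists_sphPoint (p : S2) : ∃ x ∈ Set.Icc 0 Real.pi, ∃ φ, sphPoint x φ = p := by
  have hp : (p : E3) 0 ^ 2 + (p : E3) 1 ^ 2 + (p : E3) 2 ^ 2 = 1 := by
    have h := mem_sphere_zero_iff_norm.1 p.2
    have h2 := EuclideanSpace.norm_sq_eq (p : E3)
    rw [h, Fin.sum_univ_three] at h2
    simpa using h2.symm
  have hz : -1 ≤ (p : E3) 2 ∧ (p : E3) 2 ≤ 1 := by
    constructor <;> nlinarith [sq_nonneg ((p : E3) 0), sq_nonneg ((p : E3) 1)]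
  set z : ℂ := ⟨(p : E3) 0, (p : E3) 1⟩ with hzdef
  have hnorm : ‖z‖ = Real.sin (Real.arccos ((p : E3) 2)) := by
    rw [Real.sin_arccos, Complex.norm_def, Complex.normSq_apply]
    congr 1
    simp only [hzdef]
    linarith
  refine ⟨Real.arccos ((p : E3) 2), ⟨Real.arccos_nonneg _, Real.arccos_le_pi _⟩, Complex.arg z, ?_⟩
  apply Subtype.ext
  ext i
  have h0 := Complex.norm_mul_cos_arg z
  have h1 := Complex.norm_mul_sin_arg z
  rw [hnorm] at h0 h1
  fin_cases i
  · exact h0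
  · exact h1
  · exact Real.cos_arccos hz.1 hz.2

theorem sphPoint_inj {x x' φ φ' : ℝ} (hx : x ∈ Set.Ioo 0 Real.pi) (hx' : x' ∈ Set.Icc 0 Real.pi)
    (h : sphPoint x φ = sphPoint x' φ') : x = x' ∧ ∃ l : ℤ, φ - φ' = 2 * Real.pi * l := by
  have h' : (sphPoint x φ : E3) = sphPoint x' φ' := congrArg Subtype.val h
  have h0 : Real.sin x * Real.cos φ = Real.sin x' * Real.cos φ' := congrArg (fun v : E3 => v 0) h'
  have h1 : Real.sin x * Real.sin φ = Real.sin x' * Real.sin φ' := congrArg (fun v : E3 => v 1) h'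
  have h2 : Real.cos x = Real.cos x' := congrArg (fun v : E3 => v 2) h'
  have hxx : x = x' := Real.injOn_cos ⟨hx.1.le, hx.2.le⟩ hx' h2
  subst hxx
  have hs := (Real.sin_pos_of_pos_of_lt_pi hx.1 hx.2).ne'
  refine ⟨rfl, Real.Angle.angle_eq_iff_two_pi_dvd_sub.1 (Real.Angle.cos_sin_inj
    (mul_left_cancel₀ hs h0) (mul_left_cancel₀ hs h1))⟩

theorem Grid.exists_interp (H : Grid k A θ) (hm : 1 ≤ m) (p : S2) :
    ∃ x ∈ Set.Icc (0 : ℝ) (k + 1), ∃ y, sphPoint (interp k θ x) (Real.pi / m * y) = p := by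
  have hm0 : (m : ℝ) ≠ 0 := by exact_mod_cast (by omega : m ≠ 0)
  obtain ⟨t, ht, φ, rfl⟩ := exists_sphPoint p
  have h0 : (0 : ℝ) ≤ k + 1 := by positivity
  have hsub := intermediate_value_Icc h0 (continuous_interp k θ).continuousOn
  rw [H.interp_zero, H.interp_last] at hsub
  obtain ⟨x, hx, rfl⟩ := hsub ht
  refine ⟨x, hx, m * φ / Real.pi, ?_⟩
  congr 1
  field_simp

/-- In the coordinates in which all cells are unit squares, the kites of a cell make up the diamond
that circumscribes it. -/
theorem Grid.exists_kite_point (H : Grid k A θ) {i : ℕ} (hi : i ≤ k) (j : ℤ) {b c lat : Bool}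
    {x y X Y : ℝ} (hx : x ∈ Set.Icc (0 : ℝ) (k + 1)) (hX : sg b * (x - (i + 1 / 2)) = X)
    (hY : sg c * (y - (j + 1 / 2)) = Y) (hX0 : 0 ≤ X) (hY0 : 0 ≤ Y) (hN : X + Y ≤ 1)
    (hlat : if lat then Y ≤ X else X ≤ Y) :
    ∃ q ∈ kite (kappa k θ i b lat),
      chart m θ i j b c lat q = sphPoint (interp k θ x) (Real.pi / m * y) ∧
      (X + Y = 1 → q.1 + kappa k θ i b lat * q.2 = 1 + kappa k θ i b lat) := by
  have hsb : sg b * sg b = 1 := by cases b <;> simp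
  have hsc : sg c * sg c = 1 := by cases c <;> simp
  have hxX : x = i + 1 / 2 + sg b * X := by rw [← hX]; linear_combination -(x - (i + 1 / 2)) * hsb
  have hyY : y = j + 1 / 2 + sg c * Y := by rw [← hY]; linear_combination -(y - (j + 1 / 2)) * hsc
  have hw := H.halfWidth_pos hi
  have hy2 : (j + 1 / 2 + sg c * (2 * Y) / 2 : ℝ) = y := by rw [hyY]; ring
  have hin : X ≤ 1 / 2 → midpt θ i + sg b * halfWidth θ i * (2 * X) = interp k θ x := by
    intro hX1
    rw [interp_eq θ hi, hxX]
    · simp only [midpt, halfWidth]; ring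
    · rw [hxX]; cases b <;> simp <;> linarith
    · rw [hxX]; cases b <;> simp <;> linarith
  cases lat
  · simp only [Bool.false_eq_true, if_false] at hlat
    have hκ : kappa k θ i b false = 1 := by simp [kappa]
    refine ⟨(2 * Y, 2 * X), ⟨?_, ?_, ?_⟩, ?_, ?_⟩
    · simp only; linarith
    · simp only; linarith
    · rw [hκ]; simp only; linarith
    · simp only [chart, Bool.false_eq_true, if_false]
      rw [hin (by linarith), hy2]
    · intro h; rw [hκ]; simp only; linarith
  · simp only [if_true] at hlat
    have hκ0 := H.kappa_nonneg hi b true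
    -- The chart is scaled by the half-width of its own row. Beyond the edge, X > 1/2, the
    -- interpolation has the slope of the next row, and the ratio κ of the widths converts one into
    -- the other.
    rcases le_or_gt X (1 / 2) with hX1 | hX1
    · refine ⟨(2 * X, 2 * Y), ⟨?_, ?_, ?_⟩, ?_, ?_⟩
      · simp only; linarith
      · simp only; linarith
      · simp only
        nlinarith
      · simp only [chart, if_true]
        rw [hin hX1, hy2]
      · intro h
        have h1 : X = 1 / 2 := by linarith
        have h2 : Y = 1 / 2 := by linarith
        simp only [h1, h2]; ring
    -- Beyond a pole x would leave [0, k + 1].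
    · have hnp : ¬ IsPolar k i b := by
        intro hp
        cases b
        · simp only [IsPolar, Bool.false_eq_true, if_false] at hp
          subst hp
          simp at hxX
          linarith [hx.1]
        · simp only [IsPolar, if_true] at hp
          subst hp
          simp at hxX
          linarith [hx.2]
      have hκ : kappa k θ i b true = halfWidth θ (nextRow i b) / halfWidth θ i := by
        simp [kappa, hnp]
      have hκw : kappa k θ i b true * halfWidth θ i = halfWidth θ (nextRow i b) := by
        rw [hκ, div_mul_cancel₀ _ hw.ne']
      refine ⟨(1 + kappa k θ i b true * (2 * X - 1), 2 * Y), ⟨?_, ?_, ?_⟩, ?_, ?_⟩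
      · simp only; linarith
      · simp only; nlinarith
      · simp only; nlinarith
      · simp only [chart, if_true]
        rw [hy2]
        congr 1
        have e : midpt θ i + sg b * halfWidth θ i * (1 + kappa k θ i b true * (2 * X - 1)) =
            midpt θ i + sg b * (halfWidth θ i + halfWidth θ (nextRow i b) * (2 * X - 1)) := by
          rw [← hκw]; ring
        rw [e]
        have hnk := nextRow_le hi hnp
        cases b
        · obtain ⟨l, rfl⟩ : ∃ l, i = l + 1 := ⟨i - 1, by simp [IsPolar] at hnp; omega⟩
          simp at hxX
          rw [interp_eq θ (i := l) (by omega) (by rw [hxX]; linarith) (by rw [hxX]; linarith), hxX]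
          simp [midpt, halfWidth, nextRow]
          ring
        · simp at hxX
          rw [interp_eq θ (i := i + 1) hnk (by rw [hxX]; push_cast; linarith)
            (by rw [hxX]; push_cast; linarith), hxX]
          simp [midpt, halfWidth, nextRow]
          ring
      · intro h
        simp only
        have : Y = 1 - X := by linarith
        rw [this]; ring

/-- Neighbouring cells have opposite signs but share the vertex, so a corner that is inactive for
one is active for the other. -/
theorem Active.flip_row {γ : ℕ → ℤ → ℝ} {i : ℕ} {j : ℤ} {c : Bool}
    (h0 : γ (i + 1) (j + c.toNat) ≠ 0) (h : ¬ Active γ i j true c) : Active γ (i + 1) j false c := by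
  simp only [Active, Bool.toNat_true, Bool.toNat_false, add_zero, not_lt] at h ⊢
  rw [cellSign_succ_left, neg_mul, neg_lt_zero]
  refine lt_of_le_of_ne h (Ne.symm (mul_ne_zero ?_ h0))
  rcases cellSign_eq_or i j with h | h <;> rw [h] <;> norm_num

theorem Active.flip_row' {γ : ℕ → ℤ → ℝ} {i : ℕ} {j : ℤ} {c : Bool}
    (h0 : γ (i + 1) (j + c.toNat) ≠ 0) (h : ¬ Active γ (i + 1) j false c) : Active γ i j true c := by
  by_contra hcon
  exact h (Active.flip_row h0 hcon)

theorem Active.flip_column {γ : ℕ → ℤ → ℝ} {i : ℕ} {j : ℤ} {b : Bool}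
    (h0 : γ (i + b.toNat) (j + 1) ≠ 0) (h : ¬ Active γ i j b true) :
    Active γ i (j + 1) b false := by
  simp only [Active, Bool.toNat_true, Bool.toNat_false, Nat.cast_zero, Nat.cast_one, add_zero,
    not_lt] at h ⊢
  rw [cellSign_add_one, neg_mul, neg_lt_zero]
  refine lt_of_le_of_ne h (Ne.symm (mul_ne_zero ?_ h0))
  rcases cellSign_eq_or i j with h | h <;> rw [h] <;> norm_num

variable {γ : ℕ → ℤ → ℝ} {h : S2 → ℝ}

/-- Every zero lies in an active kite. -/
theorem Grid.exists_active (H : Grid k A θ) (hm : 1 ≤ m) (hR : Resolved m k θ γ h)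
    (hγ : ∀ i ≤ k + 1, ∀ j, γ i j ≠ 0) {p : S2} (hp : h p = 0) :
    ∃ i ≤ k, ∃ j b c lat, Active γ i j b c ∧
      ∃ q ∈ kite (kappa k θ i b lat), chart m θ i j b c lat q = p := by
  obtain ⟨x, hx, y, rfl⟩ := H.exists_interp hm p
  obtain ⟨i, hi, hix, hix'⟩ : ∃ i : ℕ, i ≤ k ∧ (i : ℝ) ≤ x ∧ x ≤ i + 1 := by
    rcases le_or_gt x k with h1 | h1
    · exact ⟨⌊x⌋₊, by exact_mod_cast (Nat.floor_le hx.1).trans h1, Nat.floor_le hx.1,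
        (Nat.lt_floor_add_one x).le⟩
    · exact ⟨k, le_rfl, h1.le, hx.2⟩
  set j := ⌊y⌋ with hj
  have hjy : (j : ℝ) ≤ y := Int.floor_le y
  have hjy' : y < j + 1 := Int.lt_floor_add_one y
  obtain ⟨b, X, hX, hX0, hX1⟩ : ∃ (b : Bool) (X : ℝ), sg b * (x - (i + 1 / 2)) = X ∧ 0 ≤ X ∧
      X ≤ 1 / 2 := by
    rcases le_total (i + 1 / 2 : ℝ) x with h1 | h1
    · exact ⟨true, _, rfl, by simp; linarith, by simp; linarith⟩
    · exact ⟨false, _, rfl, by simp; linarith, by simp; linarith⟩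
  obtain ⟨c, Y, hY, hY0, hY1⟩ : ∃ (c : Bool) (Y : ℝ), sg c * (y - (j + 1 / 2)) = Y ∧ 0 ≤ Y ∧
      Y ≤ 1 / 2 := by
    rcases le_total (j + 1 / 2 : ℝ) y with h1 | h1
    · exact ⟨true, _, rfl, by simp; linarith, by simp; linarith⟩
    · exact ⟨false, _, rfl, by simp; linarith, by simp; linarith⟩
  -- Here `b` and `c` select the nearest corner of the cell. If it is inactive, it is active for the
  -- cell across the nearest edge, whose diamond also contains the point; the coordinate normal to
  -- that edge, X or Y, turns into 1 - X or 1 - Y. Across a pole there is no such cell, and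
  -- `Resolved.polar` excludes the zero.
  by_cases hact : Active γ i j b c
  · rcases le_total Y X with hXY | hXY
    · obtain ⟨q, hq, hq1, -⟩ := H.exists_kite_point (m := m) (lat := true) hi j hx hX hY hX0 hY0
        (by linarith) (by simpa using hXY)
      exact ⟨i, hi, j, b, c, true, hact, q, hq, hq1⟩
    · obtain ⟨q, hq, hq1, -⟩ := H.exists_kite_point (m := m) (lat := false) hi j hx hX hY hX0 hY0
        (by linarith) (by simpa using hXY)
      exact ⟨i, hi, j, b, c, false, hact, q, hq, hq1⟩
  rcases le_total Y X with hXY | hXY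
  · by_cases hpol : IsPolar k i b
    · obtain ⟨q, hq, hq1, -⟩ := H.exists_kite_point (m := m) (lat := true) hi j hx hX hY hX0 hY0
        (by linarith) (by simpa using hXY)
      have hκ : kappa k θ i b true = 0 := by simp [kappa, hpol]
      rw [hκ] at hq
      have := hR.polar i hi j b c hpol hact q hq
      rw [hq1] at this
      exact absurd hp this
    · cases b
      · obtain ⟨l, rfl⟩ : ∃ l, i = l + 1 := ⟨i - 1, by simp [IsPolar] at hpol; omega⟩
        have hact' := Active.flip_row' (hγ _ (by omega) _) hact
        obtain ⟨q, hq, hq1, -⟩ := H.exists_kite_point (m := m) (b := true) (lat := true)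
          (X := 1 - X) (i := l) (by omega) j hx (by rw [← hX]; simp; ring) hY (by linarith) hY0
          (by linarith) (by simp; linarith)
        exact ⟨l, by omega, j, true, c, true, hact', q, hq, hq1⟩
      · have hik : i + 1 ≤ k := nextRow_le hi hpol
        have hact' := Active.flip_row (hγ _ (by omega) _) hact
        obtain ⟨q, hq, hq1, -⟩ := H.exists_kite_point (m := m) (b := false) (lat := true)
          (X := 1 - X) (i := i + 1) hik j hx (by rw [← hX]; simp; ring) hY (by linarith) hY0
          (by linarith) (by simp; linarith)
        exact ⟨i + 1, hik, j, false, c, true, hact', q, hq, hq1⟩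
  · cases c
    · obtain ⟨l, hl⟩ : ∃ l : ℤ, j = l + 1 := ⟨j - 1, by ring⟩
      rw [hl] at hact hY
      have hact' : Active γ i l b true := by
        by_contra hcon
        exact hact (Active.flip_column (hγ _ (by cases b <;> simp <;> omega) _) hcon)
      obtain ⟨q, hq, hq1, -⟩ := H.exists_kite_point (m := m) (c := true) (lat := false) (y := y)
        (Y := 1 - Y) hi l hx hX (by rw [← hY]; push_cast; simp; ring) hX0 (by linarith)
        (by linarith) (by simp; linarith)
      exact ⟨i, hi, l, b, true, false, hact', q, hq, hq1⟩
    · have hact' := Active.flip_column (hγ _ (by cases b <;> simp <;> omega) _) hact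
      obtain ⟨q, hq, hq1, -⟩ := H.exists_kite_point (m := m) (c := false) (lat := false) (y := y)
        (Y := 1 - Y) hi (j + 1) hx hX (by rw [← hY]; push_cast; simp; ring) hX0 (by linarith)
        (by linarith) (by simp; linarith)
      exact ⟨i, hi, j + 1, b, false, false, hact', q, hq, hq1⟩

end

/-! ### Counting the components -/

/-- A preconnected piece meets at most one component, so choosing a piece that meets a given
component is injective. -/
theorem card_connectedComponents_le {X ι : Type*} [TopologicalSpace X] [Finite ι] {Z : Set X}
    (C : ι → Set X) (hpre : ∀ i, IsPreconnected (C i)) (hsub : ∀ i, C i ⊆ Z)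
    (hcov : Z ⊆ ⋃ i, C i) :
    Finite (ConnectedComponents Z) ∧ Nat.card (ConnectedComponents Z) ≤ Nat.card ι := by
  have hpre' : ∀ i, IsPreconnected (Subtype.val ⁻¹' C i : Set Z) := by
    intro i
    rw [← IsInducing.subtypeVal.isPreconnected_image, Subtype.image_preimage_coe,
      Set.inter_eq_right.2 (hsub i)]
    exact hpre i
  have hex : ∀ z : Z, ∃ i, (z : X) ∈ C i := fun z => by simpa using hcov z.2
  have hex' : ∀ d : ConnectedComponents Z, ∃ i, ∃ z : Z, ConnectedComponents.mk z = d ∧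
      (z : X) ∈ C i := by
    intro d
    obtain ⟨z, rfl⟩ := ConnectedComponents.surjective_coe d
    obtain ⟨i, hi⟩ := hex z
    exact ⟨i, z, rfl, hi⟩
  choose F z hz hF using hex'
  have hinj : Function.Injective F := by
    intro d d' hdd
    rw [← hz d, ← hz d', ConnectedComponents.coe_eq_coe]
    apply connectedComponent_eq
    have h1 : z d' ∈ (Subtype.val ⁻¹' C (F d) : Set Z) := by
      rw [Set.mem_preimage, hdd]; exact hF d'
    exact (hpre' (F d)).subset_connectedComponent (hF d) h1
  exact ⟨Finite.of_injective F hinj, Nat.card_le_card_of_injective F hinj⟩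

/-- A clopen set contains the component of each of its points, so clopen sets that are disjoint on
`Z` hold different components. -/
theorem le_card_connectedComponents {X ι : Type*} [TopologicalSpace X] {Z : Set X}
    [Finite (ConnectedComponents Z)] (E : ι → Set X)
    (hcl : ∀ i, IsClopen (Subtype.val ⁻¹' E i : Set Z)) (hne : ∀ i, (E i ∩ Z).Nonempty)
    (hdis : ∀ i i', (E i ∩ E i' ∩ Z).Nonempty → i = i') :
    Nat.card ι ≤ Nat.card (ConnectedComponents Z) := by
  choose x hx using hne
  let F : ι → ConnectedComponents Z := fun i => ConnectedComponents.mk ⟨x i, (hx i).2⟩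
  refine Nat.card_le_card_of_injective F ?_
  intro i i' hii
  have h1 : connectedComponent (⟨x i, (hx i).2⟩ : Z) = connectedComponent ⟨x i', (hx i').2⟩ :=
    ConnectedComponents.coe_eq_coe.1 hii
  have h2 := (hcl i).connectedComponent_subset (x := ⟨x i, (hx i).2⟩) (hx i).1
  rw [h1] at h2
  exact hdis i i' ⟨x i', ⟨h2 mem_connectedComponent, (hx i').1⟩, (hx i').2⟩

/-- The part of the nodal set in a kite. -/
def arcPiece (m k : ℕ) (θ : ℕ → ℝ) (h : S2 → ℝ) (i : ℕ) (j : ℤ) (b c lat : Bool) : Set S2 :=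
  chart m θ i j b c lat '' {q | q ∈ kite (kappa k θ i b lat) ∧ h (chart m θ i j b c lat q) = 0}

/-- The part of the nodal set in the kites of a cell. -/
def cellPiece (m k : ℕ) (θ : ℕ → ℝ) (h : S2 → ℝ) (i : ℕ) (j : ℤ) : Set S2 :=
  ⋃ b, ⋃ c, ⋃ lat, arcPiece m k θ h i j b c lat

section

variable {k m : ℕ} {A : ℝ → ℝ} {θ : ℕ → ℝ} {γ : ℕ → ℤ → ℝ} {h : S2 → ℝ}

theorem arcPiece_subset (i : ℕ) (j : ℤ) (b c lat : Bool) :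
    arcPiece m k θ h i j b c lat ⊆ nodalSet h := by
  rintro _ ⟨q, ⟨-, hq⟩, rfl⟩
  exact hq

theorem Resolved.isPreconnected_arcPiece (hR : Resolved m k θ γ h) {i : ℕ} (hi : i ≤ k) {j : ℤ}
    {b c : Bool} (hact : Active γ i j b c) (lat : Bool) :
    IsPreconnected (arcPiece m k θ h i j b c lat) :=
  (hR.kite_zeros i hi j b c lat hact).conn.image _ (continuous_chart m θ i j b c lat).continuousOn

theorem iUnion_bool {X : Type*} (F : Bool → Set X) : ⋃ b, F b = F true ∪ F false := by
  ext x; simp [or_comm]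

/-- The eight arcs form a chain: the two kites at a corner share the zero on their common diagonal,
and kites that are mirror images across an axis of the cell share the zero on that axis. -/
theorem Resolved.isPreconnected_cellPiece (H : Grid k A θ) (hR : Resolved m k θ γ h) {i : ℕ}
    (hi : i ≤ k) {j : ℤ} (hact : ∀ b c, Active γ i j b c) :
    IsPreconnected (cellPiece m k θ h i j) := by
  have hP := fun b c lat => hR.isPreconnected_arcPiece hi (hact b c) lat
  have hcorner : ∀ b c, ∃ p, ∀ lat, p ∈ arcPiece m k θ h i j b c lat := by
    intro b c
    obtain ⟨t, ht, h0⟩ := (hR.kite_zeros i hi j b c true (hact b c)).diag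
    have hmem : ∀ lat, ((t, t) : ℝ × ℝ) ∈ kite (kappa k θ i b lat) := by
      intro lat
      have := H.kappa_nonneg hi b lat
      refine ⟨ht.1, le_rfl, ?_⟩
      simp only
      nlinarith [ht.2]
    have hch : ∀ lat, chart m θ i j b c lat (t, t) = chart m θ i j b c true (t, t) := by
      intro lat; simp [chart]
    refine ⟨chart m θ i j b c true (t, t), fun lat => ⟨(t, t), ⟨hmem lat, ?_⟩, hch lat⟩⟩
    rw [hch lat]; exact h0
  have hrow : ∀ b, ∃ p, ∀ c, p ∈ arcPiece m k θ h i j b c true := by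
    intro b
    obtain ⟨t, ht, h0⟩ := (hR.kite_zeros i hi j b true true (hact b true)).axis
    have hch : ∀ c, chart m θ i j b c true (t, 0) = chart m θ i j b true true (t, 0) := by
      intro c; simp [chart]
    refine ⟨chart m θ i j b true true (t, 0), fun c => ⟨(t, 0), ⟨ht, ?_⟩, hch c⟩⟩
    rw [hch c]; exact h0
  have hcol : ∃ p, ∀ b, p ∈ arcPiece m k θ h i j b true false := by
    obtain ⟨t, ht, h0⟩ := (hR.kite_zeros i hi j true true false (hact true true)).axis
    have hch : ∀ b, chart m θ i j b true false (t, 0) = chart m θ i j true true false (t, 0) := by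
      intro b; simp [chart]
    refine ⟨chart m θ i j true true false (t, 0), fun b => ⟨(t, 0), ⟨?_, ?_⟩, hch b⟩⟩
    · simpa [kappa] using ht
    · rw [hch b]; exact h0
  have h1 : ∀ b c, IsPreconnected (⋃ lat, arcPiece m k θ h i j b c lat) := by
    intro b c
    obtain ⟨p, hp⟩ := hcorner b c
    rw [iUnion_bool]
    exact (hP b c true).union p (hp true) (hp false) (hP b c false)
  have h2 : ∀ b, IsPreconnected (⋃ c, ⋃ lat, arcPiece m k θ h i j b c lat) := by
    intro b
    obtain ⟨p, hp⟩ := hrow b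
    rw [iUnion_bool]
    exact (h1 b true).union p (Set.mem_iUnion.2 ⟨true, hp true⟩) (Set.mem_iUnion.2 ⟨true, hp false⟩)
      (h1 b false)
  obtain ⟨p, hp⟩ := hcol
  have hp' : ∀ b, p ∈ ⋃ c, ⋃ lat, arcPiece m k θ h i j b c lat := fun b =>
    Set.mem_iUnion.2 ⟨true, Set.mem_iUnion.2 ⟨false, hp b⟩⟩
  rw [cellPiece, iUnion_bool]
  exact (h2 true).union p (hp' true) (hp' false) (h2 false)

theorem arcPiece_add_period (hm : 1 ≤ m) (i : ℕ) (j l : ℤ) (b c lat : Bool) :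
    arcPiece m k θ h i (j + 2 * (m * l)) b c lat = arcPiece m k θ h i j b c lat := by
  unfold arcPiece
  rw [chart_add_period hm]

/-- The distance from the middle of the cell `(i, j)` in the `ℓ¹` norm of the coordinates in which
cells are unit squares. -/
noncomputable def diamond (i : ℕ) (j : ℤ) (z : ℝ × ℝ) : ℝ :=
  |z.1 - (i + 1 / 2)| + |z.2 - (j + 1 / 2)|

theorem continuous_diamond (i : ℕ) (j : ℤ) : Continuous (diamond i j) := by
  unfold diamond; fun_prop

/-- The point of the sphere with given grid coordinates. -/
noncomputable def gridPoint (m k : ℕ) (θ : ℕ → ℝ) (z : ℝ × ℝ) : S2 :=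
  sphPoint (interp k θ z.1) (Real.pi / m * z.2)

theorem continuous_gridPoint (m k : ℕ) (θ : ℕ → ℝ) : Continuous (gridPoint m k θ) := by
  have h1 : Continuous fun z : ℝ × ℝ => (interp k θ z.1, Real.pi / m * z.2) :=
    ((continuous_interp k θ).comp continuous_fst).prodMk (continuous_const.mul continuous_snd)
  have := continuous_sphPoint.comp h1
  simp only [Function.comp_def] at this
  exact this

theorem exists_sg (x : ℝ) : ∃ b, sg b * x = |x| := by
  rcases le_total 0 x with h | h
  · exact ⟨true, by simp [abs_of_nonneg h]⟩
  · exact ⟨false, by simp [abs_of_nonpos h]⟩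

/-- The boundary of the diamond is made of the far sides of the kites, where `KiteZeros.far`
applies. -/
theorem Resolved.ne_zero_of_diamond_eq_one (H : Grid k A θ) (hR : Resolved m k θ γ h) {i : ℕ}
    (hi : i ≤ k) {j : ℤ} (hact : ∀ b c, Active γ i j b c) {z : ℝ × ℝ}
    (hz : z.1 ∈ Set.Icc (0 : ℝ) (k + 1)) (hd : diamond i j z = 1) : h (gridPoint m k θ z) ≠ 0 := by
  obtain ⟨b, hb⟩ := exists_sg (z.1 - (i + 1 / 2))
  obtain ⟨c, hc⟩ := exists_sg (z.2 - (j + 1 / 2))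
  obtain ⟨lat, hlat⟩ : ∃ lat : Bool, if lat then |z.2 - (j + 1 / 2)| ≤ |z.1 - (i + 1 / 2)| else
      |z.1 - (i + 1 / 2)| ≤ |z.2 - (j + 1 / 2)| := by
    rcases le_total (|z.2 - (j + 1 / 2)|) (|z.1 - (i + 1 / 2)|) with h1 | h1
    · exact ⟨true, by simpa using h1⟩
    · exact ⟨false, by simpa using h1⟩
  obtain ⟨q, hq, hq1, hq2⟩ := H.exists_kite_point (m := m) hi j hz hb hc (abs_nonneg _)
    (abs_nonneg _) hd.le hlat
  have := (hR.kite_zeros i hi j b c lat (hact b c)).far q hq (hq2 hd)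
  rw [hq1] at this
  exact this

theorem gridPoint_inj (H : Grid k A θ) (hm : 1 ≤ m) {z z' : ℝ × ℝ} (h1 : 0 < z.1)
    (h2 : z.1 < k + 1) (hz' : z'.1 ∈ Set.Icc (0 : ℝ) (k + 1))
    (he : gridPoint m k θ z = gridPoint m k θ z') :
    z.1 = z'.1 ∧ ∃ l : ℤ, z.2 = z'.2 + 2 * (m * l) := by
  have hm0 : (m : ℝ) ≠ 0 := by exact_mod_cast (by omega : m ≠ 0)
  obtain ⟨e1, l, hl⟩ := sphPoint_inj (H.interp_mem_Ioo h1 h2) (H.interp_mem hz') he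
  refine ⟨H.interp_strictMonoOn.injOn ⟨h1.le, h2.le⟩ hz' e1, l, ?_⟩
  have hπ := Real.pi_pos.ne'
  field_simp at hl
  linarith

theorem mem_of_diamond_le {i : ℕ} (hi1 : 1 ≤ i) (hik : i < k) {j : ℤ} {z : ℝ × ℝ}
    (hz : diamond i j z ≤ 1) : 0 < z.1 ∧ z.1 < k + 1 ∧ |z.2 - (j + 1 / 2)| ≤ 1 := by
  have h1 : (1 : ℝ) ≤ i := by exact_mod_cast hi1
  have h2 : (i : ℝ) + 1 ≤ k := by exact_mod_cast hik
  have h3 := abs_le.1 (show |z.1 - (i + 1 / 2)| ≤ 1 by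
    unfold diamond at hz; linarith [abs_nonneg (z.2 - (j + 1 / 2))])
  refine ⟨by linarith [h3.1], by linarith [h3.2], ?_⟩
  unfold diamond at hz; linarith [abs_nonneg (z.1 - (i + 1 / 2))]

theorem isCompact_diamond {i : ℕ} (j : ℤ) : IsCompact {z | diamond i j z ≤ 1} := by
  refine (isCompact_Icc (a := ((i + 1 / 2 - 1 : ℝ), (j + 1 / 2 - 1 : ℝ)))
    (b := ((i + 1 / 2 + 1 : ℝ), (j + 1 / 2 + 1 : ℝ)))).of_isClosed_subset
    (isClosed_le (continuous_diamond i j) continuous_const) ?_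
  intro z hz
  have hz : diamond i j z ≤ 1 := hz
  unfold diamond at hz
  have h1 := abs_le.1 (show |z.1 - (i + 1 / 2)| ≤ 1 by linarith [abs_nonneg (z.2 - (j + 1 / 2))])
  have h2 := abs_le.1 (show |z.2 - (j + 1 / 2)| ≤ 1 by linarith [abs_nonneg (z.1 - (i + 1 / 2))])
  exact ⟨⟨by simp only; linarith, by simp only; linarith⟩, ⟨by simp only; linarith,
    by simp only; linarith⟩⟩

/-- The part of the nodal set in the diamond of a cell with active corners is separated from the
rest. -/
theorem Resolved.isClopen_diamond (H : Grid k A θ) (hm : 2 ≤ m) (hR : Resolved m k θ γ h) {i : ℕ}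
    (hi1 : 1 ≤ i) (hik : i < k) {j : ℤ} (hact : ∀ b c, Active γ i j b c) :
    IsClopen (Subtype.val ⁻¹' (gridPoint m k θ '' {z | diamond i j z ≤ 1}) :
      Set (nodalSet h)) := by
  have hm1 : 1 ≤ m := by omega
  have hc1 : IsClosed (gridPoint m k θ '' {z | diamond i j z ≤ 1}) :=
    ((isCompact_diamond j).image (continuous_gridPoint m k θ)).isClosed
  -- One full period centred at the cell, with the open diamond removed. Its image contains every
  -- zero outside the diamond's image and meets that image only along the boundary of the diamond,
  -- where there are no zeros. Since m ≥ 2, the diamond, of half-width 1, does not reach the ends of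
  -- the period.
  set K : Set (ℝ × ℝ) := Set.Icc (0, j + 1 / 2 - m) (k + 1, j + 1 / 2 + m) ∩
    {z | 1 ≤ diamond i j z} with hK
  have hKc : IsClosed (gridPoint m k θ '' K) :=
    ((isCompact_Icc.inter_right (isClosed_le continuous_const (continuous_diamond i j))).image
      (continuous_gridPoint m k θ)).isClosed
  refine ⟨hc1.preimage continuous_subtype_val, ?_⟩
  have hcompl : (Subtype.val ⁻¹' (gridPoint m k θ '' {z | diamond i j z ≤ 1}) :
      Set (nodalSet h)) = (Subtype.val ⁻¹' (gridPoint m k θ '' K) : Set (nodalSet h))ᶜ := by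
    ext p
    constructor
    · rintro ⟨z, hz, hzp⟩ ⟨z', hz', hzp'⟩
      have hz : diamond i j z ≤ 1 := hz
      obtain ⟨a1, a2, a3⟩ := mem_of_diamond_le hi1 hik hz
      have hz'1 : z'.1 ∈ Set.Icc (0 : ℝ) (k + 1) := ⟨hz'.1.1.1, hz'.1.2.1⟩
      obtain ⟨e1, l, e2⟩ := gridPoint_inj H hm1 a1 a2 hz'1 (hzp.trans hzp'.symm)
      have b1 : (j : ℝ) + 1 / 2 - m ≤ z'.2 := hz'.1.1.2
      have b2 : z'.2 ≤ (j : ℝ) + 1 / 2 + m := hz'.1.2.2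
      have a4 := abs_le.1 a3
      have hm2 : (2 : ℝ) ≤ m := by exact_mod_cast hm
      have hl : l = 0 := by
        have c1 : (l : ℝ) < 1 := by
          by_contra hcon
          have := mul_le_mul_of_nonneg_left (not_lt.1 hcon) (show (0 : ℝ) ≤ m by linarith)
          linarith [a4.2]
        have c2 : (-1 : ℝ) < l := by
          by_contra hcon
          have := mul_le_mul_of_nonneg_left (not_lt.1 hcon) (show (0 : ℝ) ≤ m by linarith)
          linarith [a4.1]
        have c1' : l < 1 := by exact_mod_cast c1
        have c2' : -1 < l := by exact_mod_cast c2
        omega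
      subst hl
      have hzz : z = z' := Prod.ext e1 (by simpa using e2)
      subst hzz
      have := hR.ne_zero_of_diamond_eq_one H hik.le hact hz'1 (le_antisymm hz hz'.2)
      rw [hzp] at this
      exact this p.2
    · intro hp
      obtain ⟨x, hx, y, hxy⟩ := H.exists_interp hm1 (p : S2)
      have hm0 : (0 : ℝ) < m := by exact_mod_cast hm1
      set l : ℤ := ⌊(y - (j + 1 / 2 - m)) / (2 * m)⌋ with hl
      have f1 : (l : ℝ) * (2 * m) ≤ y - (j + 1 / 2 - m) := by
        rw [← le_div_iff₀ (by positivity)]; exact Int.floor_le _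
      have f2 : y - (j + 1 / 2 - m) < (l + 1) * (2 * m) := by
        rw [← div_lt_iff₀ (by positivity)]; exact Int.lt_floor_add_one _
      have hgp : gridPoint m k θ (x, y - 2 * (m * l)) = p := by
        rw [← hxy]
        have e : Real.pi / m * (y - 2 * (m * l)) = Real.pi / m * y - l * (2 * Real.pi) := by
          field_simp
        apply Subtype.ext
        simp only [gridPoint, sphPoint]
        rw [e, Real.cos_sub_int_mul_two_pi, Real.sin_sub_int_mul_two_pi]
      by_contra hcon
      apply hp
      refine ⟨(x, y - 2 * (m * l)), ⟨⟨⟨hx.1, ?_⟩, ⟨hx.2, ?_⟩⟩, ?_⟩, hgp⟩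
      · simp only; linarith
      · simp only; linarith
      · rcases le_total 1 (diamond i j (x, y - 2 * (m * l))) with hd | hd
        · exact hd
        · exact absurd ⟨(x, y - 2 * (m * l)), hd, hgp⟩ hcon
  rw [hcompl]
  exact (hKc.preimage continuous_subtype_val).isOpen_compl

theorem Resolved.diamond_nonempty (hR : Resolved m k θ γ h) {i : ℕ}
    (hi : i ≤ k) {j : ℤ} (hact : ∀ b c, Active γ i j b c) :
    (gridPoint m k θ '' {z | diamond i j z ≤ 1} ∩ nodalSet h).Nonempty := by
  obtain ⟨t, ht, h0⟩ := (hR.kite_zeros i hi j true true true (hact true true)).diag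
  refine ⟨chart m θ i j true true true (t, t), ⟨(i + 1 / 2 + t / 2, j + 1 / 2 + t / 2), ?_, ?_⟩, h0⟩
  · show diamond i j _ ≤ 1
    simp only [diamond, add_sub_cancel_left]
    rw [abs_of_nonneg (by linarith [ht.1])]
    linarith [ht.2]
  · simp only [gridPoint, chart, sg_true, if_true]
    rw [interp_eq θ hi (by linarith [ht.1]) (by linarith [ht.2])]
    congr 1
    · simp only [midpt, halfWidth]; ring
    · ring

end

section

variable {k m : ℕ} {A : ℝ → ℝ} {θ : ℕ → ℝ} {γ : ℕ → ℤ → ℝ} {h : S2 → ℝ}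

/-- When all corners of a row carry the sign of η, activity depends only on the cell: all four
corners are active or none is, and the two cases alternate along the row. -/
theorem active_iff {i : ℕ} {η : ℝ} (hη : ∀ j, 0 < η * γ i j ∧ 0 < η * γ (i + 1) j) (j : ℤ)
    (b c : Bool) : Active γ i j b c ↔ cellSign i j * η < 0 := by
  have hpos : 0 < η * γ (i + b.toNat) (j + c.toNat) := by
    cases b
    · exact (hη _).1
    · exact (hη _).2
  unfold Active
  rcases cellSign_eq_or i j with h | h <;> rw [h] <;>
    rcases mul_pos_iff.1 hpos with ⟨h1, h2⟩ | ⟨h1, h2⟩ <;> constructor <;> intro h3 <;> linarith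

theorem exists_column {i : ℕ} {η : ℝ} (hη : ∀ j, 0 < η * γ i j ∧ 0 < η * γ (i + 1) j) :
    ∃ e : ℤ, (e = 0 ∨ e = 1) ∧ cellSign i e * η < 0 := by
  have h0 : η ≠ 0 := left_ne_zero_of_mul (hη 0).1.ne'
  have h1 : cellSign i 0 ≠ 0 := by
    rcases cellSign_eq_or i 0 with h | h <;> rw [h] <;> norm_num
  rcases lt_or_gt_of_ne (mul_ne_zero h1 h0) with h | h
  · exact ⟨0, Or.inl rfl, h⟩
  · refine ⟨1, Or.inr rfl, ?_⟩
    have := cellSign_add_one i 0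
    rw [zero_add] at this
    rw [this]; linarith

theorem exists_eq_add_two_mul {i : ℕ} {η : ℝ} {e j : ℤ} (he : cellSign i e * η < 0)
    (hj : cellSign i j * η < 0) : ∃ s, j = e + 2 * s := by
  rcases Int.even_or_odd (j - e) with ⟨s, hs⟩ | ⟨s, hs⟩
  · exact ⟨s, by linarith⟩
  · exfalso
    have : j = (e + 1) + 2 * s := by linarith
    rw [this, cellSign_add_two_mul, cellSign_add_one] at hj
    linarith

/-- The triangle inequality for the ℓ¹ norm. As the centres differ by integers, overlapping open
diamonds belong to equal or edge-adjacent cells. -/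
theorem diamonds_overlap {i i' : ℕ} {j j' l : ℤ} {x y y' : ℝ} (h1 : diamond i j (x, y) < 1)
    (h2 : diamond i' j' (x, y') < 1) (hy : y = y' + 2 * (m * l)) :
    |(i : ℤ) - i'| + |j - (j' + 2 * (m * l))| < 2 := by
  have h : |(i : ℝ) - i'| + |(j : ℝ) - (j' + 2 * (m * l))| < 2 := by
    unfold diamond at h1 h2
    simp only at h1 h2
    have a1 : |(i : ℝ) - i'| ≤ |x - (i + 1 / 2)| + |x - (i' + 1 / 2)| := by
      have := abs_sub (x - (i' + 1 / 2)) (x - (i + 1 / 2))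
      rw [show x - (i' + 1 / 2) - (x - (i + 1 / 2)) = (i : ℝ) - i' by ring] at this
      linarith
    have a2 : |(j : ℝ) - (j' + 2 * (m * l))| ≤ |y - (j + 1 / 2)| + |y' - (j' + 1 / 2)| := by
      have := abs_sub (y' - (j' + 1 / 2)) (y - (j + 1 / 2))
      rw [show y' - (j' + 1 / 2) - (y - (j + 1 / 2)) = (j : ℝ) - (j' + 2 * (m * l)) by
        rw [hy]; ring] at this
      linarith
    linarith
  exact_mod_cast h

/-- The number of components of a resolved nodal set: each row all of whose corners have the same
sign contributes `m` ovals, the other rows are bounded by the number of their arcs. -/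
theorem Grid.ov_bounds (H : Grid k A θ) (hm : 2 ≤ m) (hR : Resolved m k θ γ h)
    (hγ : ∀ i ≤ k + 1, ∀ j, γ i j ≠ 0) (hper : ∀ i j l, γ i (j + 2 * (m * l)) = γ i j)
    (I : Finset ℕ) (hI : ∀ i ∈ I, 1 ≤ i ∧ i < k) (η : ℕ → ℝ)
    (hη : ∀ i ∈ I, ∀ j, 0 < η i * γ i j ∧ 0 < η i * γ (i + 1) j) :
    Finite (ConnectedComponents (nodalSet h)) ∧ m * I.card ≤ ov h ∧
      ov h ≤ m * I.card + 16 * m * (k + 1 - I.card) := by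
  have hm1 : 1 ≤ m := by omega
  have hcol : ∀ i : I, ∃ e : ℤ, (e = 0 ∨ e = 1) ∧ cellSign i e * η i < 0 := fun i =>
    exists_column (hη i i.2)
  choose e he01 he using hcol
  have hsign : ∀ (i : I) (t : ℤ), cellSign i (e i + 2 * t) * η i < 0 := by
    intro i t
    rw [cellSign_add_two_mul]; exact he i
  have hact : ∀ (i : I) (t : ℤ) (b c : Bool), Active γ i (e i + 2 * t) b c := fun i t b c =>
    (active_iff (hη i i.2) _ b c).2 (hsign i t)
  have hIk : ∀ i : I, (i : ℕ) ≤ k := fun i => (hI i i.2).2.le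
  -- A row in `I` contributes its m cells of the right column parity. Any other row is charged with
  -- all arcs of its 2m cells, eight kites each, whence 16 m; arcs of inactive kites are replaced by
  -- the empty set.
  have hupper := card_connectedComponents_le (Z := nodalSet h)
    (ι := (I × Fin m) ⊕ (↥(Finset.range (k + 1) \ I) × Fin (2 * m) × Bool × Bool × Bool))
    (fun a => Sum.elim (fun z => cellPiece m k θ h z.1 (e z.1 + 2 * ((z.2 : ℕ) : ℤ)))
      (fun z => {p | p ∈ arcPiece m k θ h z.1 ((z.2.1 : ℕ) : ℤ) z.2.2.1 z.2.2.2.1 z.2.2.2.2 ∧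
        Active γ z.1 ((z.2.1 : ℕ) : ℤ) z.2.2.1 z.2.2.2.1}) a) ?_ ?_ ?_
  · have hcard : Nat.card ((I × Fin m) ⊕
        (↥(Finset.range (k + 1) \ I) × Fin (2 * m) × Bool × Bool × Bool)) =
        m * I.card + 16 * m * (k + 1 - I.card) := by
      have hsub : I ⊆ Finset.range (k + 1) := fun i hi =>
        Finset.mem_range.2 (by have := (hI i hi).2; omega)
      rw [Nat.card_eq_fintype_card]
      simp only [Fintype.card_sum, Fintype.card_prod, Fintype.card_coe, Fintype.card_fin,
        Fintype.card_bool, Finset.card_sdiff_of_subset hsub, Finset.card_range]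
      ring
    have : Finite (ConnectedComponents (nodalSet h)) := hupper.1
    refine ⟨hupper.1, ?_, hcard ▸ hupper.2⟩
    have hlower := le_card_connectedComponents (Z := nodalSet h) (ι := I × Fin m)
      (fun z => gridPoint m k θ '' {w | diamond z.1 (e z.1 + 2 * ((z.2 : ℕ) : ℤ)) w ≤ 1})
      (fun z => hR.isClopen_diamond H hm (hI z.1 z.1.2).1 (hI z.1 z.1.2).2 (hact z.1 _))
      (fun z => hR.diamond_nonempty (hIk z.1) (hact z.1 _)) ?_
    · have hc : Nat.card (I × Fin m) = m * I.card := by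
        rw [Nat.card_eq_fintype_card]
        simp only [Fintype.card_prod, Fintype.card_coe, Fintype.card_fin]
        ring
      rw [hc] at hlower
      exact hlower
    · rintro ⟨i, t⟩ ⟨i', t'⟩ ⟨p, ⟨⟨w, hw, hwp⟩, ⟨w', hw', hwp'⟩⟩, hp⟩
      have hp0 : h p = 0 := hp
      have hw : diamond i (e i + 2 * ((t : ℕ) : ℤ)) w ≤ 1 := hw
      have hw' : diamond i' (e i' + 2 * ((t' : ℕ) : ℤ)) w' ≤ 1 := hw'
      obtain ⟨a1, a2, -⟩ := mem_of_diamond_le (hI i i.2).1 (hI i i.2).2 hw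
      obtain ⟨a1', a2', -⟩ := mem_of_diamond_le (hI i' i'.2).1 (hI i' i'.2).2 hw'
      obtain ⟨e1, l, e2⟩ := gridPoint_inj H hm1 a1 a2 ⟨a1'.le, a2'.le⟩ (hwp.trans hwp'.symm)
      have s1 := lt_of_le_of_ne hw fun hd => hR.ne_zero_of_diamond_eq_one H (hIk i) (hact i _)
        ⟨a1.le, a2.le⟩ hd (by rw [hwp]; exact hp0)
      have s2 := lt_of_le_of_ne hw' fun hd => hR.ne_zero_of_diamond_eq_one H (hIk i') (hact i' _)
        ⟨a1'.le, a2'.le⟩ hd (by rw [hwp']; exact hp0)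
      have s2' : diamond i' (e i' + 2 * ((t' : ℕ) : ℤ)) (w.1, w'.2) < 1 := by rw [e1]; exact s2
      have hov := diamonds_overlap (m := m) (x := w.1) (y := w.2) (y' := w'.2) s1 s2' e2
      set J := e i + 2 * ((t : ℕ) : ℤ) with hJ
      set J' := e i' + 2 * ((t' : ℕ) : ℤ) + 2 * (m * l) with hJ'
      have hJs : cellSign i J * η i < 0 := hsign i t
      have hJs' : cellSign i' J' * η i' < 0 := by
        rw [hJ', cellSign_add_two_mul]; exact hsign i' t'
      -- Horizontal neighbours have opposite cell signs for the same η and cannot both be active.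
      -- For vertical neighbours the values on the common circle of latitude force the two η to have
      -- the same sign, with the same contradiction.
      have hcase : ((i : ℕ) = i' ∧ J = J') ∨ ((i : ℕ) = i' ∧ J = J' + 1) ∨
          ((i : ℕ) = i' ∧ J' = J + 1) ∨ ((i : ℕ) = i' + 1 ∧ J = J') ∨
          ((i' : ℕ) = i + 1 ∧ J = J') := by
        rcases abs_cases ((i : ℤ) - i') with ⟨c1, c2⟩ | ⟨c1, c2⟩ <;>
        rcases abs_cases (J - J') with ⟨d1, d2⟩ | ⟨d1, d2⟩ <;> omega
      rcases hcase with ⟨q1, q2⟩ | ⟨q1, q2⟩ | ⟨q1, q2⟩ | ⟨q1, q2⟩ | ⟨q1, q2⟩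
      · have hii : i = i' := Subtype.ext q1
        subst hii
        have hts : ((t : ℕ) : ℤ) - (t' : ℕ) = m * l := by linarith
        have ht := t.2
        have ht' := t'.2
        have hl0 : l = 0 := by
          have hmz : (0 : ℤ) < m := by omega
          have c1 : l < 1 := by
            by_contra hcon
            have := mul_le_mul_of_nonneg_left (not_lt.1 hcon) hmz.le
            omega
          have c2 : -1 < l := by
            by_contra hcon
            have := mul_le_mul_of_nonneg_left (not_lt.1 hcon) hmz.le
            omega
          omega
        rw [hl0, mul_zero] at hts
        have : t = t' := Fin.ext (by omega)
        rw [this]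
      · have hii : i = i' := Subtype.ext q1
        subst hii
        rw [q2, cellSign_add_one] at hJs
        linarith
      · have hii : i = i' := Subtype.ext q1
        subst hii
        rw [q2, cellSign_add_one] at hJs'
        linarith
      · exfalso
        have g1 := (hη i i.2 0).1
        have g2 := (hη i' i'.2 0).2
        rw [q1] at g1
        rw [q1, cellSign_succ_left, q2] at hJs
        rcases cellSign_eq_or i' J' with hc | hc <;> rw [hc] at hJs hJs' <;>
        rcases mul_pos_iff.1 g1 with ⟨x1, x2⟩ | ⟨x1, x2⟩ <;>
        rcases mul_pos_iff.1 g2 with ⟨x3, x4⟩ | ⟨x3, x4⟩ <;> linarith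
      · exfalso
        have g1 := (hη i' i'.2 0).1
        have g2 := (hη i i.2 0).2
        rw [q1] at g1
        rw [q1, cellSign_succ_left, ← q2] at hJs'
        rcases cellSign_eq_or i J with hc | hc <;> rw [hc] at hJs hJs' <;>
        rcases mul_pos_iff.1 g1 with ⟨x1, x2⟩ | ⟨x1, x2⟩ <;>
        rcases mul_pos_iff.1 g2 with ⟨x3, x4⟩ | ⟨x3, x4⟩ <;> linarith
  · rintro (⟨i, t⟩ | ⟨i, t, b, c, lat⟩)
    · exact hR.isPreconnected_cellPiece H (hIk i) (hact i _)
    · simp only [Sum.elim_inr]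
      have hi : (i : ℕ) ≤ k := by
        have := (Finset.mem_sdiff.1 i.2).1
        exact Nat.lt_succ_iff.1 (Finset.mem_range.1 this)
      by_cases ha : Active γ i ((t : ℕ) : ℤ) b c
      · simpa [ha] using hR.isPreconnected_arcPiece hi ha lat
      · simpa [ha] using isPreconnected_empty
  · rintro (⟨i, t⟩ | ⟨i, t, b, c, lat⟩)
    · simp only [Sum.elim_inl, cellPiece, Set.iUnion_subset_iff]
      exact fun b c lat => arcPiece_subset _ _ b c lat
    · rintro p ⟨hp, -⟩
      exact arcPiece_subset _ _ _ _ _ hp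
  · intro p hp
    obtain ⟨i, hi, j, b, c, lat, hac, q, hq, hqp⟩ := H.exists_active hm1 hR hγ hp
    have hmem : p ∈ arcPiece m k θ h i j b c lat :=
      ⟨q, ⟨hq, by rw [hqp]; exact hp⟩, hqp⟩
    have hmz : (0 : ℤ) < m := by omega
    by_cases hiI : i ∈ I
    · obtain ⟨s, hs⟩ := exists_eq_add_two_mul (he ⟨i, hiI⟩) ((active_iff (hη i hiI) j b c).1 hac)
      have hsm := Int.emod_add_mul_ediv s m
      have h1 := Int.emod_nonneg s hmz.ne'
      have h2 := Int.emod_lt_of_pos s hmz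
      refine Set.mem_iUnion.2 ⟨Sum.inl ⟨⟨i, hiI⟩, ⟨(s % m).toNat, by omega⟩⟩, ?_⟩
      simp only [Sum.elim_inl, cellPiece, Set.mem_iUnion]
      refine ⟨b, c, lat, ?_⟩
      rw [Int.toNat_of_nonneg h1]
      have hj : j = e ⟨i, hiI⟩ + 2 * (s % m) + 2 * (m * (s / m)) := by rw [hs]; linarith
      rw [hj, arcPiece_add_period hm1] at hmem
      exact hmem
    · have h2m : (0 : ℤ) < 2 * m := by omega
      have hsm := Int.emod_add_mul_ediv j (2 * m)
      have h1 := Int.emod_nonneg j h2m.ne'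
      have h2 := Int.emod_lt_of_pos j h2m
      have hj : j = j % (2 * m) + 2 * (m * (j / (2 * m))) := by linarith
      refine Set.mem_iUnion.2 ⟨Sum.inr ⟨⟨i, Finset.mem_sdiff.2
        ⟨Finset.mem_range.2 (by omega), hiI⟩⟩, ⟨(j % (2 * m)).toNat, by omega⟩, b, c, lat⟩, ?_⟩
      simp only [Sum.elim_inr, Set.mem_ofPred_eq]
      rw [Int.toNat_of_nonneg h1]
      rw [hj, arcPiece_add_period hm1] at hmem
      refine ⟨hmem, ?_⟩
      rw [hj] at hac
      exact (active_add_period hper i _ _ b c).1 hac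

end

/-! ### The spherical harmonic as a grid function -/

/-- The derivative is s^(m-1) (m s' Q + s Q'). After cancelling the common power, the bracket has
the negative limit m s'(1) Q(1), while K s Q tends to 0. This handles the zero of order m at a pole.
-/
theorem steepZero_of_pow {s Q : ℝ → ℝ} {m : ℕ} (hm : 1 ≤ m) (hs : ContDiff ℝ 1 s)
    (hQ : ContDiff ℝ 1 Q) (h1 : s 1 = 0) (hd : deriv s 1 < 0) (hQ1 : 0 < Q 1)
    (hspos : ∀ t, 0 ≤ t → t < 1 → 0 < s t) (hQpos : ∀ t, 0 ≤ t → t < 1 → 0 < Q t) :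
    SteepZero fun u => s u ^ m * Q u := by
  obtain ⟨r, rfl⟩ : ∃ r, m = r + 1 := ⟨m - 1, by omega⟩
  refine ⟨(hs.pow _).mul hQ, fun t h0 h1 => mul_pos (pow_pos (hspos t h0 h1) _) (hQpos t h0 h1),
    by simp [h1], fun K => ?_⟩
  have hds : ∀ u, HasDerivAt s (deriv s u) u := fun u =>
    (hs.differentiable one_ne_zero u).hasDerivAt
  have hdQ : ∀ u, HasDerivAt Q (deriv Q u) u := fun u =>
    (hQ.differentiable one_ne_zero u).hasDerivAt
  have hda : ∀ u, deriv (fun u => s u ^ (r + 1) * Q u) u =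
      s u ^ r * ((r + 1) * deriv s u * Q u + s u * deriv Q u) := by
    intro u
    have := ((hds u).fun_pow (r + 1)).fun_mul (hdQ u)
    rw [this.deriv]
    push_cast
    ring
  have hc : Continuous fun u =>
      -((r + 1) * deriv s u * Q u + s u * deriv Q u) - K * (s u * Q u) := by
    have c1 := hs.continuous_deriv le_rfl
    have c2 := hQ.continuous_deriv le_rfl
    have c3 := hs.continuous
    have c4 := hQ.continuous
    fun_prop
  have hev := hc.continuousAt (x := 1) |>.eventually (lt_mem_nhds (a := (0 : ℝ)) (by
    simp only [h1]
    have : 0 < (r + 1 : ℝ) * (-deriv s 1) * Q 1 := by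
      have := neg_pos.2 hd
      positivity
    linarith))
  filter_upwards [nhdsWithin_le_nhds hev, Ioo_mem_nhdsLT (zero_lt_one (α := ℝ))] with u hu hu2
  rw [hda]
  have := mul_pos (pow_pos (hspos u hu2.1.le hu2.2) r) hu
  rw [pow_succ]
  linarith

/-- Inside (0, π) the zeros are the simple zeros of F(cos θ), since sin θ > 0. At the poles F(±1) ≠
0 and the factor sin^m alone vanishes, so `steepZero_of_pow` applies. -/
theorem grid_sphHarm {n m : ℕ} (hm : 1 ≤ m) (hmn : m ≤ n) :
    ∃ θ : ℕ → ℝ, Grid (n - m) (fun x => Real.sin x ^ m * legendreF n m (Real.cos x)) θ := by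
  obtain ⟨θ, h0, hl, hlt, hsign, hz⟩ := exists_zeros_legendreF hmn
  set W : ℝ → ℝ := fun x => legendreF n m (Real.cos x) with hW
  have hWc : ContDiff ℝ 1 W :=
    ((contDiff_legendreF n m).of_le le_top).comp (Real.contDiff_cos.of_le le_top)
  have hmono : ∀ i j, i ≤ j → j ≤ n - m + 1 → θ i ≤ θ j := by
    intro i j hij
    induction j, hij using Nat.le_induction with
    | base => intro _; exact le_rfl
    | succ j hij ih => intro hj; exact (ih (by omega)).trans (hlt j (by omega)).le
  have hI : ∀ i ≤ n - m, ∀ x ∈ Set.Ioo (θ i) (θ (i + 1)), 0 < x ∧ x < Real.pi := by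
    intro i hi x hx
    have h1 := hmono 0 i (Nat.zero_le _) (by omega)
    have h2 := hmono (i + 1) (n - m + 1) (by omega) le_rfl
    rw [h0] at h1
    rw [hl] at h2
    exact ⟨h1.trans_lt hx.1, hx.2.trans_le h2⟩
  have hsin : ∀ i ≤ n - m, ∀ x ∈ Set.Ioo (θ i) (θ (i + 1)), 0 < Real.sin x := fun i hi x hx =>
    Real.sin_pos_of_pos_of_lt_pi (hI i hi x hx).1 (hI i hi x hx).2
  have hAc : ContDiff ℝ 1 fun x => Real.sin x ^ m * legendreF n m (Real.cos x) :=
    ((Real.contDiff_sin.of_le le_top).pow m).mul hWc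
  have hAsign : ∀ i ≤ n - m, ∀ x ∈ Set.Ioo (θ i) (θ (i + 1)),
      0 < (-1) ^ i * (Real.sin x ^ m * legendreF n m (Real.cos x)) := by
    intro i hi x hx
    have := mul_pos (pow_pos (hsin i hi x hx) m) (hsign i hi x hx)
    linarith
  have hsimple : ∀ i, 1 ≤ i → i ≤ n - m →
      (fun x => Real.sin x ^ m * legendreF n m (Real.cos x)) (θ i) = 0 ∧
      deriv (fun x => Real.sin x ^ m * legendreF n m (Real.cos x)) (θ i) ≠ 0 := by
    intro i h1 h2
    obtain ⟨hz0, hz1⟩ := hz i h1 h2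
    refine ⟨by simp [hz0], ?_⟩
    have hθ1 : 0 < θ i := by
      have a := hmono 0 (i - 1) (Nat.zero_le _) (by omega)
      have b := hlt (i - 1) (by omega)
      rw [show i - 1 + 1 = i by omega] at b
      rw [h0] at a
      linarith
    have hθ2 : θ i < Real.pi := by
      have a := hmono (i + 1) (n - m + 1) (by omega) le_rfl
      have b := hlt i h2
      rw [hl] at a
      linarith
    have hd1 := (Real.hasDerivAt_sin (θ i)).fun_pow m
    have hd2 : HasDerivAt W (deriv W (θ i)) (θ i) :=
      (hWc.differentiable one_ne_zero _).hasDerivAt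
    have hd := hd1.fun_mul hd2
    have : deriv (fun x => Real.sin x ^ m * legendreF n m (Real.cos x)) (θ i) =
        Real.sin (θ i) ^ m * deriv W (θ i) := by
      rw [hd.deriv]
      simp only [hW, hz0]
      ring
    rw [this]
    have := Real.sin_pos_of_pos_of_lt_pi hθ1 hθ2
    exact mul_ne_zero (by positivity) hz1
  have hmem : ∀ i ≤ n - m, ∀ (b : Bool) (t : ℝ), 0 ≤ t → t < 1 →
      midpt θ i + sg b * halfWidth θ i * t ∈ Set.Ioo (θ i) (θ (i + 1)) := by
    intro i hi b t ht0 ht1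
    have := hlt i hi
    cases b <;> simp only [sg_true, sg_false, midpt, halfWidth] <;> constructor <;> nlinarith
  refine ⟨θ, h0, hl, hlt, hAsign, hAc, hsimple, ?_⟩
  intro i hi b
  have hlin : ContDiff ℝ 1 fun u : ℝ => midpt θ i + sg b * halfWidth θ i * u := by fun_prop
  have hlind : HasDerivAt (fun u : ℝ => midpt θ i + sg b * halfWidth θ i * u)
      (sg b * halfWidth θ i * 1) 1 := ((hasDerivAt_id (1 : ℝ)).const_mul _).const_add _
  have hw : 0 < halfWidth θ i := by
    have := hlt i hi
    simp only [halfWidth]; linarith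
  by_cases hp : IsPolar (n - m) i b
  · have heq : (fun u => (-1) ^ i * ((fun x => Real.sin x ^ m * legendreF n m (Real.cos x))
        (midpt θ i + sg b * halfWidth θ i * u))) =
        fun u => Real.sin (midpt θ i + sg b * halfWidth θ i * u) ^ m *
          ((-1) ^ i * W (midpt θ i + sg b * halfWidth θ i * u)) := by
      funext u; simp only [hW]; ring
    rw [heq]
    have hQpos : ∀ t, 0 ≤ t → t < 1 →
        0 < (-1) ^ i * W (midpt θ i + sg b * halfWidth θ i * t) := fun t h0 h1 =>
      hsign i hi _ (hmem i hi b t h0 h1)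
    have hend : Real.cos (θ (i + b.toNat)) * sg b = -1 ∧ Real.sin (θ (i + b.toNat)) = 0 ∧
        W (θ (i + b.toNat)) ≠ 0 := by
      have hW1 : legendreF n m 1 ≠ 0 := by rw [legendreF_one hmn]; exact one_ne_zero
      have hW2 : legendreF n m (-1) ≠ 0 :=
        div_ne_zero (derivative_legendreP_ne_zero_of_one_le_abs hmn (by simp))
          (derivative_legendreP_eval_one_pos hmn).ne'
      cases b
      · simp only [IsPolar, Bool.false_eq_true, if_false] at hp
        subst hp
        simpa [h0, hW] using hW1
      · simp only [IsPolar, if_true] at hp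
        subst hp
        simpa [hl, hW] using hW2
    refine steepZero_of_pow hm ((Real.contDiff_sin.of_le le_top).comp hlin)
      (contDiff_const.mul (hWc.comp hlin)) ?_ ?_ ?_ ?_ hQpos
    · rw [midpt_add_sg]; exact hend.2.1
    · have hd := (Real.hasDerivAt_sin (midpt θ i + sg b * halfWidth θ i * 1)).comp (1 : ℝ) hlind
      simp only [Function.comp_def] at hd
      rw [hd.deriv, midpt_add_sg]
      have : Real.cos (θ (i + b.toNat)) * (sg b * halfWidth θ i * 1) =
        (Real.cos (θ (i + b.toNat)) * sg b) * halfWidth θ i := by ring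
      rw [this, hend.1]
      linarith
    · have hcont : Continuous fun t => (-1) ^ i * W (midpt θ i + sg b * halfWidth θ i * t) :=
        continuous_const.mul (hWc.continuous.comp hlin.continuous)
      have hge : 0 ≤ (-1) ^ i * W (midpt θ i + sg b * halfWidth θ i * 1) := by
        refine ge_of_tendsto (hcont.continuousAt (x := 1) |>.tendsto.mono_left
          (nhdsWithin_le_nhds (s := Set.Iio 1))) ?_
        filter_upwards [Ioo_mem_nhdsLT (zero_lt_one (α := ℝ))] with t ht
        exact (hQpos t ht.1.le ht.2).le
      refine lt_of_le_of_ne hge (Ne.symm (mul_ne_zero (by positivity) ?_))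
      rw [midpt_add_sg]; exact hend.2.2
    · exact fun t h0 h1 => hsin i hi _ (hmem i hi b t h0 h1)
  · have hsim : 1 ≤ i + b.toNat ∧ i + b.toNat ≤ n - m := by
      cases b <;> simp [IsPolar] at hp ⊢ <;> omega
    obtain ⟨hz0, hz1⟩ := hsimple _ hsim.1 hsim.2
    have hpos : ∀ t, 0 ≤ t → t < 1 → 0 < (-1) ^ i *
        ((fun x => Real.sin x ^ m * legendreF n m (Real.cos x))
          (midpt θ i + sg b * halfWidth θ i * t)) := fun t h0 h1 =>
      hAsign i hi _ (hmem i hi b t h0 h1)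
    have hzero : (-1) ^ i * ((fun x => Real.sin x ^ m * legendreF n m (Real.cos x))
        (midpt θ i + sg b * halfWidth θ i * 1)) = 0 := by
      rw [midpt_add_sg, hz0, mul_zero]
    have hAd := (hAc.differentiable one_ne_zero (midpt θ i + sg b * halfWidth θ i * 1)).hasDerivAt
    have hd := (hAd.comp (1 : ℝ) hlind).const_mul ((-1) ^ i)
    simp only [Function.comp_def] at hd
    rw [midpt_add_sg] at hd
    refine steepZero_of_simple (contDiff_const.mul (hAc.comp hlin)) hpos hzero ?_
    rw [hd.deriv]
    refine deriv_neg_of_pos_of_zero hpos hzero hd ?_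
    have hsg : sg b ≠ 0 := by cases b <;> simp
    positivity

/-! ### Smooth extensions and tangent directions -/

/-- The polynomial extension of `sphHarm n m` to space. -/
noncomputable def solidHarm (n m : ℕ) (x : E3) : ℝ :=
  (((⟨x 0, x 1⟩ : ℂ) ^ m).im) * legendreF n m (x 2)

theorem contDiff_solidHarm (n m : ℕ) : ContDiff ℝ ⊤ (solidHarm n m) := by
  have hc : ∀ i : Fin 3, ContDiff ℝ ⊤ fun x : E3 => x i := fun i =>
    contDiff_euclidean.1 contDiff_id i
  have h1 : ContDiff ℝ ⊤ fun x : E3 => (⟨x 0, x 1⟩ : ℂ) := by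
    have : (fun x : E3 => (⟨x 0, x 1⟩ : ℂ)) =
        fun x : E3 => Complex.ofRealCLM (x 0) + Complex.ofRealCLM (x 1) * Complex.I := by
      funext x; exact Complex.mk_eq_add_mul_I _ _
    rw [this]
    exact (Complex.ofRealCLM.contDiff.comp (hc 0)).add
      ((Complex.ofRealCLM.contDiff.comp (hc 1)).mul contDiff_const)
  exact (Complex.imCLM.contDiff.comp (h1.pow m)).mul ((contDiff_legendreF n m).comp (hc 2))

/-- The action of a rotation on space. -/
noncomputable def rotateE (R : SO3) (x : E3) : E3 :=
  WithLp.toLp 2 ((R : Matrix (Fin 3) (Fin 3) ℝ).mulVec (WithLp.ofLp x))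

theorem contDiff_rotateE (R : SO3) : ContDiff ℝ ⊤ (rotateE R) := by
  have hc : ∀ i : Fin 3, ContDiff ℝ ⊤ fun x : E3 => x i := fun i =>
    contDiff_euclidean.1 contDiff_id i
  rw [contDiff_euclidean]
  intro i
  have : (fun x : E3 => (rotateE R x) i) =
      fun x : E3 => ∑ j, (R : Matrix (Fin 3) (Fin 3) ℝ) i j * x j := by
    funext x; rfl
  rw [this]
  exact ContDiff.sum fun j _ => contDiff_const.mul (hc j)

/-- A zero in an active kite is a regular point of the nodal set. -/
theorem exists_tangent_of_kite {hE : E3 → ℝ} (hh : ContDiff ℝ ⊤ hE) {m : ℕ} {θ : ℕ → ℝ} {i : ℕ}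
    {j : ℤ} {b c lat : Bool} {q : ℝ × ℝ}
    (hq : fderiv ℝ (fun q => hE (chart m θ i j b c lat q)) q q ≠ 0) :
    ∃ w : E3, inner ℝ (chart m θ i j b c lat q : E3) w = 0 ∧
      fderiv ℝ hE (chart m θ i j b c lat q) w ≠ 0 := by
  set Ψ : ℝ × ℝ → E3 := fun q => (chart m θ i j b c lat q : E3) with hΨ
  have hΨd : HasFDerivAt Ψ (fderiv ℝ Ψ q) q :=
    ((contDiff_chart m θ i j b c lat).differentiable (by simp) q).hasFDerivAt
  have hhd : HasFDerivAt hE (fderiv ℝ hE (Ψ q)) (Ψ q) :=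
    (hh.differentiable (by simp) _).hasFDerivAt
  -- The image under the chart of the radial direction of the kite; differentiating |Ψ|² = 1 shows
  -- that it is tangent to the sphere.
  refine ⟨fderiv ℝ Ψ q q, ?_, ?_⟩
  · have h1 := (hΨd.inner ℝ hΨd)
    have h2 : (fun t => inner ℝ (Ψ t) (Ψ t)) = fun _ => (1 : ℝ) := by
      funext t
      rw [real_inner_self_eq_norm_sq, mem_sphere_zero_iff_norm.1 (chart m θ i j b c lat t).2]
      norm_num
    rw [h2] at h1
    have h3 := h1.unique (hasFDerivAt_const (1 : ℝ) q)
    have h4 := congrArg (fun L => L q) h3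
    simp only [ContinuousLinearMap.comp_apply, fderivInnerCLM_apply,
      ContinuousLinearMap.prod_apply] at h4
    rw [real_inner_comm (Ψ q)] at h4
    have h5 : inner ℝ (Ψ q) (fderiv ℝ Ψ q q) + inner ℝ (Ψ q) (fderiv ℝ Ψ q q) = (0 : ℝ) := h4
    linarith
  · have h1 := hhd.comp q hΨd
    have h2 : fderiv ℝ (fun q => hE (chart m θ i j b c lat q)) q =
        (fderiv ℝ hE (Ψ q)).comp (fderiv ℝ Ψ q) := h1.fderiv
    rw [h2] at hq
    exact hq

/-! ### Bounds for each degree and the limit -/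

theorem Grid.strictMonoOn {k : ℕ} {A : ℝ → ℝ} {θ : ℕ → ℝ} (H : Grid k A θ) {i j : ℕ} (hij : i < j)
    (hj : j ≤ k + 1) : θ i < θ j := by
  induction j, hij using Nat.le_induction with
  | base => exact H.lt i (by omega)
  | succ j hij ih => exact (ih (by omega)).trans (H.lt j (by omega))

/-- A strictly decreasing sequence changes sign at most once, hence has at most two consecutive
pairs of terms with nonpositive product. -/
theorem card_filter_mul_nonpos_le_two {k : ℕ} {c : ℕ → ℝ}
    (hc : ∀ i j, 1 ≤ i → i < j → j ≤ k → c j < c i) :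
    ((Finset.Ico 1 k).filter fun i => ¬ 0 < c i * c (i + 1)).card ≤ 2 := by
  set s := (Finset.Ico 1 k).filter fun i => ¬ 0 < c i * c (i + 1) with hs
  rcases s.eq_empty_or_nonempty with h | h
  · simp [h]
  · set a := s.min' h with ha
    have hmem : ∀ i ∈ s, 1 ≤ i ∧ i < k ∧ c i * c (i + 1) ≤ 0 := by
      intro i hi
      rw [hs, Finset.mem_filter, Finset.mem_Ico, not_lt] at hi
      exact ⟨hi.1.1, hi.1.2, hi.2⟩
    obtain ⟨a1, a2, a3⟩ := hmem a (s.min'_mem h)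
    have hneg : c (a + 1) ≤ 0 := by
      by_contra! h0
      have := hc a (a + 1) a1 (by omega) (by omega)
      nlinarith
    refine (Finset.card_le_card (t := {a, a + 1}) fun i hi => ?_).trans Finset.card_le_two
    obtain ⟨i1, i2, i3⟩ := hmem i hi
    have hai : a ≤ i := s.min'_le i hi
    by_contra hne
    simp only [Finset.mem_insert, Finset.mem_singleton, not_or] at hne
    have h1 := hc (a + 1) i (by omega) (by omega) (by omega)
    have h2 := hc (a + 1) (i + 1) (by omega) (by omega) (by omega)
    nlinarith

theorem exists_rotation_ov_bounds {n l m : ℕ} (hm : 2 ≤ m) (hl : l = 2 * m)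
    (hn : n = l ∨ n = l + 1) :
    ∃ R : SO3, ∃ ε₀ > 0, ∀ ε, 0 < ε → ε < ε₀ → NonSingularNodalSet (perturbed n m l ε R) ∧
      m * (n - m) ≤ ov (perturbed n m l ε R) + 3 * m ∧
      ov (perturbed n m l ε R) ≤ m * (n - m) + 64 * m := by
  have hm1 : 1 ≤ m := by omega
  obtain ⟨θ, H⟩ := grid_sphHarm (n := n) hm1 (by omega)
  set k := n - m with hk
  have hθ : ∀ i, 1 ≤ i → i ≤ k → 0 < θ i ∧ θ i < Real.pi := by
    intro i h1 h2
    rw [← H.left, ← H.right]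
    exact ⟨H.strictMonoOn (by omega) (by omega), H.strictMonoOn (by omega) le_rfl⟩
  obtain ⟨R, hRV, hR0, hRπ⟩ := exists_rotation hm1 hl hn ((Finset.Icc 1 k).image θ) (by
    intro x hx
    obtain ⟨i, hi, rfl⟩ := Finset.mem_image.1 hx
    rw [Finset.mem_Icc] at hi
    exact hθ i hi.1 hi.2)
  set g : S2 → ℝ := fun p => sphHarm n l (rotate R p) with hg
  set c : ℕ → ℝ := fun i => legendreF n l (Real.cos (θ i)) with hc
  have hV : ∀ i, 1 ≤ i → i ≤ k → ∀ j, vertexValue m θ g i j ≠ 0 ∧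
      (c i ≠ 0 → 0 < c i * vertexValue m θ g i j) := by
    intro i h1 h2 j
    have := hRV (θ i) (Finset.mem_image_of_mem θ (Finset.mem_Icc.2 ⟨h1, h2⟩)) j
    rw [mul_div_right_comm] at this
    exact this
  have hne : ∀ i ≤ k + 1, ∀ j, vertexValue m θ g i j ≠ 0 := by
    intro i hi j
    rcases Nat.eq_zero_or_pos i with rfl | h1
    · rw [vertexValue, H.left]; exact hR0 _
    · rcases hi.eq_or_lt with rfl | h2
      · rw [vertexValue, H.right]; exact hRπ _
      · exact (hV i h1 (by omega) j).1
  have hgE : ContDiff ℝ ⊤ fun x => solidHarm n l (rotateE R x) :=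
    (contDiff_solidHarm n l).comp (contDiff_rotateE R)
  have hev := H.eventually_resolved (f := sphHarm n m) (g := g) hm1
    (fun x φ => sphHarm_sphPoint n m x φ) (fun p => rfl) hgE hne
  obtain ⟨ε₀, hε₀, hε⟩ := (mem_nhdsGT_iff_exists_Ioo_subset).1 hev
  -- The good rows: not polar, and with the same sign of the perturbation on both bounding circles.
  -- Of the k + 1 rows at most four are lost, at 16 m components each, whence 64 m; and k ≤ |I| + 3
  -- gives the 3 m in the lower bound.
  set I := (Finset.Ico 1 k).filter fun i => 0 < c i * c (i + 1) with hI
  have hbad : ((Finset.Ico 1 k).filter fun i => ¬ 0 < c i * c (i + 1)).card ≤ 2 := by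
    rcases hn with h | h
    · have : ∀ i, c i = 1 := fun i => by rw [hc, h]; exact legendreF_self l _
      simp [this]
    · refine card_filter_mul_nonpos_le_two fun i j h1 hij hj => ?_
      have : ∀ i, c i = Real.cos (θ i) := fun i => by rw [hc, h]; exact legendreF_pred l _
      rw [this, this]
      exact Real.cos_lt_cos_of_nonneg_of_le_pi (hθ i h1 (by omega)).1.le
        (hθ j (by omega) hj).2.le (H.strictMonoOn hij (by omega))
  have hcard := Finset.card_filter_add_card_filter_not (s := Finset.Ico 1 k)
    (fun i => 0 < c i * c (i + 1))
  rw [Nat.card_Ico, ← hI] at hcard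
  refine ⟨R, ε₀, hε₀, fun ε h0 h1 => ?_⟩
  have hR : Resolved m k θ (vertexValue m θ g) (perturbed n m l ε R) := hε ⟨h0, h1⟩
  obtain ⟨hfin, hlo, hup⟩ := H.ov_bounds hm hR hne (vertexValue_add_period hm1) I
    (fun i hi => Finset.mem_Ico.1 (Finset.mem_filter.1 hi).1) c (by
      intro i hi j
      obtain ⟨hi1, hi2⟩ := Finset.mem_filter.1 hi
      rw [Finset.mem_Ico] at hi1
      have n1 : c i ≠ 0 := left_ne_zero_of_mul hi2.ne'
      have n2 : c (i + 1) ≠ 0 := right_ne_zero_of_mul hi2.ne'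
      refine ⟨(hV i hi1.1 (by omega) j).2 n1, ?_⟩
      have h3 := (hV (i + 1) (by omega) (by omega) j).2 n2
      have h4 : 0 < c (i + 1) * c (i + 1) := mul_self_pos.2 n2
      have h5 := mul_pos hi2 h3
      have h6 : c i * c (i + 1) * (c (i + 1) * vertexValue m θ g (i + 1) j) =
        (c (i + 1) * c (i + 1)) * (c i * vertexValue m θ g (i + 1) j) := by ring
      rw [h6] at h5
      exact (pos_iff_pos_of_mul_pos h5).1 h4)
  refine ⟨nonSingularNodalSet_of_regular
    (h := fun x => solidHarm n m x + ε * solidHarm n l (rotateE R x)) (fun p => rfl)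
    ((contDiff_solidHarm n m).add (contDiff_const.mul hgE)) ?_ hfin, ?_, ?_⟩
  · intro p hp
    obtain ⟨i, hi, j, b, d, lat, hact, q, hq, rfl⟩ := H.exists_active hm1 hR hne hp
    exact exists_tangent_of_kite ((contDiff_solidHarm n m).add (contDiff_const.mul hgE))
      ((hR.kite_zeros i hi j b d lat hact).regular q hq hp)
  · have : k ≤ I.card + 3 := by omega
    nlinarith
  · have h2 : k + 1 - I.card ≤ 4 := by omega
    have h3 : I.card ≤ k := by omega
    have h4 := Nat.mul_le_mul_left (16 * m) h2
    have h5 := Nat.mul_le_mul_left m h3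
    linarith

theorem tendsto_div_sq_of_bounds {u : ℕ → ℕ} (hlo : ∀ᶠ n in atTop,
    n / 2 * (n - n / 2) ≤ u n + 3 * (n / 2))
    (hup : ∀ᶠ n in atTop, u n ≤ n / 2 * (n - n / 2) + 64 * (n / 2)) :
    Tendsto (fun n : ℕ => (u n : ℝ) / ((n : ℝ) ^ 2 / 4)) atTop (𝓝 1) := by
  have hlim : ∀ C : ℝ, Tendsto (fun n : ℕ => 1 + C * (1 / (n : ℝ))) atTop (𝓝 1) := by
    intro C
    simpa using (tendsto_one_div_atTop_nhds_zero_nat.const_mul C).const_add 1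
  have hhalf : ∀ n : ℕ, ∃ r : ℝ, 0 ≤ r ∧ r ≤ 1 ∧ ((n / 2 : ℕ) : ℝ) = (n - r) / 2 ∧
      ((n - n / 2 : ℕ) : ℝ) = (n + r) / 2 := by
    intro n
    have h1 : ((n / 2 : ℕ) : ℝ) * 2 + ((n % 2 : ℕ) : ℝ) = n := by
      exact_mod_cast (by omega : n / 2 * 2 + n % 2 = n)
    have h2 : ((n % 2 : ℕ) : ℝ) ≤ 1 := by exact_mod_cast (by omega : n % 2 ≤ 1)
    refine ⟨((n % 2 : ℕ) : ℝ), Nat.cast_nonneg _, h2, by linarith, ?_⟩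
    rw [Nat.cast_sub (Nat.div_le_self _ _)]
    linarith
  -- With r = n mod 2 the product is (n² - r²)/4. The loss of at most 3n/2 = 6n/4, plus n/4
  -- absorbing r²/4, gives -7; the excess of at most 64 · n/2 = 128 n/4 gives 128.
  refine tendsto_of_tendsto_of_tendsto_of_le_of_le' (hlim (-7)) (hlim 128) ?_ ?_
  · filter_upwards [hlo, eventually_ge_atTop 1] with n hn h1
    obtain ⟨r, r0, r1, e1, e2⟩ := hhalf n
    have hn' : ((n / 2 : ℕ) : ℝ) * ((n - n / 2 : ℕ) : ℝ) ≤ u n + 3 * ((n / 2 : ℕ) : ℝ) := by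
      exact_mod_cast hn
    rw [e1, e2] at hn'
    have h1' : (1 : ℝ) ≤ n := by exact_mod_cast h1
    rw [le_div_iff₀ (by positivity)]
    have : (1 + -7 * (1 / (n : ℝ))) * ((n : ℝ) ^ 2 / 4) = ((n : ℝ) ^ 2 - 7 * n) / 4 := by
      field_simp; ring
    rw [this]
    nlinarith
  · filter_upwards [hup, eventually_ge_atTop 1] with n hn h1
    obtain ⟨r, r0, r1, e1, e2⟩ := hhalf n
    have hn' : (u n : ℝ) ≤ ((n / 2 : ℕ) : ℝ) * ((n - n / 2 : ℕ) : ℝ) +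
        64 * ((n / 2 : ℕ) : ℝ) := by
      exact_mod_cast hn
    rw [e1, e2] at hn'
    have h1' : (1 : ℝ) ≤ n := by exact_mod_cast h1
    rw [div_le_iff₀ (by positivity)]
    have : (1 + 128 * (1 / (n : ℝ))) * ((n : ℝ) ^ 2 / 4) = ((n : ℝ) ^ 2 + 128 * n) / 4 := by
      field_simp
    rw [this]
    nlinarith

end NodalOvals

theorem theorem3 :
    ∃ (N : ℕ) (ε₀ : ℕ → ℝ) (R : ℕ → NodalOvals.SO3),
      (∀ n, N ≤ n → 0 < ε₀ n) ∧
      (∀ n, N ≤ n → ∀ ε : ℝ, 0 < ε → ε < ε₀ n →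
        (Odd n → NodalOvals.NonSingularNodalSet
          (NodalOvals.perturbed n (n / 2) (n - 1) ε (R n))) ∧
        (Even n → NodalOvals.NonSingularNodalSet
          (NodalOvals.perturbed n (n / 2) n ε (R n)))) ∧
      (∀ ε : ℕ → ℝ, (∀ n, N ≤ n → 0 < ε n ∧ ε n < ε₀ n) →
        Tendsto (fun n : ℕ =>
            (NodalOvals.ov (NodalOvals.perturbed n (n / 2) (n - 1) (ε n) (R n)) : ℝ)
              / ((n : ℝ) ^ 2 / 4))
          (atTop ⊓ 𝓟 {n : ℕ | Odd n}) (𝓝 1) ∧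
        Tendsto (fun n : ℕ =>
            (NodalOvals.ov (NodalOvals.perturbed n (n / 2) n (ε n) (R n)) : ℝ)
              / ((n : ℝ) ^ 2 / 4))
          (atTop ⊓ 𝓟 {n : ℕ | Even n}) (𝓝 1)) := by
  -- The order 2⌊n/2⌋ is n - 1 for odd n and n for even n, so one statement covers both parities; n
  -- ≥ 4 provides m ≥ 2. For smaller n the values are placeholders.
  have key : ∀ n : ℕ, ∃ R : NodalOvals.SO3, ∃ ε₀ : ℝ, 4 ≤ n → 0 < ε₀ ∧
      ∀ ε, 0 < ε → ε < ε₀ →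
        NodalOvals.NonSingularNodalSet (NodalOvals.perturbed n (n / 2) (2 * (n / 2)) ε R) ∧
        n / 2 * (n - n / 2) ≤
          NodalOvals.ov (NodalOvals.perturbed n (n / 2) (2 * (n / 2)) ε R) + 3 * (n / 2) ∧
        NodalOvals.ov (NodalOvals.perturbed n (n / 2) (2 * (n / 2)) ε R) ≤
          n / 2 * (n - n / 2) + 64 * (n / 2) := by
    intro n
    by_cases hn : 4 ≤ n
    · obtain ⟨R, ε₀, h0, h⟩ := NodalOvals.exists_rotation_ov_bounds (n := n) (m := n / 2)
        (by omega) rfl (by omega)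
      exact ⟨R, ε₀, fun _ => ⟨h0, h⟩⟩
    · exact ⟨1, 1, fun h => absurd h hn⟩
  choose R ε₀ key using key
  have hodd : ∀ n, Odd n → n - 1 = 2 * (n / 2) := by
    rintro n ⟨t, rfl⟩; omega
  have heven : ∀ n, Even n → n = 2 * (n / 2) := by
    rintro n ⟨t, rfl⟩; omega
  refine ⟨4, ε₀, R, fun n hn => (key n hn).1, fun n hn ε h0 h1 => ?_, fun ε hε => ?_⟩
  · have h := ((key n hn).2 ε h0 h1).1
    refine ⟨fun ho => ?_, fun he => ?_⟩
    · rwa [hodd n ho]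
    · rwa [← heven n he] at h
  · have hk : ∀ᶠ n in atTop, 4 ≤ n := eventually_ge_atTop 4
    have hlim := NodalOvals.tendsto_div_sq_of_bounds
      (u := fun n => NodalOvals.ov (NodalOvals.perturbed n (n / 2) (2 * (n / 2)) (ε n) (R n)))
      (hk.mono fun n hn => ((key n hn).2 _ (hε n hn).1 (hε n hn).2).2.1)
      (hk.mono fun n hn => ((key n hn).2 _ (hε n hn).1 (hε n hn).2).2.2)
    constructor
    · refine (hlim.mono_left inf_le_left).congr' ?_
      filter_upwards [mem_inf_of_right (mem_principal_self _)] with n hn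
      have hn : Odd n := hn
      rw [hodd n hn]
    · refine (hlim.mono_left inf_le_left).congr' ?_
      filter_upwards [mem_inf_of_right (mem_principal_self _)] with n hn
      have hn : Even n := hn
      rw [← heven n hn]
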